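/- Let $n\ge 1$ be an integer. For $k\in\{0,1,2,\dots\}$ and $\gamma\in(0,1)$, let $C^{k+\gamma}(\mathbb R^n;\mathbb R^m)$ be the space of $k$ times continuously differentiable functions $u:\mathbb R^n\to\mathbb R^m$ with $$\|u\|_{C^{k+\gamma}}:=\sup_{|\beta|\le k}\ \sup_{x}|D^\beta u(x)|+\sup_{|\beta|\le k}\ \sup_{x\ne y}\frac{|D^\beta u(x)-D^\beta u(y)|}{|x-y|^\gamma}<\infty ,$$ where $\beta$ runs over multi-indices, and write $C^{k+\gamma}(\mathbb R^n)$ when $m=1$. For $s\in(0,1)$ let $$(-\Delta)^su(x)=c_{n,s}\,\lim_{\varepsilon\downarrow0}\int_{|x-y|>\varepsilon}\frac{u(x)-u(y)}{|x-y|^{n+2s}}\,dy,\qquad c_{n,s}=\frac{4^s\,s\,\Gamma(n/2+s)}{\pi^{n/2}\,\Gamma(1-s)} .$$ **Lemma.** Let $s\in(1/2,1)$, and let $\alpha\in(0,1)$ be such that $2s+\alpha$ is not an integer. Let $c_0>0$ and $M_b,M_c\ge 0$. Then there is a constant $C>0$, depending only on $\alpha$, $M_b$, $M_c$, $c_0$,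 $n$ and $s$, such that the following holds. Let $b\in C^\alpha(\mathbb R^n;\mathbb R^n)$ and $c\in C^\alpha(\mathbb R^n)$ satisfy $\|b\|_{C^\alpha}\le M_b$, $\|c\|_{C^\alpha}\le M_c$ and $c(x)\ge c_0$ for all $x\in\mathbb R^n$. Then for every $f\in C^\alpha(\mathbb R^n)$ there is a unique $u\in C^{2s+\alpha}(\mathbb R^n)$ such that $$(-\Delta)^su(x)+b(x)\cdot\nabla u(x)+c(x)u(x)=f(x)\qquad\text{for all }x\in\mathbb R^n$$ (in particular, the limit that defines $(-\Delta)^su(x)$ exists for all $x$), and this solution satisfies $$\|u\|_{C^{2s+\alpha}(\mathbb R^n)}\le C\,\|f\|_{C^\alpha(\mathbb R^n)} .$$ -/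

import Mathlib

open MeasureTheory Filter Topology
open scoped NNReal ENNReal Gradient

namespace FracDrift

/-- The iterated partial derivative `∂_{i 0} ⋯ ∂_{i (j-1)} u (x)` of order `j`. As `i` runs over all
maps `Fin j → Fin n`, these are all the derivatives `D^β u (x)` with `β` a multi-index of length `j`. -/
noncomputable def partialDeriv {n : ℕ} {F : Type*} [NormedAddCommGroup F] [NormedSpace ℝ F]
    {j : ℕ} (i : Fin j → Fin n) (u : EuclideanSpace ℝ (Fin n) → F)
    (x : EuclideanSpace ℝ (Fin n)) : F :=
  iteratedFDeriv ℝ j u x (fun l => EuclideanSpace.single (i l) (1 : ℝ))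

/-- `‖u‖_{C^k} = sup_{|β| ≤ k} sup_x |D^β u (x)|`, with values in `[0, ∞]`. -/
noncomputable def ckENorm {n : ℕ} {F : Type*} [NormedAddCommGroup F] [NormedSpace ℝ F]
    (k : ℕ) (u : EuclideanSpace ℝ (Fin n) → F) : ℝ≥0∞ :=
  ⨆ (j : ℕ) (_ : j ≤ k) (i : Fin j → Fin n) (x : EuclideanSpace ℝ (Fin n)), ‖partialDeriv i u x‖ₑ

/-- `[u]_{C^{k+γ}} = sup_{|β| ≤ k} sup_{x ≠ y} |D^β u (x) - D^β u (y)| / |x - y|^γ`,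
with values in `[0, ∞]`. -/
noncomputable def holderESeminorm {n : ℕ} {F : Type*} [NormedAddCommGroup F] [NormedSpace ℝ F]
    (k : ℕ) (γ : ℝ≥0) (u : EuclideanSpace ℝ (Fin n) → F) : ℝ≥0∞ :=
  ⨆ (j : ℕ) (_ : j ≤ k) (i : Fin j → Fin n), eHolderNorm γ (partialDeriv i u)

/-- The norm of `C^θ(ℝⁿ; F)` for a positive non-integer `θ = k + γ`, with `k = ⌊θ⌋` and
`γ = θ - k ∈ (0, 1)`, with values in `[0, ∞]`. -/
noncomputable def holderENorm {n : ℕ} {F : Type*} [NormedAddCommGroup F] [NormedSpace ℝ F]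
    (θ : ℝ) (u : EuclideanSpace ℝ (Fin n) → F) : ℝ≥0∞ :=
  ckENorm ⌊θ⌋₊ u + holderESeminorm ⌊θ⌋₊ (Int.fract θ).toNNReal u

/-- Membership in the Hölder space `C^θ(ℝⁿ; F)`, for a positive non-integer `θ`. -/
def MemHolderSpace {n : ℕ} {F : Type*} [NormedAddCommGroup F] [NormedSpace ℝ F]
    (θ : ℝ) (u : EuclideanSpace ℝ (Fin n) → F) : Prop :=
  ContDiff ℝ (⌊θ⌋₊ : ℕ) u ∧ holderENorm θ u < ∞

/-- The normalizing constant `c_{n,s} = 4^s s Γ(n/2 + s) / (π^{n/2} Γ(1 - s))`, for which `(-Δ)^s`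
is the Fourier multiplier with symbol `|ξ|^{2s}`. -/
noncomputable def fracLapConst (n : ℕ) (s : ℝ) : ℝ :=
  4 ^ s * s * Real.Gamma ((n : ℝ) / 2 + s) / (Real.pi ^ ((n : ℝ) / 2) * Real.Gamma (1 - s))

/-- The integrand `y ↦ (u x - u y) / |x - y|^{n + 2s}` of the fractional Laplacian. -/
noncomputable def fracLapIntegrand {n : ℕ} (s : ℝ) (u : EuclideanSpace ℝ (Fin n) → ℝ)
    (x y : EuclideanSpace ℝ (Fin n)) : ℝ :=
  (u x - u y) / ‖x - y‖ ^ ((n : ℝ) + 2 * s)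

/-- `(-Δ)^s u (x)` exists as a principal value integral and is equal to `ℓ`: the integrals over
`{|x - y| > ε}` converge absolutely, and after multiplication by `c_{n,s}` they tend to `ℓ` as
`ε ↓ 0`. -/
def HasFracLaplacianAt {n : ℕ} (s : ℝ) (u : EuclideanSpace ℝ (Fin n) → ℝ)
    (x : EuclideanSpace ℝ (Fin n)) (ℓ : ℝ) : Prop :=
  (∀ ε : ℝ, 0 < ε → IntegrableOn (fracLapIntegrand s u x) {y | ε < ‖x - y‖}) ∧
  Tendsto (fun ε : ℝ => fracLapConst n s * ∫ y in {y | ε < ‖x - y‖}, fracLapIntegrand s u x y)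
    (𝓝[>] 0) (𝓝 ℓ)

/-- `u` solves `(-Δ)^s u + b · ∇u + c u = f` at every point of `ℝⁿ`. -/
def IsSolution {n : ℕ} (s : ℝ) (b : EuclideanSpace ℝ (Fin n) → EuclideanSpace ℝ (Fin n))
    (c f u : EuclideanSpace ℝ (Fin n) → ℝ) : Prop :=
  ∀ x, DifferentiableAt ℝ u x ∧
    ∃ ℓ : ℝ, HasFracLaplacianAt s u x ℓ ∧ ℓ + inner ℝ (b x) (∇ u x) + c x * u x = f x

end FracDrift

/-!
The solution is represented as a Bessel potential `u = J g`, where `J = (δ - Δ)^{-s}` up to a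
constant and `δ` is large.

*Heat semigroup.* Everything is expressed through the heat semigroup `P_t`. Up to a constant,
`(δ - Δ)^s u` is `fracGen s δ u = ∫_0^∞ t^{-1-s} (u - e^{-δ t} P_t u) dt`, and the principal value
which defines `(-Δ)^s u` equals a multiple of `fracGen s 0 u` because `|z|^{-n-2s}` is a
superposition of heat kernels (`hasFracLaplacianAt_fracGen`). The potential is
`besselPot s δ g = ∫_0^∞ r^{s-1} e^{-δ r} P_r g dr`, and `fracGen s δ` inverts it up to a constant
(`fracGen_besselPot`): along an orbit of the semigroup this is the inversion of a fractional
integral by the Marchaud derivative on the half line (`integral_marchaud`). The potential maps `C^α`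
to `C^{2s+α}` (`exists_schauder_besselPot`), since the derivatives of `P_r g` up to order three are
bounded by powers of `r`, improved by the Hölder continuity of `g`.

*Drift.* For `u = J g` the equation `(δ - Δ)^s u + b · ∇u + c u = F` reads
`μ g + (b · ∇ + c) J g = F`. As `s > 1/2`, the operator `(b · ∇ + c) J` is bounded on bounded
functions, with a norm that tends to zero as `δ → ∞` (`tendsto_driftBound`). For `δ` large this is
solved by a contraction (`exists_add_driftOp_eq`), and `g` inherits the Hölder continuity of `F` by
applying the a priori bound to differences of translates (`abs_sub_le_of_add_driftOp_eq`).

*Removing the damping.* The difference `(δ - Δ)^s - (-Δ)^s` is a bounded positive operator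
(`levyPot`), of mass `ℓ` say, because `1 - e^{-δ t}` is integrable against `t^{-1-s} dt`. The
solution of the original equation is a fixed point of the map `v ↦ u`, where `u` solves the damped
equation with right hand side `f + κ levyPot v`. By the maximum principle (`le_of_fracGen_le`) the
damped operator is bounded below by `c₀ + κ ℓ` in the sup norm, so the map contracts with factor
`κ ℓ / (c₀ + κ ℓ) < 1` (`exists_besselPot_solution`). The maximum principle also yields uniqueness
(`solution_unique`) and, with the potential estimates, the Schauder estimate (`exists_solution`).
-/

namespace FracDrift

section Heat

set_option linter.unusedSectionVars false

variable {V : Type*} [NormedAddCommGroup V] [InnerProductSpace ℝ V] [FiniteDimensional ℝ V]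
  [MeasurableSpace V] [BorelSpace V]
variable {F : Type*} [NormedAddCommGroup F] [NormedSpace ℝ F]

/-! ### The heat kernel -/

/-- The Gauss–Weierstrass kernel `G_t (z) = (4πt)^{-d/2} exp (-|z|² / (4t))`. -/
noncomputable def heatKernel (t : ℝ) (z : V) : ℝ :=
  (4 * Real.pi * t) ^ (-((Module.finrank ℝ V : ℝ) / 2)) * Real.exp (-(1 / (4 * t)) * ‖z‖ ^ 2)

lemma heatKernel_pos {t : ℝ} (ht : 0 < t) (z : V) : 0 < heatKernel t z := by
  unfold heatKernel; positivity

lemma heatKernel_neg (t : ℝ) (z : V) : heatKernel t (-z) = heatKernel t z := by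
  simp [heatKernel]

lemma continuous_heatKernel (t : ℝ) : Continuous (heatKernel t : V → ℝ) := by
  unfold heatKernel; fun_prop

lemma measurable_heatKernel : Measurable fun p : ℝ × V => heatKernel p.1 p.2 := by
  unfold heatKernel; fun_prop

lemma integral_heatKernel {t : ℝ} (ht : 0 < t) : ∫ z : V, heatKernel t z = 1 := by
  unfold heatKernel
  rw [integral_const_mul, GaussianFourier.integral_rexp_neg_mul_sq_norm (by positivity),
    Real.rpow_neg (by positivity)]
  have : Real.pi / (1 / (4 * t)) = 4 * Real.pi * t := by field_simp
  rw [this]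
  exact inv_mul_cancel₀ (by positivity)

lemma integrable_heatKernel {t : ℝ} (ht : 0 < t) : Integrable (heatKernel t : V → ℝ) :=
  Integrable.of_integral_ne_zero (by rw [integral_heatKernel ht]; exact one_ne_zero)

/-- The constant in the comparison of `|z|^p G_t (z)` with `t^{p/2} G_{2t} (z)`. -/
noncomputable def heatConst (V : Type*) [NormedAddCommGroup V] [InnerProductSpace ℝ V] : ℝ :=
  8 * 2 ^ ((Module.finrank ℝ V : ℝ) / 2)

lemma heatConst_pos : 0 < heatConst V := by unfold heatConst; positivity

/-- Powers of `|z|` are absorbed by doubling the time of the heat kernel. -/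
lemma norm_rpow_mul_heatKernel_le {t p : ℝ} (ht : 0 < t) (hp : 0 ≤ p) (hp2 : p ≤ 2) (z : V) :
    ‖z‖ ^ p * heatKernel t z ≤ heatConst V * t ^ (p / 2) * heatKernel (2 * t) z := by
  have key : ∀ a : ℝ, 0 ≤ a → a ^ p ≤ 8 * Real.exp (a ^ 2 / 8) := by
    intro a ha
    have h1 : a ^ p ≤ 1 + a ^ 2 := by
      rcases le_total a 1 with h | h
      · have := Real.rpow_le_one ha h hp
        nlinarith [sq_nonneg a]
      · have := Real.rpow_le_rpow_of_exponent_le h hp2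
        rw [Real.rpow_two] at this
        linarith
    nlinarith [Real.add_one_le_exp (a ^ 2 / 8)]
  have hs : 0 < √t := Real.sqrt_pos.2 ht
  have h1 := key (‖z‖ / √t) (by positivity)
  rw [Real.div_rpow (by positivity) (by positivity), div_pow, Real.sq_sqrt ht.le,
    div_le_iff₀ (by positivity), Real.sqrt_eq_rpow, ← Real.rpow_mul ht.le] at h1
  have h2 : (1 / 2 * p) = p / 2 := by ring
  rw [h2] at h1
  unfold heatKernel heatConst
  have h3 : (4 * Real.pi * (2 * t)) ^ (-((Module.finrank ℝ V : ℝ) / 2))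
      = 2 ^ (-((Module.finrank ℝ V : ℝ) / 2)) *
        (4 * Real.pi * t) ^ (-((Module.finrank ℝ V : ℝ) / 2)) := by
    rw [← Real.mul_rpow (by positivity) (by positivity)]
    congr 1; ring
  have h4 : (2:ℝ) ^ ((Module.finrank ℝ V : ℝ) / 2) * 2 ^ (-((Module.finrank ℝ V : ℝ) / 2)) = 1 := by
    rw [← Real.rpow_add (by norm_num)]; simp
  have h5 : Real.exp (-(1 / (4 * (2 * t))) * ‖z‖ ^ 2)
      = Real.exp (‖z‖ ^ 2 / t / 8) * Real.exp (-(1 / (4 * t)) * ‖z‖ ^ 2) := by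
    rw [← Real.exp_add]; congr 1; field_simp; ring
  rw [h3, h5]
  set A := (4 * Real.pi * t) ^ (-((Module.finrank ℝ V : ℝ) / 2))
  have hA : 0 ≤ A := by positivity
  calc ‖z‖ ^ p * (A * Real.exp (-(1 / (4 * t)) * ‖z‖ ^ 2))
      ≤ (8 * Real.exp (‖z‖ ^ 2 / t / 8) * t ^ (p / 2)) *
        (A * Real.exp (-(1 / (4 * t)) * ‖z‖ ^ 2)) := by gcongr
    _ = (2 ^ ((Module.finrank ℝ V : ℝ) / 2) * 2 ^ (-((Module.finrank ℝ V : ℝ) / 2))) *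
        ((8 * Real.exp (‖z‖ ^ 2 / t / 8) * t ^ (p / 2)) *
        (A * Real.exp (-(1 / (4 * t)) * ‖z‖ ^ 2))) := by rw [h4, one_mul]
    _ = _ := by ring

lemma integrable_norm_rpow_mul_heatKernel {t p : ℝ} (ht : 0 < t) (hp : 0 ≤ p) (hp2 : p ≤ 2) :
    Integrable fun z : V => ‖z‖ ^ p * heatKernel t z := by
  refine ((integrable_heatKernel (V := V) (t := 2 * t) (by positivity)).const_mul
    (heatConst V * t ^ (p / 2))).mono' ?_ ?_
  · exact ((continuous_norm.rpow_const fun _ => Or.inr hp).mul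
      (continuous_heatKernel t)).aestronglyMeasurable
  · refine Eventually.of_forall fun z => ?_
    rw [Real.norm_of_nonneg (mul_nonneg (by positivity) (heatKernel_pos ht z).le)]
    exact norm_rpow_mul_heatKernel_le ht hp hp2 z

lemma integral_norm_rpow_mul_heatKernel_le {t p : ℝ} (ht : 0 < t) (hp : 0 ≤ p) (hp2 : p ≤ 2) :
    ∫ z : V, ‖z‖ ^ p * heatKernel t z ≤ heatConst V * t ^ (p / 2) := by
  calc ∫ z : V, ‖z‖ ^ p * heatKernel t z
      ≤ ∫ z : V, heatConst V * t ^ (p / 2) * heatKernel (2 * t) z :=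
        integral_mono (integrable_norm_rpow_mul_heatKernel ht hp hp2)
          ((integrable_heatKernel (by positivity)).const_mul _)
          fun z => norm_rpow_mul_heatKernel_le ht hp hp2 z
    _ = _ := by rw [integral_const_mul, integral_heatKernel (by positivity), mul_one]

/-- The convolution identity `G_s * G_t = G_{s+t}`, obtained by completing the square. -/
lemma integral_heatKernel_mul_heatKernel {s t : ℝ} (hs : 0 < s) (ht : 0 < t) (z : V) :
    ∫ y : V, heatKernel s (z - y) * heatKernel t y = heatKernel (s + t) z := by
  have h1 : ∀ y : V, heatKernel s (z - y) * heatKernel t y =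
      heatKernel (s + t) z * heatKernel (s * t / (s + t)) (y - (t / (s + t)) • z) := by
    intro y
    unfold heatKernel
    have e1 : (4 * Real.pi * s) ^ (-((Module.finrank ℝ V : ℝ) / 2)) *
        (4 * Real.pi * t) ^ (-((Module.finrank ℝ V : ℝ) / 2)) =
        (4 * Real.pi * (s + t)) ^ (-((Module.finrank ℝ V : ℝ) / 2)) *
        (4 * Real.pi * (s * t / (s + t))) ^ (-((Module.finrank ℝ V : ℝ) / 2)) := by
      rw [← Real.mul_rpow (by positivity) (by positivity),
        ← Real.mul_rpow (by positivity) (by positivity)]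
      congr 1; field_simp
    have e2 : Real.exp (-(1 / (4 * s)) * ‖z - y‖ ^ 2) * Real.exp (-(1 / (4 * t)) * ‖y‖ ^ 2) =
        Real.exp (-(1 / (4 * (s + t))) * ‖z‖ ^ 2) *
        Real.exp (-(1 / (4 * (s * t / (s + t)))) * ‖y - (t / (s + t)) • z‖ ^ 2) := by
      rw [← Real.exp_add, ← Real.exp_add]
      congr 1
      rw [norm_sub_sq_real, norm_sub_sq_real, norm_smul, inner_smul_right, real_inner_comm y z,
        Real.norm_of_nonneg (by positivity)]
      field_simp
      ring
    calc _ = ((4 * Real.pi * s) ^ (-((Module.finrank ℝ V : ℝ) / 2)) *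
        (4 * Real.pi * t) ^ (-((Module.finrank ℝ V : ℝ) / 2))) *
        (Real.exp (-(1 / (4 * s)) * ‖z - y‖ ^ 2) * Real.exp (-(1 / (4 * t)) * ‖y‖ ^ 2)) := by ring
      _ = _ := by rw [e1, e2]; ring
  simp_rw [h1]
  rw [integral_const_mul, integral_sub_right_eq_self (fun y => heatKernel (s * t / (s + t)) y),
    integral_heatKernel (by positivity), mul_one]

/-! ### The heat semigroup on bounded continuous functions -/

/-- The heat semigroup `P_t f = G_t * f`. -/
noncomputable def heat (t : ℝ) (f : V → F) (x : V) : F := ∫ z, heatKernel t z • f (x - z)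

lemma integrable_heatKernel_smul {t K : ℝ} (ht : 0 < t) {φ : V → F} (hφ : Continuous φ)
    (hK : ∀ z, ‖φ z‖ ≤ K) : Integrable fun z => heatKernel t z • φ z :=
  (integrable_heatKernel ht).smul_bdd _ hφ.aestronglyMeasurable (Eventually.of_forall hK)

/-- Moments of the heat kernel: functions of order `|z|^p` have averages of order `t^{p/2}`. -/
lemma norm_integral_heatKernel_smul_le {t H p : ℝ} (ht : 0 < t) (hp : 0 ≤ p) (hp2 : p ≤ 2)
    (hH : 0 ≤ H) {φ : V → F} (hφ : ∀ z, ‖φ z‖ ≤ H * ‖z‖ ^ p) :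
    ‖∫ z, heatKernel t z • φ z‖ ≤ heatConst V * t ^ (p / 2) * H := by
  have h1 : ‖∫ z, heatKernel t z • φ z‖ ≤ ∫ z : V, H * (‖z‖ ^ p * heatKernel t z) := by
    refine norm_integral_le_of_norm_le ((integrable_norm_rpow_mul_heatKernel ht hp hp2).const_mul _)
      (Eventually.of_forall fun z => ?_)
    rw [norm_smul, Real.norm_of_nonneg (heatKernel_pos ht z).le]
    nlinarith [hφ z, heatKernel_pos ht z]
  rw [integral_const_mul] at h1
  have := integral_norm_rpow_mul_heatKernel_le (V := V) ht hp hp2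
  nlinarith

lemma norm_integral_heatKernel_smul_le_of_bound {t K : ℝ} (ht : 0 < t) {φ : V → F}
    (hφ : ∀ z, ‖φ z‖ ≤ K) : ‖∫ z, heatKernel t z • φ z‖ ≤ K := by
  have h1 : ‖∫ z, heatKernel t z • φ z‖ ≤ ∫ z : V, heatKernel t z * K := by
    refine norm_integral_le_of_norm_le ((integrable_heatKernel ht).mul_const _)
      (Eventually.of_forall fun z => ?_)
    rw [norm_smul, Real.norm_of_nonneg (heatKernel_pos ht z).le]
    exact mul_le_mul_of_nonneg_left (hφ z) (heatKernel_pos ht z).le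
  rwa [integral_mul_const, integral_heatKernel ht, one_mul] at h1

lemma norm_heat_le {t K : ℝ} (ht : 0 < t) {f : V → F} (hK : ∀ z, ‖f z‖ ≤ K) (x : V) :
    ‖heat t f x‖ ≤ K :=
  norm_integral_heatKernel_smul_le_of_bound ht fun _ => hK _

lemma heat_sub_heat {t K : ℝ} (ht : 0 < t) {f : V → F} (hf : Continuous f)
    (hK : ∀ z, ‖f z‖ ≤ K) (x y : V) :
    heat t f x - heat t f y = ∫ z, heatKernel t z • (f (x - z) - f (y - z)) := by
  unfold heat
  rw [← integral_sub (integrable_heatKernel_smul ht (by fun_prop) fun z => hK _)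
    (integrable_heatKernel_smul ht (by fun_prop) fun z => hK _)]
  simp_rw [smul_sub]

lemma heat_sub {t K K' : ℝ} (ht : 0 < t) {f g : V → F} (hf : Continuous f)
    (hK : ∀ z, ‖f z‖ ≤ K) (hg : Continuous g) (hK' : ∀ z, ‖g z‖ ≤ K') (x : V) :
    heat t (fun y => f y - g y) x = heat t f x - heat t g x := by
  unfold heat
  rw [← integral_sub (integrable_heatKernel_smul ht (by fun_prop) fun z => hK _)
    (integrable_heatKernel_smul ht (by fun_prop) fun z => hK' _)]
  simp_rw [smul_sub]

lemma heat_sub_self [CompleteSpace F] {t K : ℝ} (ht : 0 < t) {f : V → F} (hf : Continuous f)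
    (hK : ∀ z, ‖f z‖ ≤ K) (x : V) :
    heat t f x - f x = ∫ z, heatKernel t z • (f (x - z) - f x) := by
  have h1 : ∫ z : V, heatKernel t z • f x = f x := by
    rw [integral_smul_const, integral_heatKernel ht, one_smul]
  calc heat t f x - f x = heat t f x - ∫ z : V, heatKernel t z • f x := by rw [h1]
    _ = _ := ?_
  unfold heat
  rw [← integral_sub (integrable_heatKernel_smul ht (by fun_prop) fun z => hK _)
    (integrable_heatKernel_smul ht (by fun_prop) fun z => hK _)]
  simp_rw [smul_sub]

lemma heat_eq_integral_sub (t : ℝ) (f : V → F) (x : V) :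
    heat t f x = ∫ y, heatKernel t (x - y) • f y := by
  unfold heat
  rw [← integral_sub_left_eq_self (fun z => heatKernel t z • f (x - z)) volume x]
  simp

/-- Joint measurability in time and space. The function may depend on time, so that the statement
can be iterated. -/
lemma stronglyMeasurable_heat {f : ℝ × V → F} (hf : StronglyMeasurable f) :
    StronglyMeasurable fun p : ℝ × V => heat p.1 (fun y => f (p.1, y)) p.2 := by
  unfold heat
  refine StronglyMeasurable.integral_prod_right
    (f := fun (p : ℝ × V) (z : V) => heatKernel p.1 z • f (p.1, p.2 - z)) ?_
  have h1 : StronglyMeasurable fun q : (ℝ × V) × V => heatKernel q.1.1 q.2 :=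
    (measurable_heatKernel.comp (measurable_fst.fst.prodMk measurable_snd)).stronglyMeasurable
  have h2 : StronglyMeasurable fun q : (ℝ × V) × V => f (q.1.1, q.1.2 - q.2) :=
    hf.comp_measurable (by fun_prop)
  exact h1.smul h2

/-- The semigroup law `P_s P_t = P_{s+t}`. -/
lemma heat_heat [CompleteSpace F] {s t K : ℝ} (hs : 0 < s) (ht : 0 < t) {f : V → F}
    (hf : Continuous f) (hK : ∀ z, ‖f z‖ ≤ K) (x : V) :
    heat s (heat t f) x = heat (s + t) f x := by
  have hint : Integrable (Function.uncurry fun w y : V =>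
      (heatKernel s w * heatKernel t (y - w)) • f (x - y)) (volume.prod volume) := by
    have hc : Continuous (Function.uncurry fun w y : V =>
        (heatKernel s w * heatKernel t (y - w)) • f (x - y)) := by
      have := continuous_heatKernel (V := V) s
      have := continuous_heatKernel (V := V) t
      unfold Function.uncurry
      fun_prop
    have hb : ∀ w y : V, ‖(heatKernel s w * heatKernel t (y - w)) • f (x - y)‖ ≤
        heatKernel s w * K * heatKernel t (y - w) := by
      intro w y
      rw [norm_smul, Real.norm_of_nonneg (mul_pos (heatKernel_pos hs _) (heatKernel_pos ht _)).le]
      have := mul_le_mul_of_nonneg_left (hK (x - y))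
        (mul_pos (heatKernel_pos hs w) (heatKernel_pos ht (y - w))).le
      nlinarith
    have hi : ∀ w : V, Integrable fun y : V => heatKernel s w * K * heatKernel t (y - w) :=
      fun w => ((integrable_heatKernel ht).comp_sub_right w).const_mul _
    rw [integrable_prod_iff hc.aestronglyMeasurable]
    refine ⟨Eventually.of_forall fun w => (hi w).mono' ?_ (Eventually.of_forall (hb w)), ?_⟩
    · exact (hc.comp (by fun_prop : Continuous fun y : V => (w, y))).aestronglyMeasurable
    · refine ((integrable_heatKernel hs).mul_const K).mono'
        hc.aestronglyMeasurable.norm.integral_prod_right' (Eventually.of_forall fun w => ?_)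
      rw [Real.norm_of_nonneg (integral_nonneg fun _ => norm_nonneg _)]
      refine (integral_mono_of_nonneg (Eventually.of_forall fun _ => norm_nonneg _) (hi w)
        (Eventually.of_forall (hb w))).trans ?_
      rw [integral_const_mul, integral_sub_right_eq_self (fun y => heatKernel t y),
        integral_heatKernel ht, mul_one]
  calc heat s (heat t f) x
      = ∫ w, ∫ y, (heatKernel s w * heatKernel t (y - w)) • f (x - y) := by
        unfold heat
        refine integral_congr_ae (Eventually.of_forall fun w => ?_)
        simp only
        rw [← integral_sub_right_eq_self (fun z => heatKernel t z • f (x - w - z)) w,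
          ← integral_smul]
        refine integral_congr_ae (Eventually.of_forall fun y => ?_)
        simp only [smul_smul]
        congr 2; abel
    _ = ∫ y, ∫ w, (heatKernel s w * heatKernel t (y - w)) • f (x - y) :=
        integral_integral_swap hint
    _ = heat (s + t) f x := by
        unfold heat
        refine integral_congr_ae (Eventually.of_forall fun y => ?_)
        simp only
        rw [integral_smul_const, add_comm s t, ← integral_heatKernel_mul_heatKernel ht hs]
        simp_rw [mul_comm]

/-! ### The gradient of the heat semigroup -/

/-- The derivative of the heat kernel. -/
noncomputable def gradKernel (t : ℝ) (z : V) : V →L[ℝ] ℝ :=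
  -(heatKernel t z / (2 * t)) • innerSL ℝ z

lemma hasFDerivAt_heatKernel {t : ℝ} (ht : 0 < t) (z : V) :
    HasFDerivAt (heatKernel t) (gradKernel t z) z := by
  have h1 : HasFDerivAt (fun z : V => ‖z‖ ^ 2) (2 • innerSL ℝ z) z :=
    (hasStrictFDerivAt_norm_sq z).hasFDerivAt
  have h2 := ((h1.const_mul (-(1 / (4 * t)))).exp).const_mul
    ((4 * Real.pi * t) ^ (-((Module.finrank ℝ V : ℝ) / 2)))
  refine h2.congr_fderiv ?_
  ext v
  simp [gradKernel, heatKernel]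
  field_simp
  ring

lemma norm_gradKernel {t : ℝ} (ht : 0 < t) (z : V) :
    ‖gradKernel t z‖ = ‖z‖ * heatKernel t z / (2 * t) := by
  unfold gradKernel
  rw [norm_smul, innerSL_apply_norm, norm_neg,
    Real.norm_of_nonneg (div_nonneg (heatKernel_pos ht z).le (by positivity))]
  ring

lemma gradKernel_neg (t : ℝ) (z : V) : gradKernel t (-z) = -gradKernel t z := by
  simp [gradKernel, heatKernel_neg]

lemma continuous_gradKernel (t : ℝ) : Continuous (gradKernel t : V → V →L[ℝ] ℝ) := by
  have := continuous_heatKernel (V := V) t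
  unfold gradKernel; fun_prop

/-- The derivative of `P_t f`, as a convolution with the derivative of the heat kernel. -/
noncomputable def gradHeat (t : ℝ) (f : V → F) (x : V) : V →L[ℝ] F :=
  ∫ z, (gradKernel t z).smulRight (f (x - z))

lemma norm_smulRight_gradKernel_le {t H p : ℝ} (ht : 0 < t) (hp : 0 ≤ p) (hp1 : p ≤ 1)
    (hH : 0 ≤ H) {φ : V → F} (hφ : ∀ z, ‖φ z‖ ≤ H * ‖z‖ ^ p) (z : V) :
    ‖(gradKernel t z).smulRight (φ z)‖ ≤
      heatConst V * t ^ ((p - 1) / 2) * H * heatKernel (2 * t) z := by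
  rw [ContinuousLinearMap.norm_smulRight_apply, norm_gradKernel ht]
  have hG := heatKernel_pos ht z
  have h1 := norm_rpow_mul_heatKernel_le (p := 1 + p) ht (by linarith) (by linarith) z
  have h2 : t ^ ((1 + p) / 2) = t ^ ((p - 1) / 2) * t := by
    nth_rewrite 3 [← Real.rpow_one t]
    rw [← Real.rpow_add ht]; congr 1; ring
  have h3 : ‖z‖ * ‖z‖ ^ p ≤ ‖z‖ ^ (1 + p) := by
    rw [Real.rpow_add_of_nonneg (norm_nonneg _) (by norm_num) hp, Real.rpow_one]
  have hC := heatConst_pos (V := V)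
  have hG2 := heatKernel_pos (t := 2 * t) (by positivity) z
  calc ‖z‖ * heatKernel t z / (2 * t) * ‖φ z‖
      ≤ ‖z‖ * heatKernel t z / (2 * t) * (H * ‖z‖ ^ p) := by gcongr; exact hφ z
    _ = (‖z‖ * ‖z‖ ^ p) * heatKernel t z * H / (2 * t) := by ring
    _ ≤ ‖z‖ ^ (1 + p) * heatKernel t z * H / (2 * t) := by gcongr
    _ ≤ (heatConst V * t ^ ((1 + p) / 2) * heatKernel (2 * t) z) * H / (2 * t) := by gcongr
    _ = (heatConst V * t ^ ((p - 1) / 2) * H * heatKernel (2 * t) z) / 2 := by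
        rw [h2]; field_simp
    _ ≤ _ := half_le_self (by positivity)

lemma norm_integral_gradKernel_le {t H p : ℝ} (ht : 0 < t) (hp : 0 ≤ p) (hp1 : p ≤ 1)
    (hH : 0 ≤ H) {φ : V → F} (hφ : ∀ z, ‖φ z‖ ≤ H * ‖z‖ ^ p) :
    ‖∫ z, (gradKernel t z).smulRight (φ z)‖ ≤ heatConst V * t ^ ((p - 1) / 2) * H := by
  refine (norm_integral_le_of_norm_le
    ((integrable_heatKernel (t := 2 * t) (by positivity)).const_mul _)
    (Eventually.of_forall (norm_smulRight_gradKernel_le ht hp hp1 hH hφ))).trans_eq ?_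
  rw [integral_const_mul, integral_heatKernel (by positivity), mul_one]

lemma integrable_gradKernel_smulRight {t K : ℝ} (ht : 0 < t) {φ : V → F} (hφ : Continuous φ)
    (hK : ∀ z, ‖φ z‖ ≤ K) : Integrable fun z => (gradKernel t z).smulRight (φ z) := by
  refine ((integrable_heatKernel (t := 2 * t) (by positivity)).const_mul _).mono' ?_
    (Eventually.of_forall (norm_smulRight_gradKernel_le (p := 0) (H := K) ht le_rfl zero_le_one
      ((norm_nonneg _).trans (hK 0)) fun z => by simpa using hK z))
  exact (isBoundedBilinearMap_smulRight.continuous.comp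
    ((continuous_gradKernel t).prodMk hφ)).aestronglyMeasurable

lemma norm_gradHeat_le {t K : ℝ} (ht : 0 < t) {f : V → F} (hK : ∀ z, ‖f z‖ ≤ K) (x : V) :
    ‖gradHeat t f x‖ ≤ heatConst V * t ^ (-(1 / 2 : ℝ)) * K := by
  have := norm_integral_gradKernel_le (p := 0) (H := K) ht le_rfl zero_le_one
    ((norm_nonneg _).trans (hK 0)) (φ := fun z => f (x - z)) fun z => by simpa using hK _
  rwa [show ((0 : ℝ) - 1) / 2 = -(1 / 2) by norm_num] at this

lemma gradHeat_sub_gradHeat {t K : ℝ} (ht : 0 < t) {f : V → F} (hf : Continuous f)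
    (hK : ∀ z, ‖f z‖ ≤ K) (x y : V) :
    gradHeat t f x - gradHeat t f y =
      ∫ z, (gradKernel t z).smulRight (f (x - z) - f (y - z)) := by
  unfold gradHeat
  rw [← integral_sub (integrable_gradKernel_smulRight ht (by fun_prop) fun z => hK _)
    (integrable_gradKernel_smulRight ht (by fun_prop) fun z => hK _)]
  congr 1; ext z v
  simp [smul_sub]

lemma gradHeat_sub {t K K' : ℝ} (ht : 0 < t) {f g : V → F} (hf : Continuous f)
    (hK : ∀ z, ‖f z‖ ≤ K) (hg : Continuous g) (hK' : ∀ z, ‖g z‖ ≤ K') (x : V) :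
    gradHeat t (fun y => f y - g y) x = gradHeat t f x - gradHeat t g x := by
  unfold gradHeat
  rw [← integral_sub (integrable_gradKernel_smulRight ht (by fun_prop) fun z => hK _)
    (integrable_gradKernel_smulRight ht (by fun_prop) fun z => hK' _)]
  congr 1; ext z v
  simp [smul_sub]

/-- `∇P_t` is a convolution operator whose kernel has mass `O(t^{-1/2})`, so it maps functions
with a given modulus of continuity to functions with the same modulus. -/
lemma norm_gradHeat_sub_le {t K H : ℝ} (ht : 0 < t) {f : V → F} (hf : Continuous f)
    (hK : ∀ z, ‖f z‖ ≤ K) {x y : V} (hH : ∀ z, ‖f (x - z) - f (y - z)‖ ≤ H) :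
    ‖gradHeat t f x - gradHeat t f y‖ ≤ heatConst V * t ^ (-(1 / 2 : ℝ)) * H := by
  rw [gradHeat_sub_gradHeat ht hf hK]
  have := norm_integral_gradKernel_le (p := 0) (H := H) ht le_rfl zero_le_one
    ((norm_nonneg _).trans (hH 0)) (φ := fun z => f (x - z) - f (y - z)) fun z => by
      simpa using hH z
  rwa [show ((0 : ℝ) - 1) / 2 = -(1 / 2) by norm_num] at this

/-- Hölder continuity of `f` improves the bound on `∇P_t f`, because the derivative of the heat
kernel is odd and so has integral zero. -/
lemma norm_gradHeat_le_of_holder {t K H α : ℝ} (ht : 0 < t) (hα : 0 ≤ α) (hα1 : α ≤ 1)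
    (hH : 0 ≤ H) {f : V → F} (hf : Continuous f) (hK : ∀ z, ‖f z‖ ≤ K)
    (hfH : ∀ x y, ‖f x - f y‖ ≤ H * ‖x - y‖ ^ α) (x : V) :
    ‖gradHeat t f x‖ ≤ heatConst V * t ^ ((α - 1) / 2) * H := by
  have h0 : ∫ z : V, (gradKernel t z).smulRight (f x) = 0 := by
    have h := integral_neg_eq_self (fun z : V => (gradKernel t z).smulRight (f x)) volume
    have h2 : ∀ z : V, (gradKernel t (-z)).smulRight (f x) =
        -(gradKernel t z).smulRight (f x) := by
      intro z; rw [gradKernel_neg]; ext v; simp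
    simp_rw [h2, integral_neg] at h
    have h3 : (2 : ℝ) • ∫ z : V, (gradKernel t z).smulRight (f x) = 0 := by
      rw [two_smul]
      nth_rewrite 1 [← h]
      exact neg_add_cancel _
    simpa using h3
  have h1 : gradHeat t f x = ∫ z, (gradKernel t z).smulRight (f (x - z) - f x) := by
    rw [← sub_zero (gradHeat t f x), ← h0]
    unfold gradHeat
    rw [← integral_sub (integrable_gradKernel_smulRight ht (by fun_prop) fun z => hK _)
      (integrable_gradKernel_smulRight ht (by fun_prop) fun z => hK _)]
    congr 1; ext z v
    simp [smul_sub]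
  rw [h1]
  refine norm_integral_gradKernel_le ht hα hα1 hH fun z => ?_
  simpa using hfH (x - z) x

/-- Translates of the heat kernel by at most `√t` are dominated by a single kernel. This gives the
integrable majorant for differentiating `P_t f` under the integral sign. -/
lemma heatKernel_le_of_norm_sub_le {t : ℝ} (ht : 0 < t) {w w' : V} (h : ‖w' - w‖ ≤ √t) :
    heatKernel t w ≤ heatConst V * heatKernel (2 * t) w' := by
  have h1 : ‖w'‖ ^ 2 ≤ 2 * ‖w‖ ^ 2 + 2 * t := by
    have h2 : ‖w'‖ ≤ ‖w‖ + √t := by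
      calc ‖w'‖ = ‖w + (w' - w)‖ := by congr 1; abel
        _ ≤ _ := (norm_add_le _ _).trans (by gcongr)
    have h3 := Real.sq_sqrt ht.le
    nlinarith [norm_nonneg w', norm_nonneg w, Real.sqrt_nonneg t, sq_nonneg (‖w‖ - √t)]
  unfold heatKernel heatConst
  have h3 : (4 * Real.pi * (2 * t)) ^ (-((Module.finrank ℝ V : ℝ) / 2))
      = 2 ^ (-((Module.finrank ℝ V : ℝ) / 2)) *
        (4 * Real.pi * t) ^ (-((Module.finrank ℝ V : ℝ) / 2)) := by
    rw [← Real.mul_rpow (by positivity) (by positivity)]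
    congr 1; ring
  have h4 : (2:ℝ) ^ ((Module.finrank ℝ V : ℝ) / 2) * 2 ^ (-((Module.finrank ℝ V : ℝ) / 2)) = 1 := by
    rw [← Real.rpow_add (by norm_num)]; simp
  rw [h3]
  set A := (4 * Real.pi * t) ^ (-((Module.finrank ℝ V : ℝ) / 2))
  have hA : 0 ≤ A := by positivity
  have h5 : Real.exp (-(1 / (4 * t)) * ‖w‖ ^ 2) ≤
      8 * Real.exp (-(1 / (4 * (2 * t))) * ‖w'‖ ^ 2) := by
    have : Real.exp (-(1 / (4 * t)) * ‖w‖ ^ 2) ≤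
        Real.exp 1 * Real.exp (-(1 / (4 * (2 * t))) * ‖w'‖ ^ 2) := by
      rw [← Real.exp_add]
      refine Real.exp_le_exp.2 ?_
      have : -(1 / (4 * t)) * ‖w‖ ^ 2 = -(2 * ‖w‖ ^ 2) / (8 * t) := by field_simp; ring
      have e2 : 1 + -(1 / (4 * (2 * t))) * ‖w'‖ ^ 2 = (8 * t - ‖w'‖ ^ 2) / (8 * t) := by
        field_simp; ring
      rw [this, e2]
      gcongr
      linarith
    refine this.trans ?_
    gcongr
    linarith [Real.exp_one_lt_d9]
  calc A * Real.exp (-(1 / (4 * t)) * ‖w‖ ^ 2)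
      ≤ A * (8 * Real.exp (-(1 / (4 * (2 * t))) * ‖w'‖ ^ 2)) := by gcongr
    _ = (2 ^ ((Module.finrank ℝ V : ℝ) / 2) * 2 ^ (-((Module.finrank ℝ V : ℝ) / 2))) *
        (A * (8 * Real.exp (-(1 / (4 * (2 * t))) * ‖w'‖ ^ 2))) := by rw [h4, one_mul]
    _ = _ := by ring

lemma hasFDerivAt_heat {t K : ℝ} (ht : 0 < t) {f : V → F} (hf : Continuous f)
    (hK : ∀ z, ‖f z‖ ≤ K) (x : V) : HasFDerivAt (heat t f) (gradHeat t f x) x := by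
  have hK0 : 0 ≤ K := (norm_nonneg _).trans (hK 0)
  have e1 : heat t f = fun x => ∫ y, heatKernel t (x - y) • f y :=
    funext (heat_eq_integral_sub t f)
  have e2 : gradHeat t f x = ∫ y, (gradKernel t (x - y)).smulRight (f y) := by
    unfold gradHeat
    rw [← integral_sub_left_eq_self (fun z => (gradKernel t z).smulRight (f (x - z))) volume x]
    simp
  rw [e1, e2]
  refine hasFDerivAt_integral_of_dominated_of_fderiv_le (𝕜 := ℝ) (E := F) (H := V)
    (F := fun x y => heatKernel t (x - y) • f y)
    (F' := fun x y => (gradKernel t (x - y)).smulRight (f y)) (Metric.ball_mem_nhds x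
    (Real.sqrt_pos.2 (by positivity : 0 < 2 * t))) (Eventually.of_forall fun w => ?_) ?_ ?_
    (bound := fun y : V => heatConst V * t ^ ((0 - 1 : ℝ) / 2) * K *
      (heatConst V * heatKernel (2 * (2 * t)) (x - y)))
    (Eventually.of_forall fun y w hw => ?_) ?_ (Eventually.of_forall fun y w _ => ?_)
  · have := continuous_heatKernel (V := V) t
    exact Continuous.aestronglyMeasurable (by fun_prop)
  · have := integrable_heatKernel_smul (φ := fun z => f (x - z)) ht (by fun_prop) fun z => hK _
    simpa using this.comp_sub_left x
  · exact (isBoundedBilinearMap_smulRight.continuous.comp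
      (((continuous_gradKernel t).comp (continuous_const.sub continuous_id)).prodMk
        hf)).aestronglyMeasurable
  · refine (norm_smulRight_gradKernel_le (p := 0) (φ := fun _ => f y) ht le_rfl zero_le_one hK0
      (fun z => by simpa using hK y) (w - y)).trans ?_
    have hC := heatConst_pos (V := V)
    gcongr
    refine heatKernel_le_of_norm_sub_le (by positivity) ?_
    have := (mem_ball_iff_norm.1 hw).le
    rw [norm_sub_rev]
    simpa using this
  · exact (((integrable_heatKernel (by positivity)).comp_sub_left x).const_mul _).const_mul _
  · have h1 := (hasFDerivAt_heatKernel ht (w - y)).comp w ((hasFDerivAt_id w).sub_const y)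
    exact h1.smul_const (f y)

/-- Differentiation commutes with the heat semigroup. -/
lemma hasFDerivAt_heat_of_hasFDerivAt {t K K' : ℝ} (ht : 0 < t) {f : V → F} {f' : V → V →L[ℝ] F}
    (hf : ∀ x, HasFDerivAt f (f' x) x) (hK : ∀ z, ‖f z‖ ≤ K) (hf' : Continuous f')
    (hK' : ∀ z, ‖f' z‖ ≤ K') (x : V) : HasFDerivAt (heat t f) (heat t f' x) x := by
  have hfc : Continuous f := continuous_iff_continuousAt.2 fun x => (hf x).continuousAt
  refine hasFDerivAt_integral_of_dominated_of_fderiv_le (𝕜 := ℝ) (E := F) (H := V)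
    (F := fun x z => heatKernel t z • f (x - z))
    (F' := fun x z => heatKernel t z • f' (x - z)) (s := Set.univ) univ_mem
    (Eventually.of_forall fun w => ?_) ?_ ?_
    (bound := fun y : V => heatKernel t y * K')
    (Eventually.of_forall fun y w hw => ?_) ?_ (Eventually.of_forall fun y w _ => ?_)
  · exact (integrable_heatKernel_smul ht (by fun_prop) fun z => hK _).aestronglyMeasurable
  · exact integrable_heatKernel_smul ht (by fun_prop) fun z => hK _
  · exact (integrable_heatKernel_smul ht (by fun_prop) fun z => hK' _).aestronglyMeasurable
  · rw [norm_smul, Real.norm_of_nonneg (heatKernel_pos ht y).le]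
    exact mul_le_mul_of_nonneg_left (hK' _) (heatKernel_pos ht y).le
  · exact (integrable_heatKernel ht).mul_const _
  · exact ((hf (w - y)).comp w ((hasFDerivAt_id w).sub_const y)).const_smul (heatKernel t y)

lemma continuous_heat {t K : ℝ} (ht : 0 < t) {f : V → F} (hf : Continuous f)
    (hK : ∀ z, ‖f z‖ ≤ K) : Continuous (heat t f) :=
  continuous_iff_continuousAt.2 fun x => (hasFDerivAt_heat ht hf hK x).continuousAt

/-- Joint measurability of the gradient. The factor `c` on the time is there for `c = 1/2`, the
case needed for `hessHeat`. -/
lemma stronglyMeasurable_gradHeat {f : ℝ × V → F} (hf : StronglyMeasurable f) (c : ℝ) :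
    StronglyMeasurable fun p : ℝ × V => gradHeat (c * p.1) (fun y => f (p.1, y)) p.2 := by
  unfold gradHeat
  refine StronglyMeasurable.integral_prod_right
    (f := fun (p : ℝ × V) (z : V) => (gradKernel (c * p.1) z).smulRight (f (p.1, p.2 - z))) ?_
  have h1 : StronglyMeasurable fun q : (ℝ × V) × V => gradKernel (c * q.1.1) q.2 := by
    unfold gradKernel
    have h : Measurable fun q : (ℝ × V) × V => -(heatKernel (c * q.1.1) q.2 / (2 * (c * q.1.1))) :=
      ((measurable_heatKernel.comp (((measurable_fst.fst).const_mul c).prodMk measurable_snd)).div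
        (by fun_prop)).neg
    exact h.stronglyMeasurable.smul
      ((innerSL ℝ).continuous.comp continuous_snd).stronglyMeasurable
  have h2 : StronglyMeasurable fun q : (ℝ × V) × V => f (q.1.1, q.1.2 - q.2) :=
    hf.comp_measurable (by fun_prop)
  exact isBoundedBilinearMap_smulRight.continuous.comp_stronglyMeasurable (h1.prodMk h2)

end Heat

/-! ### Regularity of the heat semigroup -/

section HeatRegularity

set_option linter.unusedSectionVars false

variable {V : Type*} [NormedAddCommGroup V] [InnerProductSpace ℝ V] [FiniteDimensional ℝ V]
  [MeasurableSpace V] [BorelSpace V]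
variable {F : Type*} [NormedAddCommGroup F] [NormedSpace ℝ F]

lemma norm_sub_le_of_hasFDerivAt {f : V → F} {f' : V → V →L[ℝ] F} {L : ℝ}
    (hf : ∀ x, HasFDerivAt f (f' x) x) (hL : ∀ x, ‖f' x‖ ≤ L) (x y : V) :
    ‖f x - f y‖ ≤ L * ‖x - y‖ :=
  convex_univ.norm_image_sub_le_of_norm_hasFDerivWithin_le
    (fun x _ => (hf x).hasFDerivWithinAt) (fun x _ => hL x) (Set.mem_univ y) (Set.mem_univ x)

lemma continuous_of_norm_sub_le {f : V → F} {L : ℝ} (h : ∀ x y, ‖f x - f y‖ ≤ L * ‖x - y‖) :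
    Continuous f := by
  refine (LipschitzWith.of_dist_le_mul (K := L.toNNReal) fun x y => ?_).continuous
  rw [dist_eq_norm, dist_eq_norm]
  exact (h x y).trans (by gcongr; exact Real.le_coe_toNNReal L)

variable [CompleteSpace F]

lemma gradHeat_add {s t K : ℝ} (hs : 0 < s) (ht : 0 < t) {f : V → F} (hf : Continuous f)
    (hK : ∀ z, ‖f z‖ ≤ K) : gradHeat (s + t) f = gradHeat s (heat t f) := by
  ext1 x
  have h1 := hasFDerivAt_heat (add_pos hs ht) hf hK x
  have h2 := hasFDerivAt_heat hs (continuous_heat ht hf hK) (norm_heat_le ht hK) x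
  rw [funext (heat_heat hs ht hf hK)] at h2
  exact h1.unique h2

/-- `∇P_t f` is Lipschitz, by the splitting `∇P_t = ∇P_{t/2} P_{t/2}`; the right hand side is left
unsimplified. -/
lemma norm_gradHeat_sub_le_lipschitz {t K : ℝ} (ht : 0 < t) {f : V → F} (hf : Continuous f)
    (hK : ∀ z, ‖f z‖ ≤ K) (x y : V) :
    ‖gradHeat t f x - gradHeat t f y‖ ≤ heatConst V * (t / 2) ^ (-(1 / 2 : ℝ)) *
      (heatConst V * (t / 2) ^ (-(1 / 2 : ℝ)) * K) * ‖x - y‖ := by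
  have ht2 : 0 < t / 2 := by positivity
  have e : gradHeat t f = gradHeat (t / 2) (heat (t / 2) f) := by
    rw [← gradHeat_add ht2 ht2 hf hK, add_halves]
  rw [e, mul_assoc (heatConst V * (t / 2) ^ (-(1 / 2 : ℝ)))]
  refine norm_gradHeat_sub_le ht2 (continuous_heat ht2 hf hK) (norm_heat_le ht2 hK) fun z => ?_
  have := norm_sub_le_of_hasFDerivAt (hasFDerivAt_heat ht2 hf hK) (norm_gradHeat_le ht2 hK)
    (x - z) (y - z)
  simpa using this

lemma continuous_gradHeat {t K : ℝ} (ht : 0 < t) {f : V → F} (hf : Continuous f)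
    (hK : ∀ z, ‖f z‖ ≤ K) : Continuous (gradHeat t f) :=
  continuous_of_norm_sub_le (norm_gradHeat_sub_le_lipschitz ht hf hK)

/-- The second derivative of `P_t f`, written as `∇P_{t/2} ∇P_{t/2} f`. -/
noncomputable def hessHeat (t : ℝ) (f : V → F) : V → V →L[ℝ] V →L[ℝ] F :=
  gradHeat (2⁻¹ * t) (gradHeat (2⁻¹ * t) f)

lemma hasFDerivAt_gradHeat {t K : ℝ} (ht : 0 < t) {f : V → F} (hf : Continuous f)
    (hK : ∀ z, ‖f z‖ ≤ K) (x : V) : HasFDerivAt (gradHeat t f) (hessHeat t f x) x := by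
  have ht2 : 0 < 2⁻¹ * t := by positivity
  have e : gradHeat t f = heat (2⁻¹ * t) (gradHeat (2⁻¹ * t) f) := by
    ext1 x
    have h1 := hasFDerivAt_heat ht hf hK x
    have h2 := hasFDerivAt_heat_of_hasFDerivAt ht2 (hasFDerivAt_heat ht2 hf hK)
      (norm_heat_le ht2 hK) (continuous_gradHeat ht2 hf hK) (norm_gradHeat_le ht2 hK) x
    rw [funext (heat_heat ht2 ht2 hf hK), show 2⁻¹ * t + 2⁻¹ * t = t by ring] at h2
    exact h1.unique h2
  rw [e]
  exact hasFDerivAt_heat ht2 (continuous_gradHeat ht2 hf hK) (norm_gradHeat_le ht2 hK) x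

/-- One factor `∇P_{t/2}` profits from the Hölder continuity of `f`, the other costs `t^{-1/2}`. -/
lemma norm_hessHeat_le_of_holder {t K H α : ℝ} (ht : 0 < t) (hα : 0 ≤ α) (hα1 : α ≤ 1)
    (hH : 0 ≤ H) {f : V → F} (hf : Continuous f) (hK : ∀ z, ‖f z‖ ≤ K)
    (hfH : ∀ x y, ‖f x - f y‖ ≤ H * ‖x - y‖ ^ α) (x : V) :
    ‖hessHeat t f x‖ ≤ 2 * heatConst V ^ 2 * t ^ ((α - 2) / 2) * H := by
  have ht2 : 0 < 2⁻¹ * t := by positivity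
  refine (norm_gradHeat_le ht2 (norm_gradHeat_le_of_holder ht2 hα hα1 hH hf hK hfH) x).trans ?_
  have e1 : (2⁻¹ * t) ^ (-(1 / 2) : ℝ) * (2⁻¹ * t) ^ ((α - 1) / 2) =
      2⁻¹ ^ ((α - 2) / 2) * t ^ ((α - 2) / 2) := by
    rw [← Real.rpow_add ht2, ← Real.mul_rpow (by norm_num) ht.le]
    congr 1; ring
  have e2 : (2⁻¹ : ℝ) ^ ((α - 2) / 2) ≤ 2 := by
    rw [Real.inv_rpow (by norm_num), ← Real.rpow_neg (by norm_num)]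
    calc (2:ℝ) ^ (-((α - 2) / 2)) ≤ 2 ^ (1:ℝ) :=
          Real.rpow_le_rpow_of_exponent_le (by norm_num) (by linarith)
      _ = 2 := Real.rpow_one 2
  have hC := heatConst_pos (V := V)
  calc heatConst V * (2⁻¹ * t) ^ (-(1 / 2) : ℝ) *
        (heatConst V * (2⁻¹ * t) ^ ((α - 1) / 2) * H)
      = heatConst V ^ 2 * ((2⁻¹ * t) ^ (-(1 / 2) : ℝ) * (2⁻¹ * t) ^ ((α - 1) / 2)) * H := by ring
    _ = heatConst V ^ 2 * (2⁻¹ ^ ((α - 2) / 2) * t ^ ((α - 2) / 2)) * H := by rw [e1]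
    _ ≤ heatConst V ^ 2 * (2 * t ^ ((α - 2) / 2)) * H := by gcongr
    _ = _ := by ring

lemma norm_hessHeat_sub_le_of_holder {t K H α : ℝ} (ht : 0 < t) (hα : 0 ≤ α) (hα1 : α ≤ 1)
    (hH : 0 ≤ H) {f : V → F} (hf : Continuous f) (hK : ∀ z, ‖f z‖ ≤ K)
    (hfH : ∀ x y, ‖f x - f y‖ ≤ H * ‖x - y‖ ^ α) (x y : V) :
    ‖hessHeat t f x - hessHeat t f y‖ ≤
      8 * heatConst V ^ 3 * t ^ ((α - 3) / 2) * H * ‖x - y‖ := by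
  have ht2 : 0 < 2⁻¹ * t := by positivity
  refine (norm_gradHeat_sub_le ht2 (continuous_gradHeat ht2 hf hK) (norm_gradHeat_le ht2 hK)
    (H := 2 * heatConst V ^ 2 * (2⁻¹ * t) ^ ((α - 2) / 2) * H * ‖x - y‖) fun z => ?_).trans ?_
  · have := norm_sub_le_of_hasFDerivAt (hasFDerivAt_gradHeat ht2 hf hK)
      (norm_hessHeat_le_of_holder ht2 hα hα1 hH hf hK hfH) (x - z) (y - z)
    simpa using this
  have e1 : (2⁻¹ * t) ^ (-(1 / 2) : ℝ) * (2⁻¹ * t) ^ ((α - 2) / 2) =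
      2⁻¹ ^ ((α - 3) / 2) * t ^ ((α - 3) / 2) := by
    rw [← Real.rpow_add ht2, ← Real.mul_rpow (by norm_num) ht.le]
    congr 1; ring
  have e2 : (2⁻¹ : ℝ) ^ ((α - 3) / 2) ≤ 4 := by
    rw [Real.inv_rpow (by norm_num), ← Real.rpow_neg (by norm_num)]
    calc (2:ℝ) ^ (-((α - 3) / 2)) ≤ 2 ^ (2:ℝ) :=
          Real.rpow_le_rpow_of_exponent_le (by norm_num) (by linarith)
      _ = 4 := by norm_num
  have hC := heatConst_pos (V := V)
  calc heatConst V * (2⁻¹ * t) ^ (-(1 / 2) : ℝ) *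
        (2 * heatConst V ^ 2 * (2⁻¹ * t) ^ ((α - 2) / 2) * H * ‖x - y‖)
      = 2 * heatConst V ^ 3 * ((2⁻¹ * t) ^ (-(1 / 2) : ℝ) * (2⁻¹ * t) ^ ((α - 2) / 2)) * H *
        ‖x - y‖ := by ring
    _ = 2 * heatConst V ^ 3 * (2⁻¹ ^ ((α - 3) / 2) * t ^ ((α - 3) / 2)) * H * ‖x - y‖ := by
        rw [e1]
    _ ≤ 2 * heatConst V ^ 3 * (4 * t ^ ((α - 3) / 2)) * H * ‖x - y‖ := by gcongr
    _ = _ := by ring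

lemma norm_gradHeat_sub_le_of_holder {t K H α : ℝ} (ht : 0 < t) (hα : 0 ≤ α) (hα1 : α ≤ 1)
    (hH : 0 ≤ H) {f : V → F} (hf : Continuous f) (hK : ∀ z, ‖f z‖ ≤ K)
    (hfH : ∀ x y, ‖f x - f y‖ ≤ H * ‖x - y‖ ^ α) (x y : V) :
    ‖gradHeat t f x - gradHeat t f y‖ ≤
      2 * heatConst V ^ 2 * t ^ ((α - 2) / 2) * H * ‖x - y‖ :=
  norm_sub_le_of_hasFDerivAt (hasFDerivAt_gradHeat ht hf hK)
    (norm_hessHeat_le_of_holder ht hα hα1 hH hf hK hfH) x y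

lemma stronglyMeasurable_heat_left {f : V → F} (hf : Continuous f) (x : V) :
    StronglyMeasurable fun r : ℝ => heat r f x :=
  (stronglyMeasurable_heat (f := fun p : ℝ × V => f p.2)
    (hf.comp continuous_snd).stronglyMeasurable).comp_measurable (by fun_prop :
      Measurable fun r : ℝ => (r, x))

lemma stronglyMeasurable_gradHeat_left {f : V → F} (hf : Continuous f) (x : V) :
    StronglyMeasurable fun r : ℝ => gradHeat r f x := by
  have := (stronglyMeasurable_gradHeat (f := fun p : ℝ × V => f p.2)
    (hf.comp continuous_snd).stronglyMeasurable 1).comp_measurable (by fun_prop :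
      Measurable fun r : ℝ => (r, x))
  simp only [one_mul] at this
  exact this

lemma stronglyMeasurable_hessHeat_left {f : V → F} (hf : Continuous f) (x : V) :
    StronglyMeasurable fun r : ℝ => hessHeat r f x := by
  have h := stronglyMeasurable_gradHeat (f := fun p : ℝ × V => f p.2)
    (hf.comp continuous_snd).stronglyMeasurable 2⁻¹
  have h2 := stronglyMeasurable_gradHeat
    (f := fun p : ℝ × V => gradHeat (2⁻¹ * p.1) (fun y => f y) p.2) h 2⁻¹
  have h3 := h2.comp_measurable (by fun_prop : Measurable fun r : ℝ => (r, x))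
  unfold hessHeat
  exact h3

end HeatRegularity

/-! ### Integrals over the time variable -/

lemma integrableOn_rpow_mul_exp {a δ : ℝ} (ha : 0 < a) (hδ : 0 < δ) :
    IntegrableOn (fun r : ℝ => r ^ (a - 1) * Real.exp (-(δ * r))) (Set.Ioi 0) := by
  have := integrableOn_rpow_mul_exp_neg_mul_rpow (p := 1) (s := a - 1) (by linarith) one_pos hδ
  simpa [neg_mul] using this

/-- The interpolation argument behind the Hölder estimates: a difference which is bounded by
`r^{q-1}` and by `d r^{q-3/2}` has an integral of size `d^{2q}`, as one sees by splitting the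
integral at `r = d²`. -/
lemma norm_integral_le_rpow_of_two_bounds {X : Type*} [NormedAddCommGroup X] [NormedSpace ℝ X]
    {D : ℝ → X} {M q d : ℝ} (hq : 0 < q) (hq2 : q < 1 / 2) (hd : 0 ≤ d)
    (hD : IntegrableOn D (Set.Ioi 0)) (h1 : ∀ r, 0 < r → ‖D r‖ ≤ M * r ^ (q - 1))
    (h2 : ∀ r, 0 < r → ‖D r‖ ≤ M * r ^ (q - 3 / 2) * d) :
    ‖∫ r in Set.Ioi 0, D r‖ ≤ M * (1 / q + 1 / (1 / 2 - q)) * d ^ (2 * q) := by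
  rcases hd.eq_or_lt with rfl | hd
  · have : ∫ r in Set.Ioi 0, D r = 0 := by
      refine setIntegral_eq_zero_of_forall_eq_zero fun r hr => ?_
      simpa using h2 r hr
    rw [this, Real.zero_rpow (by positivity)]
    simp
  have hρ : 0 < d ^ 2 := by positivity
  have hsplit : ∫ r in Set.Ioi 0, D r =
      (∫ r in Set.Ioc 0 (d ^ 2), D r) + ∫ r in Set.Ioi (d ^ 2), D r := by
    rw [← setIntegral_union (Set.Ioc_disjoint_Ioi le_rfl) measurableSet_Ioi
      (hD.mono_set Set.Ioc_subset_Ioi_self) (hD.mono_set (Set.Ioi_subset_Ioi hρ.le)),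
      Set.Ioc_union_Ioi_eq_Ioi hρ.le]
  have hdq : (d ^ 2) ^ q = d ^ (2 * q) := by
    rw [← Real.rpow_natCast d 2, ← Real.rpow_mul hd.le]; norm_num
  have hA : ‖∫ r in Set.Ioc 0 (d ^ 2), D r‖ ≤ M * (1 / q) * d ^ (2 * q) := by
    have hi : IntegrableOn (fun r : ℝ => M * r ^ (q - 1)) (Set.Ioc 0 (d ^ 2)) :=
      ((intervalIntegral.intervalIntegrable_rpow' (by linarith)).1).const_mul M
    refine (norm_integral_le_of_norm_le hi ?_).trans_eq ?_
    · exact (ae_restrict_iff' measurableSet_Ioc).2 (Eventually.of_forall fun r hr => h1 r hr.1)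
    · rw [integral_const_mul, ← intervalIntegral.integral_of_le hρ.le,
        integral_rpow (Or.inl (by linarith)), sub_add_cancel, Real.zero_rpow hq.ne', hdq]
      ring
  have hB : ‖∫ r in Set.Ioi (d ^ 2), D r‖ ≤ M * (1 / (1 / 2 - q)) * d ^ (2 * q) := by
    have hi : IntegrableOn (fun r : ℝ => M * r ^ (q - 3 / 2) * d) (Set.Ioi (d ^ 2)) :=
      ((integrableOn_Ioi_rpow_of_lt (by linarith) hρ).const_mul M).mul_const d
    refine (norm_integral_le_of_norm_le hi ?_).trans_eq ?_
    · exact (ae_restrict_iff' measurableSet_Ioi).2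
        (Eventually.of_forall fun r hr => h2 r (hρ.trans hr))
    · rw [integral_mul_const, integral_const_mul, integral_Ioi_rpow_of_lt (by linarith) hρ]
      have e : (d ^ 2) ^ (q - 3 / 2 + 1) * d = d ^ (2 * q) := by
        rw [← Real.rpow_natCast d 2, ← Real.rpow_mul hd.le]
        nth_rewrite 2 [← Real.rpow_one d]
        rw [← Real.rpow_add hd]; congr 1; push_cast; ring
      rw [show q - 3 / 2 + 1 = -(1 / 2 - q) by ring] at e ⊢
      rw [← e]
      have : (1 / 2 - q) ≠ 0 := by linarith
      field_simp
  rw [hsplit]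
  refine (norm_add_le _ _).trans ((add_le_add hA hB).trans_eq ?_)
  ring

section Bessel

set_option linter.unusedSectionVars false

variable {V : Type*} [NormedAddCommGroup V] [InnerProductSpace ℝ V] [FiniteDimensional ℝ V]
  [MeasurableSpace V] [BorelSpace V]
variable {F : Type*} [NormedAddCommGroup F] [NormedSpace ℝ F]

/-! ### Bessel potentials -/

/-- The weight `r^{s-1} e^{-δ r}`. -/
noncomputable def besselWeight (s δ r : ℝ) : ℝ := r ^ (s - 1) * Real.exp (-(δ * r))

/-- The total mass `∫_0^∞ r^{a-1} e^{-δ r} dr`. -/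
noncomputable def besselMass (a δ : ℝ) : ℝ := ∫ r in Set.Ioi 0, besselWeight a δ r

/-- The (unnormalized) Bessel potential `∫_0^∞ r^{s-1} e^{-δ r} P_r g dr`, a multiple of
`(δ - Δ)^{-s} g`. -/
noncomputable def besselPot (s δ : ℝ) (g : V → F) (x : V) : F :=
  ∫ r in Set.Ioi 0, besselWeight s δ r • heat r g x

/-- The derivative of the Bessel potential. -/
noncomputable def gradBessel (s δ : ℝ) (g : V → F) (x : V) : V →L[ℝ] F :=
  ∫ r in Set.Ioi 0, besselWeight s δ r • gradHeat r g x

/-- The second derivative of the Bessel potential. -/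
noncomputable def hessBessel (s δ : ℝ) (g : V → F) (x : V) : V →L[ℝ] V →L[ℝ] F :=
  ∫ r in Set.Ioi 0, besselWeight s δ r • hessHeat r g x

lemma besselWeight_pos (s δ : ℝ) {r : ℝ} (hr : 0 < r) : 0 < besselWeight s δ r := by
  unfold besselWeight; positivity

lemma measurable_besselWeight (s δ : ℝ) : Measurable (besselWeight s δ) := by
  unfold besselWeight; fun_prop

lemma besselWeight_le {s δ r : ℝ} (hδ : 0 ≤ δ) (hr : 0 < r) : besselWeight s δ r ≤ r ^ (s - 1) := by
  unfold besselWeight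
  refine mul_le_of_le_one_right (by positivity) (Real.exp_le_one_iff.2 ?_)
  have := mul_nonneg hδ hr.le
  linarith

lemma besselMass_eq {a δ : ℝ} (ha : 0 < a) (hδ : 0 < δ) :
    besselMass a δ = (1 / δ) ^ a * Real.Gamma a :=
  Real.integral_rpow_mul_exp_neg_mul_Ioi ha hδ

lemma besselMass_nonneg {a δ : ℝ} : 0 ≤ besselMass a δ :=
  setIntegral_nonneg measurableSet_Ioi fun _ hr => (besselWeight_pos a δ hr).le

lemma tendsto_besselMass {a : ℝ} (ha : 0 < a) : Tendsto (besselMass a) atTop (𝓝 0) := by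
  have h : Tendsto (fun δ : ℝ => (1 / δ) ^ a * Real.Gamma a) atTop (𝓝 0) := by
    have h1 := (tendsto_rpow_neg_atTop ha).mul_const (Real.Gamma a)
    rw [zero_mul] at h1
    refine h1.congr' ?_
    filter_upwards [eventually_gt_atTop 0] with δ hδ
    rw [Real.rpow_neg hδ.le, one_div, Real.inv_rpow hδ.le]
  refine h.congr' ?_
  filter_upwards [eventually_gt_atTop 0] with δ hδ
  rw [besselMass_eq ha hδ]

lemma integrableOn_besselWeight {a δ : ℝ} (ha : 0 < a) (hδ : 0 < δ) :
    IntegrableOn (besselWeight a δ) (Set.Ioi 0) := integrableOn_rpow_mul_exp ha hδ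

lemma besselWeight_mul_rpow (s δ b : ℝ) {r : ℝ} (hr : 0 < r) :
    besselWeight s δ r * r ^ b = besselWeight (s + b) δ r := by
  unfold besselWeight
  rw [show s + b - 1 = s - 1 + b by ring, Real.rpow_add hr]; ring

lemma norm_besselWeight_smul_le {s δ b A : ℝ} {φ : ℝ → F} (hφ : ∀ r, 0 < r → ‖φ r‖ ≤ A * r ^ b)
    {r : ℝ} (hr : 0 < r) : ‖besselWeight s δ r • φ r‖ ≤ A * besselWeight (s + b) δ r := by
  rw [norm_smul, Real.norm_of_nonneg (besselWeight_pos s δ hr).le, ← besselWeight_mul_rpow _ _ _ hr]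
  have := mul_le_mul_of_nonneg_left (hφ r hr) (besselWeight_pos s δ hr).le
  linarith

lemma integrableOn_besselWeight_smul {s δ b A : ℝ} (hs : 0 < s + b) (hδ : 0 < δ) {φ : ℝ → F}
    (hm : StronglyMeasurable φ) (hφ : ∀ r, 0 < r → ‖φ r‖ ≤ A * r ^ b) :
    IntegrableOn (fun r => besselWeight s δ r • φ r) (Set.Ioi 0) :=
  ((integrableOn_besselWeight hs hδ).const_mul A).mono'
    ((measurable_besselWeight s δ).stronglyMeasurable.smul hm).aestronglyMeasurable
    ((ae_restrict_iff' measurableSet_Ioi).2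
      (Eventually.of_forall fun _ hr => norm_besselWeight_smul_le hφ hr))

lemma norm_integral_besselWeight_smul_le {s δ b A : ℝ} (hs : 0 < s + b) (hδ : 0 < δ) {φ : ℝ → F}
    (hφ : ∀ r, 0 < r → ‖φ r‖ ≤ A * r ^ b) :
    ‖∫ r in Set.Ioi 0, besselWeight s δ r • φ r‖ ≤ besselMass (s + b) δ * A := by
  refine (norm_integral_le_of_norm_le ((integrableOn_besselWeight hs hδ).const_mul A)
    ((ae_restrict_iff' measurableSet_Ioi).2
      (Eventually.of_forall fun _ hr => norm_besselWeight_smul_le hφ hr))).trans_eq ?_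
  rw [integral_const_mul, mul_comm]; rfl

variable {s δ : ℝ}

section Bounds

variable [CompleteSpace F] {K : ℝ} {g : V → F}

lemma integrableOn_besselPot (hs : 0 < s) (hδ : 0 < δ) (hg : Continuous g)
    (hK : ∀ z, ‖g z‖ ≤ K) (x : V) :
    IntegrableOn (fun r => besselWeight s δ r • heat r g x) (Set.Ioi 0) :=
  integrableOn_besselWeight_smul (b := 0) (A := K) (by linarith) hδ
    (stronglyMeasurable_heat_left hg x) fun r hr => by simpa using norm_heat_le hr hK x

lemma integrableOn_gradBessel (hs : 1 / 2 < s) (hδ : 0 < δ) (hg : Continuous g)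
    (hK : ∀ z, ‖g z‖ ≤ K) (x : V) :
    IntegrableOn (fun r => besselWeight s δ r • gradHeat r g x) (Set.Ioi 0) :=
  integrableOn_besselWeight_smul (b := -(1 / 2)) (A := heatConst V * K) (by linarith) hδ
    (stronglyMeasurable_gradHeat_left hg x) fun r hr =>
      (norm_gradHeat_le hr hK x).trans_eq (by ring)

lemma norm_besselPot_le (hs : 0 < s) (hδ : 0 < δ) (hK : ∀ z, ‖g z‖ ≤ K) (x : V) :
    ‖besselPot s δ g x‖ ≤ besselMass s δ * K := by
  have := norm_integral_besselWeight_smul_le (s := s) (b := 0) (A := K) (δ := δ)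
    (φ := fun r => heat r g x) (by linarith) hδ fun r hr => by simpa using norm_heat_le hr hK x
  simpa [besselPot] using this

lemma norm_gradBessel_le (hs : 1 / 2 < s) (hδ : 0 < δ) (hK : ∀ z, ‖g z‖ ≤ K) (x : V) :
    ‖gradBessel s δ g x‖ ≤ besselMass (s - 1 / 2) δ * (heatConst V * K) :=
  norm_integral_besselWeight_smul_le (s := s) (b := -(1 / 2)) (A := heatConst V * K) (δ := δ)
    (φ := fun r => gradHeat r g x) (by linarith) hδ fun r hr =>
      (norm_gradHeat_le hr hK x).trans_eq (by ring)

lemma besselPot_sub {g' : V → F} {K' : ℝ} (hs : 0 < s) (hδ : 0 < δ) (hg : Continuous g)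
    (hK : ∀ z, ‖g z‖ ≤ K) (hg' : Continuous g') (hK' : ∀ z, ‖g' z‖ ≤ K') (x : V) :
    besselPot s δ (fun y => g y - g' y) x = besselPot s δ g x - besselPot s δ g' x := by
  unfold besselPot
  rw [← integral_sub (integrableOn_besselPot hs hδ hg hK x)
    (integrableOn_besselPot hs hδ hg' hK' x)]
  refine setIntegral_congr_fun measurableSet_Ioi fun r hr => ?_
  rw [heat_sub hr hg hK hg' hK', smul_sub]

lemma gradBessel_sub {g' : V → F} {K' : ℝ} (hs : 1 / 2 < s) (hδ : 0 < δ) (hg : Continuous g)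
    (hK : ∀ z, ‖g z‖ ≤ K) (hg' : Continuous g') (hK' : ∀ z, ‖g' z‖ ≤ K') (x : V) :
    gradBessel s δ (fun y => g y - g' y) x = gradBessel s δ g x - gradBessel s δ g' x := by
  unfold gradBessel
  rw [← integral_sub (integrableOn_gradBessel hs hδ hg hK x)
    (integrableOn_gradBessel hs hδ hg' hK' x)]
  refine setIntegral_congr_fun measurableSet_Ioi fun r hr => ?_
  rw [gradHeat_sub hr hg hK hg' hK', smul_sub]

/-- Bessel potentials are differentiable when `s > 1/2`, since `∇P_r` has norm `O(r^{-1/2})`. -/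
lemma hasFDerivAt_besselPot (hs : 1 / 2 < s) (hδ : 0 < δ) (hg : Continuous g)
    (hK : ∀ z, ‖g z‖ ≤ K) (x : V) :
    HasFDerivAt (besselPot s δ g) (gradBessel s δ g x) x := by
  refine hasFDerivAt_integral_of_dominated_of_fderiv_le (𝕜 := ℝ) (E := F) (H := V)
    (F := fun x r => besselWeight s δ r • heat r g x)
    (F' := fun x r => besselWeight s δ r • gradHeat r g x) (s := Set.univ) univ_mem
    (bound := fun r : ℝ => heatConst V * K * besselWeight (s + -(1 / 2)) δ r)
    (Eventually.of_forall fun w => ?_) ?_ ?_ ?_ ?_ ?_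
  · exact (integrableOn_besselPot (by linarith) hδ hg hK w).aestronglyMeasurable
  · exact integrableOn_besselPot (by linarith) hδ hg hK x
  · exact (integrableOn_gradBessel hs hδ hg hK x).aestronglyMeasurable
  · refine (ae_restrict_iff' measurableSet_Ioi).2 (Eventually.of_forall fun r hr w _ => ?_)
    exact norm_besselWeight_smul_le (φ := fun r => gradHeat r g w) (fun r hr =>
      (norm_gradHeat_le hr hK w).trans_eq (by ring)) hr
  · exact (integrableOn_besselWeight (by linarith) hδ).const_mul _
  · refine (ae_restrict_iff' measurableSet_Ioi).2 (Eventually.of_forall fun r hr w _ => ?_)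
    exact (hasFDerivAt_heat hr hg hK w).const_smul (besselWeight s δ r)

lemma continuous_gradBessel (hs : 1 / 2 < s) (hδ : 0 < δ) (hg : Continuous g)
    (hK : ∀ z, ‖g z‖ ≤ K) : Continuous (gradBessel s δ g) := by
  refine continuous_of_dominated (F := fun x r => besselWeight s δ r • gradHeat r g x)
    (bound := fun r : ℝ => heatConst V * K * besselWeight (s + -(1 / 2)) δ r)
    (fun w => (integrableOn_gradBessel hs hδ hg hK w).aestronglyMeasurable) (fun w => ?_) ?_ ?_
  · refine (ae_restrict_iff' measurableSet_Ioi).2 (Eventually.of_forall fun r hr => ?_)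
    exact norm_besselWeight_smul_le (φ := fun r => gradHeat r g w) (fun r hr =>
      (norm_gradHeat_le hr hK w).trans_eq (by ring)) hr
  · exact (integrableOn_besselWeight (by linarith) hδ).const_mul _
  · refine (ae_restrict_iff' measurableSet_Ioi).2 (Eventually.of_forall fun r hr => ?_)
    exact (continuous_gradHeat hr hg hK).const_smul (besselWeight s δ r)

lemma one_le_heatConst : 1 ≤ heatConst V := by
  have : (1:ℝ) ≤ 2 ^ ((Module.finrank ℝ V : ℝ) / 2) :=
    Real.one_le_rpow (by norm_num) (by positivity)
  unfold heatConst; linarith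

end Bounds

section Schauder

set_option maxSynthPendingDepth 3

variable [CompleteSpace F] {K H α : ℝ} {g : V → F}

/-- The Schauder estimate for the Bessel potential when `1 < 2s + α < 2`. -/
lemma norm_gradBessel_sub_le_of_holder (hδ : 0 < δ) (hα : 0 ≤ α) (hα1 : α ≤ 1)
    (hs1 : 1 / 2 < s) (hs2 : 2 * s + α < 2) (hH : 0 ≤ H) (hg : Continuous g)
    (hK : ∀ z, ‖g z‖ ≤ K) (hgH : ∀ x y, ‖g x - g y‖ ≤ H * ‖x - y‖ ^ α) (x y : V) :
    ‖gradBessel s δ g x - gradBessel s δ g y‖ ≤ 2 * heatConst V ^ 2 * H *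
      (1 / (s + (α - 1) / 2) + 1 / (1 / 2 - (s + (α - 1) / 2))) * ‖x - y‖ ^ (2 * s + α - 1) := by
  have hC := one_le_heatConst (V := V)
  have hCC : heatConst V ≤ heatConst V ^ 2 := by nlinarith
  unfold gradBessel
  rw [← integral_sub (integrableOn_gradBessel hs1 hδ hg hK x)
    (integrableOn_gradBessel hs1 hδ hg hK y)]
  simp_rw [← smul_sub]
  have := norm_integral_le_rpow_of_two_bounds
    (D := fun r => besselWeight s δ r • (gradHeat r g x - gradHeat r g y))
    (M := 2 * heatConst V ^ 2 * H) (q := s + (α - 1) / 2) (d := ‖x - y‖)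
    (by linarith) (by linarith) (norm_nonneg _)
    (by simp_rw [smul_sub]; exact (integrableOn_gradBessel hs1 hδ hg hK x).sub
          (integrableOn_gradBessel hs1 hδ hg hK y)) (fun r hr => ?_) (fun r hr => ?_)
  · rwa [show 2 * (s + (α - 1) / 2) = 2 * s + α - 1 by ring] at this
  · rw [norm_smul, Real.norm_of_nonneg (besselWeight_pos s δ hr).le,
      show s + (α - 1) / 2 - 1 = (s - 1) + (α - 1) / 2 by ring, Real.rpow_add hr]
    have h1 := norm_gradHeat_le_of_holder hr hα hα1 hH hg hK hgH x
    have h2 := norm_gradHeat_le_of_holder hr hα hα1 hH hg hK hgH y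
    have h3 := (norm_sub_le _ _).trans (add_le_add h1 h2)
    calc _ ≤ r ^ (s - 1) * (heatConst V * r ^ ((α - 1) / 2) * H +
          heatConst V * r ^ ((α - 1) / 2) * H) := by
          gcongr
          exact besselWeight_le hδ.le hr
      _ = 2 * heatConst V * (H * (r ^ (s - 1) * r ^ ((α - 1) / 2))) := by ring
      _ ≤ 2 * heatConst V ^ 2 * (H * (r ^ (s - 1) * r ^ ((α - 1) / 2))) := by gcongr
      _ = _ := by ring
  · rw [norm_smul, Real.norm_of_nonneg (besselWeight_pos s δ hr).le,
      show s + (α - 1) / 2 - 3 / 2 = (s - 1) + (α - 2) / 2 by ring, Real.rpow_add hr]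
    have h1 := norm_gradHeat_sub_le_of_holder hr hα hα1 hH hg hK hgH x y
    calc _ ≤ r ^ (s - 1) * (2 * heatConst V ^ 2 * r ^ ((α - 2) / 2) * H * ‖x - y‖) := by
          gcongr
          exact besselWeight_le hδ.le hr
      _ = _ := by ring

lemma integrableOn_hessBessel (hδ : 0 < δ) (hα : 0 ≤ α) (hα1 : α ≤ 1)
    (hs2 : 2 < 2 * s + α) (hH : 0 ≤ H) (hg : Continuous g)
    (hK : ∀ z, ‖g z‖ ≤ K) (hgH : ∀ x y, ‖g x - g y‖ ≤ H * ‖x - y‖ ^ α) (x : V) :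
    IntegrableOn (fun r => besselWeight s δ r • hessHeat r g x) (Set.Ioi 0) :=
  integrableOn_besselWeight_smul (b := (α - 2) / 2) (A := 2 * heatConst V ^ 2 * H)
    (by linarith) hδ (stronglyMeasurable_hessHeat_left hg x) fun r hr =>
      (norm_hessHeat_le_of_holder hr hα hα1 hH hg hK hgH x).trans_eq (by ring)

lemma norm_hessBessel_le (hδ : 0 < δ) (hα : 0 ≤ α) (hα1 : α ≤ 1)
    (hs2 : 2 < 2 * s + α) (hH : 0 ≤ H) (hg : Continuous g)
    (hK : ∀ z, ‖g z‖ ≤ K) (hgH : ∀ x y, ‖g x - g y‖ ≤ H * ‖x - y‖ ^ α) (x : V) :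
    ‖hessBessel s δ g x‖ ≤ besselMass (s + (α - 2) / 2) δ * (2 * heatConst V ^ 2 * H) :=
  norm_integral_besselWeight_smul_le (s := s) (φ := fun r => hessHeat r g x)
    (by linarith) hδ fun r hr =>
      (norm_hessHeat_le_of_holder hr hα hα1 hH hg hK hgH x).trans_eq (by ring)

lemma hasFDerivAt_gradBessel (hδ : 0 < δ) (hα : 0 ≤ α) (hα1 : α ≤ 1)
    (hs2 : 2 < 2 * s + α) (hH : 0 ≤ H) (hg : Continuous g)
    (hK : ∀ z, ‖g z‖ ≤ K) (hgH : ∀ x y, ‖g x - g y‖ ≤ H * ‖x - y‖ ^ α) (x : V) :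
    HasFDerivAt (gradBessel s δ g) (hessBessel s δ g x) x := by
  have hs1 : 1 / 2 < s := by linarith
  refine hasFDerivAt_integral_of_dominated_of_fderiv_le (𝕜 := ℝ) (E := V →L[ℝ] F) (H := V)
    (F := fun x r => besselWeight s δ r • gradHeat r g x)
    (F' := fun x r => besselWeight s δ r • hessHeat r g x) (s := Set.univ) univ_mem
    (bound := fun r : ℝ => 2 * heatConst V ^ 2 * H * besselWeight (s + (α - 2) / 2) δ r)
    (Eventually.of_forall fun w => ?_) ?_ ?_ ?_ ?_ ?_
  · exact (integrableOn_gradBessel hs1 hδ hg hK w).aestronglyMeasurable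
  · exact integrableOn_gradBessel hs1 hδ hg hK x
  · exact (integrableOn_hessBessel hδ hα hα1 hs2 hH hg hK hgH x).aestronglyMeasurable
  · refine (ae_restrict_iff' measurableSet_Ioi).2 (Eventually.of_forall fun r hr w _ => ?_)
    exact norm_besselWeight_smul_le (φ := fun r => hessHeat r g w) (fun r hr =>
      (norm_hessHeat_le_of_holder hr hα hα1 hH hg hK hgH w).trans_eq (by ring)) hr
  · exact (integrableOn_besselWeight (by linarith) hδ).const_mul _
  · refine (ae_restrict_iff' measurableSet_Ioi).2 (Eventually.of_forall fun r hr w _ => ?_)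
    exact (hasFDerivAt_gradHeat hr hg hK w).const_smul (besselWeight s δ r)

/-- The Schauder estimate for the Bessel potential when `2 < 2s + α < 3`. -/
lemma norm_hessBessel_sub_le_of_holder (hδ : 0 < δ) (hα : 0 ≤ α) (hα1 : α ≤ 1)
    (hs2 : 2 < 2 * s + α) (hs3 : 2 * s + α < 3) (hH : 0 ≤ H) (hg : Continuous g)
    (hK : ∀ z, ‖g z‖ ≤ K) (hgH : ∀ x y, ‖g x - g y‖ ≤ H * ‖x - y‖ ^ α) (x y : V) :
    ‖hessBessel s δ g x - hessBessel s δ g y‖ ≤ 8 * heatConst V ^ 3 * H *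
      (1 / (s + (α - 2) / 2) + 1 / (1 / 2 - (s + (α - 2) / 2))) * ‖x - y‖ ^ (2 * s + α - 2) := by
  have hC := one_le_heatConst (V := V)
  have hCC : heatConst V ^ 2 ≤ heatConst V ^ 3 := pow_le_pow_right₀ hC (by norm_num)
  unfold hessBessel
  rw [← integral_sub (integrableOn_hessBessel hδ hα hα1 hs2 hH hg hK hgH x)
    (integrableOn_hessBessel hδ hα hα1 hs2 hH hg hK hgH y)]
  simp_rw [← smul_sub]
  have := norm_integral_le_rpow_of_two_bounds
    (D := fun r => besselWeight s δ r • (hessHeat r g x - hessHeat r g y))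
    (M := 8 * heatConst V ^ 3 * H) (q := s + (α - 2) / 2) (d := ‖x - y‖)
    (by linarith) (by linarith) (norm_nonneg _)
    (by simp_rw [smul_sub]; exact (integrableOn_hessBessel hδ hα hα1 hs2 hH hg hK hgH x).sub
          (integrableOn_hessBessel hδ hα hα1 hs2 hH hg hK hgH y)) (fun r hr => ?_) (fun r hr => ?_)
  · rwa [show 2 * (s + (α - 2) / 2) = 2 * s + α - 2 by ring] at this
  · rw [norm_smul, Real.norm_of_nonneg (besselWeight_pos s δ hr).le,
      show s + (α - 2) / 2 - 1 = (s - 1) + (α - 2) / 2 by ring, Real.rpow_add hr]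
    have h1 := norm_hessHeat_le_of_holder hr hα hα1 hH hg hK hgH x
    have h2 := norm_hessHeat_le_of_holder hr hα hα1 hH hg hK hgH y
    have h3 := (norm_sub_le _ _).trans (add_le_add h1 h2)
    calc _ ≤ r ^ (s - 1) * (2 * heatConst V ^ 2 * r ^ ((α - 2) / 2) * H +
          2 * heatConst V ^ 2 * r ^ ((α - 2) / 2) * H) := by
          gcongr
          exact besselWeight_le hδ.le hr
      _ = 4 * heatConst V ^ 2 * (H * (r ^ (s - 1) * r ^ ((α - 2) / 2))) := by ring
      _ ≤ 8 * heatConst V ^ 3 * (H * (r ^ (s - 1) * r ^ ((α - 2) / 2))) := by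
          gcongr ?_ * _
          nlinarith
      _ = _ := by ring
  · rw [norm_smul, Real.norm_of_nonneg (besselWeight_pos s δ hr).le,
      show s + (α - 2) / 2 - 3 / 2 = (s - 1) + (α - 3) / 2 by ring, Real.rpow_add hr]
    have h1 := norm_hessHeat_sub_le_of_holder hr hα hα1 hH hg hK hgH x y
    calc _ ≤ r ^ (s - 1) * (8 * heatConst V ^ 3 * r ^ ((α - 3) / 2) * H * ‖x - y‖) := by
          gcongr
          exact besselWeight_le hδ.le hr
      _ = _ := by ring

end Schauder

end Bessel

/-! ### Inversion of the Bessel potential along the semigroup -/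

/-- An absolutely convergent integral is the limit of its truncations to `{ε < q}` as `ε ↓ 0`. -/
lemma tendsto_setIntegral_lt {X : Type*} [MeasurableSpace X] {μ : Measure X} {φ : X → ℝ}
    (hφ : Integrable φ μ) {q : X → ℝ} (hq : Measurable q) (hpos : ∀ᵐ x ∂μ, 0 < q x ∨ φ x = 0) :
    Tendsto (fun ε : ℝ => ∫ x in {x | ε < q x}, φ x ∂μ) (𝓝[>] 0) (𝓝 (∫ x, φ x ∂μ)) := by
  have hm : ∀ ε : ℝ, MeasurableSet {x | ε < q x} := fun ε => measurableSet_lt measurable_const hq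
  simp_rw [← integral_indicator (hm _)]
  refine tendsto_integral_filter_of_dominated_convergence (fun x => ‖φ x‖)
    (Eventually.of_forall fun ε => hφ.aestronglyMeasurable.indicator (hm ε))
    (Eventually.of_forall fun ε => Eventually.of_forall fun x => norm_indicator_le_norm_self _ _)
    hφ.norm ?_
  filter_upwards [hpos] with x hx
  rcases hx with hx | hx
  · refine tendsto_const_nhds.congr' ?_
    filter_upwards [Ioo_mem_nhdsGT hx] with ε hε
    rw [Set.indicator_of_mem]
    exact hε.2
  · have : ∀ ε : ℝ, Set.indicator {x | ε < q x} φ x = 0 := fun ε => by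
      by_cases h : x ∈ {x | ε < q x} <;> simp [h, hx]
    simp [this, hx]

/-- The incomplete beta integral `∫_ε^y t^{-1-s} (y - t)^{s-1} dt`, with the primitive
`-((y - t) / t)^s / (s y)`. -/
lemma integral_rpow_mul_sub_rpow {s ε y : ℝ} (hs : 0 < s) (hε : 0 < ε) (hy : ε ≤ y) :
    IntegrableOn (fun t : ℝ => t ^ (-1 - s) * (y - t) ^ (s - 1)) (Set.Ioc ε y) ∧
    ∫ t in Set.Ioc ε y, t ^ (-1 - s) * (y - t) ^ (s - 1) = ((y - ε) / ε) ^ s / (s * y) := by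
  have hy0 : 0 < y := hε.trans_le hy
  set g : ℝ → ℝ := fun t => -(((y - t) / t) ^ s / (s * y)) with hg
  have hcont : ContinuousOn g (Set.Icc ε y) := by
    refine ((ContinuousOn.rpow_const ?_ fun x hx => Or.inr hs.le).div_const _).neg
    exact (continuousOn_const.sub continuousOn_id).div continuousOn_id
      fun x hx => (hε.trans_le hx.1).ne'
  have hder : ∀ x ∈ Set.Ioo ε y, HasDerivAt g (x ^ (-1 - s) * (y - x) ^ (s - 1)) x := by
    intro x hx
    have hx0 : 0 < x := hε.trans hx.1
    have hyx : 0 < y - x := sub_pos.2 hx.2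
    have h1 : HasDerivAt (fun t : ℝ => (y - t) / t) ((-1 * x - (y - x) * 1) / x ^ 2) x :=
      ((hasDerivAt_id x).const_sub y).div (hasDerivAt_id x) hx0.ne'
    have h2 := ((h1.rpow_const (p := s) (Or.inl (div_pos hyx hx0).ne')).div_const (s * y)).neg
    refine h2.congr_deriv ?_
    have h3 : x ^ (-1 - s) = (x ^ (s - 1))⁻¹ / x ^ 2 := by
      rw [← Real.rpow_neg hx0.le, ← Real.rpow_two, ← Real.rpow_sub hx0]
      congr 1; ring
    rw [Real.div_rpow hyx.le hx0.le, h3]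
    field_simp
    ring
  have hint : IntegrableOn (fun t : ℝ => t ^ (-1 - s) * (y - t) ^ (s - 1)) (Set.Ioc ε y) := by
    refine intervalIntegral.integrableOn_deriv_of_nonneg hcont hder fun x hx => ?_
    have hx0 : 0 < x := hε.trans hx.1
    have hyx : 0 < y - x := sub_pos.2 hx.2
    positivity
  refine ⟨hint, ?_⟩
  rw [← intervalIntegral.integral_of_le hy,
    intervalIntegral.integral_eq_sub_of_hasDerivAt_of_le hy hcont hder
      ((intervalIntegrable_iff_integrableOn_Ioc_of_le hy).2 hint)]
  simp [hg, Real.zero_rpow hs.ne']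

/-- The kernel `(ρ^s - (ρ-1)_+^s) / (s ρ)` which appears when the Marchaud derivative of order `s`,
truncated at time `1`, is applied to the fractional integral of order `s`. -/
noncomputable def marchaudKernel (s ρ : ℝ) : ℝ := (ρ ^ s - (max (ρ - 1) 0) ^ s) / (s * ρ)

/-- The mass of `marchaudKernel`. -/
noncomputable def marchaudConst (s : ℝ) : ℝ := ∫ ρ in Set.Ioi 0, marchaudKernel s ρ

lemma marchaudKernel_pos {s ρ : ℝ} (hs : 0 < s) (hρ : 0 < ρ) : 0 < marchaudKernel s ρ := by
  unfold marchaudKernel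
  have : max (ρ - 1) 0 ^ s < ρ ^ s :=
    Real.rpow_lt_rpow (le_max_right _ _) (max_lt (by linarith) hρ) hs
  have := sub_pos.2 this
  positivity

lemma integrableOn_marchaudKernel {s : ℝ} (hs : 0 < s) (hs1 : s < 1) :
    IntegrableOn (marchaudKernel s) (Set.Ioi 0) := by
  have hm : Measurable (marchaudKernel s) := by unfold marchaudKernel; fun_prop
  rw [← Set.Ioc_union_Ioi_eq_Ioi zero_le_one, integrableOn_union]
  constructor
  · have h : IntegrableOn (fun ρ : ℝ => ρ ^ (s - 1) * (1 / s)) (Set.Ioc 0 1) :=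
      ((intervalIntegral.intervalIntegrable_rpow' (by linarith)).1).mul_const _
    refine h.mono' hm.aestronglyMeasurable ?_
    refine (ae_restrict_iff' measurableSet_Ioc).2 (Eventually.of_forall fun ρ hρ => ?_)
    rw [Real.norm_of_nonneg (marchaudKernel_pos hs hρ.1).le]
    unfold marchaudKernel
    rw [max_eq_right (by linarith [hρ.2]), Real.zero_rpow hs.ne', sub_zero,
      Real.rpow_sub hρ.1, Real.rpow_one]
    apply le_of_eq
    field_simp
  · have h : IntegrableOn (fun ρ : ℝ => ρ ^ (s - 2) * (1 / s)) (Set.Ioi 1) :=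
      (integrableOn_Ioi_rpow_of_lt (by linarith) one_pos).mul_const _
    refine h.mono' hm.aestronglyMeasurable ?_
    refine (ae_restrict_iff' measurableSet_Ioi).2 (Eventually.of_forall fun ρ hρ => ?_)
    have hρ1 : 1 < ρ := hρ
    have hρ0 : 0 < ρ := by linarith
    rw [Real.norm_of_nonneg (marchaudKernel_pos hs hρ0).le]
    unfold marchaudKernel
    rw [max_eq_left (by linarith)]
    have h1 : ρ ^ s * ((ρ - 1) / ρ) ≤ (ρ - 1) ^ s := by
      have h2 : (ρ - 1) / ρ ≤ ((ρ - 1) / ρ) ^ s := by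
        have h3 : 0 < (ρ - 1) / ρ := div_pos (by linarith) hρ0
        have h4 : (ρ - 1) / ρ ≤ 1 := (div_le_one hρ0).2 (by linarith)
        simpa using Real.rpow_le_rpow_of_exponent_ge h3 h4 hs1.le
      rw [Real.div_rpow (by linarith) hρ0.le] at h2
      have h5 : 0 < ρ ^ s := by positivity
      calc ρ ^ s * ((ρ - 1) / ρ) ≤ ρ ^ s * ((ρ - 1) ^ s / ρ ^ s) := by gcongr
        _ = _ := by field_simp
    rw [Real.rpow_sub hρ0, Real.rpow_two]
    have h6 : ρ ^ s - (ρ - 1) ^ s ≤ ρ ^ s / ρ := by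
      have : ρ ^ s * ((ρ - 1) / ρ) = ρ ^ s - ρ ^ s / ρ := by field_simp
      linarith
    calc (ρ ^ s - (ρ - 1) ^ s) / (s * ρ) ≤ (ρ ^ s / ρ) / (s * ρ) := by gcongr
      _ = _ := by field_simp

lemma marchaudConst_pos {s : ℝ} (hs : 0 < s) (hs1 : s < 1) : 0 < marchaudConst s := by
  unfold marchaudConst
  rw [setIntegral_pos_iff_support_of_nonneg_ae]
  · have : Function.support (marchaudKernel s) ∩ Set.Ioi 0 = Set.Ioi 0 :=
      Set.inter_eq_right.2 fun ρ hρ => (marchaudKernel_pos hs hρ).ne'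
    rw [this]
    simp
  · exact (ae_restrict_iff' measurableSet_Ioi).2
      (Eventually.of_forall fun ρ hρ => (marchaudKernel_pos hs hρ).le)
  · exact integrableOn_marchaudKernel hs hs1

section Inversion

variable {s δ K h₀ : ℝ} {h : ℝ → ℝ}

lemma integrableOn_rpow_mul_of_exp_bound (hs : 0 < s) (hδ : 0 < δ) (hm : Measurable h)
    (hK : ∀ r, 0 < r → |h r| ≤ K * Real.exp (-(δ * r))) :
    IntegrableOn (fun r => r ^ (s - 1) * h r) (Set.Ioi 0) := by
  refine ((integrableOn_rpow_mul_exp hs hδ).const_mul K).mono'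
    (by fun_prop : Measurable fun r => r ^ (s - 1) * h r).aestronglyMeasurable ?_
  refine (ae_restrict_iff' measurableSet_Ioi).2 (Eventually.of_forall fun r hr => ?_)
  have hr0 : 0 < r := hr
  rw [norm_mul, Real.norm_of_nonneg (by positivity), Real.norm_eq_abs]
  have := mul_le_mul_of_nonneg_left (hK r hr) (by positivity : 0 ≤ r ^ (s - 1))
  linarith

/-- Fubini for the truncated Marchaud derivative of `t ↦ ∫_0^∞ r^{s-1} h (r + t) dr`: with
`y = r + t`, the integral over `t ∈ (ε, y)` is an incomplete beta integral. -/
lemma integral_truncated_marchaud (hs : 0 < s) (hδ : 0 < δ) (hm : Measurable h)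
    (hK : ∀ r, 0 < r → |h r| ≤ K * Real.exp (-(δ * r))) {ε : ℝ} (hε : 0 < ε) :
    IntegrableOn (fun y => h y * (((y - ε) / ε) ^ s / (s * y))) (Set.Ioi ε) ∧
    IntegrableOn (fun t => t ^ (-1 - s) * ∫ r in Set.Ioi 0, r ^ (s - 1) * h (r + t)) (Set.Ioi ε) ∧
    ∫ t in Set.Ioi ε, t ^ (-1 - s) * ∫ r in Set.Ioi 0, r ^ (s - 1) * h (r + t) =
      ∫ y in Set.Ioi ε, h y * (((y - ε) / ε) ^ s / (s * y)) := by
  -- the integrand after the substitution `y = r + t`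
  set f : ℝ → ℝ → ℝ := fun t y => (Set.Ioi t).indicator
    (fun y => t ^ (-1 - s) * (y - t) ^ (s - 1) * h y) y with hf
  have hfm : Measurable (Function.uncurry f) := by
    have : Function.uncurry f = Set.indicator {p : ℝ × ℝ | p.1 < p.2}
        (fun p => p.1 ^ (-1 - s) * (p.2 - p.1) ^ (s - 1) * h p.2) := by
      ext p
      simp only [Function.uncurry, hf, Set.indicator, Set.mem_Ioi, Set.mem_ofPred_eq]
    rw [this]
    exact Measurable.indicator (by fun_prop) (measurableSet_lt measurable_fst measurable_snd)
  have hin : ∀ t, ∫ y in Set.Ioi ε, f t y = ∫ y in Set.Ioi ε ∩ Set.Ioi t,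
      t ^ (-1 - s) * (y - t) ^ (s - 1) * h y := fun t => by
    rw [hf]; simp only; rw [setIntegral_indicator measurableSet_Ioi]
  have hleft : ∀ t ∈ Set.Ioi ε, ∫ y in Set.Ioi ε, f t y =
      t ^ (-1 - s) * ∫ r in Set.Ioi 0, r ^ (s - 1) * h (r + t) := by
    intro t ht
    rw [hin, Set.inter_eq_right.2 (Set.Ioi_subset_Ioi (le_of_lt ht))]
    simp_rw [mul_assoc]
    rw [integral_const_mul]
    have := (measurePreserving_add_right volume t).setIntegral_preimage_emb
      (measurableEmbedding_addRight t) (fun y => (y - t) ^ (s - 1) * h y) (Set.Ioi t)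
    rw [← this]
    simp
  -- for fixed `y` the integrand in `t` lives on `(ε, y)`
  have hfy : ∀ y, ∀ t ∈ Set.Ioi ε, f t y = (Set.Iio y).indicator
      (fun t => t ^ (-1 - s) * (y - t) ^ (s - 1) * h y) t := by
    intro y t _
    simp only [hf, Set.indicator, Set.mem_Ioi, Set.mem_Iio]
  have hright_int : ∀ y ∈ Set.Ioi ε,
      IntegrableOn (fun t => t ^ (-1 - s) * (y - t) ^ (s - 1)) (Set.Ioi ε ∩ Set.Iio y) := by
    intro y hy
    exact (integral_rpow_mul_sub_rpow hs hε (le_of_lt hy)).1.mono_set fun t ht => ⟨ht.1, ht.2.le⟩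
  have hval : ∀ y ∈ Set.Ioi ε, ∫ t in Set.Ioi ε ∩ Set.Iio y, t ^ (-1 - s) * (y - t) ^ (s - 1) =
      ((y - ε) / ε) ^ s / (s * y) := by
    intro y hy
    rw [Set.Ioi_inter_Iio, ← integral_Ioc_eq_integral_Ioo,
      (integral_rpow_mul_sub_rpow hs hε (le_of_lt hy)).2]
  have hright : ∀ y ∈ Set.Ioi ε, ∫ t in Set.Ioi ε, f t y = h y * (((y - ε) / ε) ^ s / (s * y)) := by
    intro y hy
    rw [setIntegral_congr_fun measurableSet_Ioi (hfy y), setIntegral_indicator measurableSet_Iio,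
      integral_mul_const, hval y hy, mul_comm]
  have hright_norm : ∀ y ∈ Set.Ioi ε, ∫ t in Set.Ioi ε, ‖f t y‖ =
      |h y| * (((y - ε) / ε) ^ s / (s * y)) := by
    intro y hy
    have : ∀ t ∈ Set.Ioi ε, ‖f t y‖ = (Set.Iio y).indicator
      (fun t => t ^ (-1 - s) * (y - t) ^ (s - 1) * |h y|) t := by
      intro t ht
      rw [hfy y t ht]
      by_cases hty : t ∈ Set.Iio y
      · have h1 : 0 < t := hε.trans ht
        have h2 : 0 < y - t := sub_pos.2 hty
        simp only [Set.indicator_of_mem hty]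
        rw [norm_mul, Real.norm_of_nonneg (by positivity), Real.norm_eq_abs]
      · simp [Set.indicator_of_notMem hty]
    rw [setIntegral_congr_fun measurableSet_Ioi this, setIntegral_indicator measurableSet_Iio,
      integral_mul_const, hval y hy, mul_comm]
  -- the kernel grows at most like `y^{s-1}`, so the exponential decay of `h` suffices
  have hdom : IntegrableOn (fun y => |h y| * (((y - ε) / ε) ^ s / (s * y))) (Set.Ioi ε) := by
    have h1 : IntegrableOn (fun y => K * (ε ^ (-s) / s) * (y ^ (s - 1) * Real.exp (-(δ * y))))
        (Set.Ioi ε) :=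
      IntegrableOn.mono_set ((integrableOn_rpow_mul_exp hs hδ).const_mul _)
        (Set.Ioi_subset_Ioi hε.le)
    refine h1.mono' (by fun_prop : Measurable fun y => |h y| *
      (((y - ε) / ε) ^ s / (s * y))).aestronglyMeasurable ?_
    refine (ae_restrict_iff' measurableSet_Ioi).2 (Eventually.of_forall fun y hy => ?_)
    have hy0 : 0 < y := hε.trans hy
    have hye : 0 < y - ε := sub_pos.2 hy
    rw [Real.norm_of_nonneg (by positivity)]
    have h2 : ((y - ε) / ε) ^ s ≤ y ^ s * ε ^ (-s) := by
      rw [Real.rpow_neg hε.le, ← div_eq_mul_inv, ← Real.div_rpow hy0.le hε.le]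
      gcongr
      linarith
    calc |h y| * (((y - ε) / ε) ^ s / (s * y))
        ≤ (K * Real.exp (-(δ * y))) * ((y ^ s * ε ^ (-s)) / (s * y)) := by
          gcongr
          · exact (abs_nonneg _).trans (hK y hy0)
          · exact hK y hy0
      _ = _ := by
          rw [Real.rpow_sub hy0, Real.rpow_one]; field_simp
  have hprod : Integrable (Function.uncurry f)
      ((volume.restrict (Set.Ioi ε)).prod (volume.restrict (Set.Ioi ε))) := by
    rw [integrable_prod_iff' hfm.aestronglyMeasurable]
    constructor
    · refine (ae_restrict_iff' measurableSet_Ioi).2 (Eventually.of_forall fun y hy => ?_)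
      have h1 : IntegrableOn ((Set.Iio y).indicator
          (fun t => t ^ (-1 - s) * (y - t) ^ (s - 1) * h y)) (Set.Ioi ε) := by
        rw [integrableOn_indicator_iff measurableSet_Iio, Set.inter_comm]
        exact (hright_int y hy).mul_const _
      exact h1.congr_fun (fun t ht => (hfy y t ht).symm) measurableSet_Ioi
    · exact hdom.congr_fun (fun y hy => (hright_norm y hy).symm) measurableSet_Ioi
  refine ⟨hdom.mono' (by fun_prop : Measurable fun y => h y *
      (((y - ε) / ε) ^ s / (s * y))).aestronglyMeasurable ?_, ?_, ?_⟩
  · refine (ae_restrict_iff' measurableSet_Ioi).2 (Eventually.of_forall fun y hy => ?_)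
    have hy0 : 0 < y := hε.trans hy
    have hye : 0 < y - ε := sub_pos.2 hy
    rw [norm_mul, Real.norm_eq_abs, Real.norm_of_nonneg (by positivity)]
  · exact IntegrableOn.congr_fun (hprod.integral_prod_left) hleft measurableSet_Ioi
  · rw [← setIntegral_congr_fun measurableSet_Ioi hleft, integral_integral_swap hprod,
      setIntegral_congr_fun measurableSet_Ioi hright]

/-- The Marchaud derivative of order `s` inverts the fractional integral of order `s`: with
`U t = ∫_0^∞ r^{s-1} h (r + t) dr`, the integral `∫_0^∞ t^{-1-s} (U 0 - U t) dt` is a multiple of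
`h (0+)`. Truncated at `t > ε`, it is the average of `h` against a dilated kernel. -/
lemma integral_marchaud (hs : 0 < s) (hs1 : s < 1) (hδ : 0 < δ) (hm : Measurable h)
    (hK : ∀ r, 0 < r → |h r| ≤ K * Real.exp (-(δ * r))) (h0 : Tendsto h (𝓝[>] 0) (𝓝 h₀))
    (hint : IntegrableOn (fun t => t ^ (-1 - s) * ((∫ r in Set.Ioi 0, r ^ (s - 1) * h r) -
      ∫ r in Set.Ioi 0, r ^ (s - 1) * h (r + t))) (Set.Ioi 0)) :
    ∫ t in Set.Ioi 0, t ^ (-1 - s) * ((∫ r in Set.Ioi 0, r ^ (s - 1) * h r) -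
      ∫ r in Set.Ioi 0, r ^ (s - 1) * h (r + t)) = marchaudConst s * h₀ := by
  set U₀ := ∫ r in Set.Ioi 0, r ^ (s - 1) * h r with hU₀
  have hK0 : 0 ≤ K := by
    have := (abs_nonneg _).trans (hK 1 one_pos)
    exact nonneg_of_mul_nonneg_left this (Real.exp_pos _)
  have hL := tendsto_setIntegral_lt (μ := volume.restrict (Set.Ioi 0)) hint measurable_id
    ((ae_restrict_iff' measurableSet_Ioi).2 (Eventually.of_forall fun t ht => Or.inl ht))
  -- the averages of `h` against the dilated kernels converge, as `h` is continuous at `0+`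
  have hR : Tendsto (fun ε : ℝ => ∫ ρ in Set.Ioi 0, marchaudKernel s ρ * h (ε * ρ)) (𝓝[>] 0)
      (𝓝 (∫ ρ in Set.Ioi 0, marchaudKernel s ρ * h₀)) := by
    refine tendsto_integral_filter_of_dominated_convergence (fun ρ => marchaudKernel s ρ * K)
      (Eventually.of_forall fun ε => ?_) ?_ ((integrableOn_marchaudKernel hs hs1).mul_const K) ?_
    · have : Measurable (marchaudKernel s) := by unfold marchaudKernel; fun_prop
      exact (by fun_prop : Measurable fun ρ => marchaudKernel s ρ * h (ε * ρ)).aestronglyMeasurable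
    · filter_upwards [self_mem_nhdsWithin] with ε hε
      refine (ae_restrict_iff' measurableSet_Ioi).2 (Eventually.of_forall fun ρ hρ => ?_)
      have hρ0 : 0 < ρ := hρ
      have hε0 : 0 < ε := hε
      rw [norm_mul, Real.norm_of_nonneg (marchaudKernel_pos hs hρ).le, Real.norm_eq_abs]
      refine mul_le_mul_of_nonneg_left ((hK _ (by positivity)).trans ?_)
        (marchaudKernel_pos hs hρ).le
      refine mul_le_of_le_one_right hK0 (Real.exp_le_one_iff.2 ?_)
      have : 0 ≤ δ * (ε * ρ) := by positivity
      linarith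
    · refine (ae_restrict_iff' measurableSet_Ioi).2 (Eventually.of_forall fun ρ hρ => ?_)
      refine (h0.comp ?_).const_mul _
      refine tendsto_nhdsWithin_iff.2 ⟨?_, ?_⟩
      · have : Tendsto (fun ε : ℝ => ε * ρ) (𝓝 0) (𝓝 (0 * ρ)) := tendsto_id.mul_const ρ
        rw [zero_mul] at this
        exact this.mono_left nhdsWithin_le_nhds
      · filter_upwards [self_mem_nhdsWithin] with ε hε
        have hρ0 : 0 < ρ := hρ
        have hε0 : 0 < ε := hε
        exact mul_pos hε0 hρ0
  rw [integral_mul_const] at hR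
  refine tendsto_nhds_unique hL (hR.congr' ?_)
  filter_upwards [self_mem_nhdsWithin] with ε hε
  have hε0 : 0 < ε := hε
  obtain ⟨i1, i2, e⟩ := integral_truncated_marchaud hs hδ hm hK hε0
  have hset : {x : ℝ | ε < id x} = Set.Ioi ε := rfl
  rw [hset, Measure.restrict_restrict measurableSet_Ioi,
    Set.inter_eq_left.2 (Set.Ioi_subset_Ioi hε0.le)]
  have hc : IntegrableOn (fun t : ℝ => t ^ (-1 - s) * U₀) (Set.Ioi ε) :=
    (integrableOn_Ioi_rpow_of_lt (by linarith) hε0).mul_const _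
  simp_rw [mul_sub]
  rw [integral_sub hc i2, e, integral_mul_const, integral_Ioi_rpow_of_lt (by linarith) hε0]
  -- undo the dilation `y = ε ρ`, so that both sides are integrals over `y`
  have hcomp := integral_comp_mul_left_Ioi (fun y => marchaudKernel s (y / ε) * h y) 0 hε0
  rw [mul_zero] at hcomp
  have e1 : ∫ ρ in Set.Ioi 0, marchaudKernel s ρ * h (ε * ρ) =
      ∫ ρ in Set.Ioi 0, marchaudKernel s (ε * ρ / ε) * h (ε * ρ) := by
    simp_rw [mul_div_cancel_left₀ _ hε0.ne']
  rw [e1, hcomp, smul_eq_mul, ← integral_const_mul]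
  have e2 : ∀ y ∈ Set.Ioi (0:ℝ), ε⁻¹ * (marchaudKernel s (y / ε) * h y) =
      (ε ^ (-s) / s) * (y ^ (s - 1) * h y) -
      (Set.Ioi ε).indicator (fun y => h y * (((y - ε) / ε) ^ s / (s * y))) y := by
    intro y hy
    have hy0 : 0 < y := hy
    have e3 : y / ε - 1 = (y - ε) / ε := by field_simp
    have e4 : y ^ (s - 1) = y ^ s / y := by rw [Real.rpow_sub hy0, Real.rpow_one]
    unfold marchaudKernel
    rw [Real.div_rpow hy0.le hε0.le, Real.rpow_neg hε0.le, e3, e4]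
    by_cases hye : y ∈ Set.Ioi ε
    · have : 0 < y - ε := sub_pos.2 hye
      rw [Set.indicator_of_mem hye, max_eq_left (by positivity)]
      field_simp
    · have : y - ε ≤ 0 := sub_nonpos.2 (not_lt.1 hye)
      rw [Set.indicator_of_notMem hye, max_eq_right (div_nonpos_of_nonpos_of_nonneg this hε0.le),
        Real.zero_rpow hs.ne']
      field_simp
      ring
  rw [setIntegral_congr_fun measurableSet_Ioi e2, integral_sub
    ((integrableOn_rpow_mul_of_exp_bound hs hδ hm hK).const_mul _)
    (by rw [← IntegrableOn, integrableOn_indicator_iff measurableSet_Ioi]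
        exact i1.mono_set Set.inter_subset_left),
    setIntegral_indicator measurableSet_Ioi, integral_const_mul,
    Set.inter_eq_right.2 (Set.Ioi_subset_Ioi hε0.le), ← hU₀]
  congr 1
  rw [show -1 - s + 1 = -s by ring]
  field_simp

end Inversion

/-! ### The fractional Laplacian through the heat semigroup -/

/-- An integrability criterion against the Lévy measure `t^{-1-s} dt` of subordination. -/
lemma integrableOn_levy {s p A B : ℝ} (hs : 0 < s) (hp : s < p) {φ : ℝ → ℝ} (hm : Measurable φ)
    (h1 : ∀ t, 0 < t → t ≤ 1 → |φ t| ≤ A * t ^ p) (h2 : ∀ t, 1 < t → |φ t| ≤ B) :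
    IntegrableOn (fun t => t ^ (-1 - s) * φ t) (Set.Ioi 0) := by
  have hmm : Measurable fun t : ℝ => t ^ (-1 - s) * φ t := by fun_prop
  rw [← Set.Ioc_union_Ioi_eq_Ioi zero_le_one, integrableOn_union]
  constructor
  · have h : IntegrableOn (fun t : ℝ => t ^ (-1 - s + p) * A) (Set.Ioc 0 1) :=
      ((intervalIntegral.intervalIntegrable_rpow' (by linarith)).1).mul_const _
    refine h.mono' hmm.aestronglyMeasurable ?_
    refine (ae_restrict_iff' measurableSet_Ioc).2 (Eventually.of_forall fun t ht => ?_)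
    have ht0 : 0 < t := ht.1
    rw [norm_mul, Real.norm_of_nonneg (by positivity), Real.norm_eq_abs, Real.rpow_add ht0]
    calc _ ≤ t ^ (-1 - s) * (A * t ^ p) := by gcongr; exact h1 t ht0 ht.2
      _ = _ := by ring
  · have h : IntegrableOn (fun t : ℝ => t ^ (-1 - s) * B) (Set.Ioi 1) :=
      (integrableOn_Ioi_rpow_of_lt (by linarith) one_pos).mul_const _
    refine h.mono' hmm.aestronglyMeasurable ?_
    refine (ae_restrict_iff' measurableSet_Ioi).2 (Eventually.of_forall fun t ht => ?_)
    have ht0 : 0 < t := one_pos.trans ht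
    rw [norm_mul, Real.norm_of_nonneg (by positivity), Real.norm_eq_abs]
    gcongr
    exact h2 t ht

section Generator

set_option linter.unusedSectionVars false

variable {V : Type*} [NormedAddCommGroup V] [InnerProductSpace ℝ V] [FiniteDimensional ℝ V]
  [MeasurableSpace V] [BorelSpace V]

/-- The symmetric second difference `2 u (x) - u (x + z) - u (x - z)`. -/
def secondDiff (u : V → ℝ) (x z : V) : ℝ := 2 * u x - u (x + z) - u (x - z)

/-- The integral `∫_0^∞ t^{-1-s} (u (x) - e^{-δ t} P_t u (x)) dt`, a multiple of
`(δ - Δ)^s u (x)`. -/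
noncomputable def fracGen (s δ : ℝ) (u : V → ℝ) (x : V) : ℝ :=
  ∫ t in Set.Ioi 0, t ^ (-1 - s) * (u x - Real.exp (-(δ * t)) * heat t u x)

variable {s δ σ K A : ℝ} {u : V → ℝ} {x : V}

lemma continuous_secondDiff (hu : Continuous u) (x : V) : Continuous (secondDiff u x) := by
  unfold secondDiff; fun_prop

lemma abs_secondDiff_le (hK : ∀ z, |u z| ≤ K) (x z : V) : |secondDiff u x z| ≤ 4 * K := by
  unfold secondDiff
  have h1 := abs_le.1 (hK x)
  have h2 := abs_le.1 (hK (x + z))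
  have h3 := abs_le.1 (hK (x - z))
  exact abs_le.2 ⟨by linarith, by linarith⟩

/-- Since the heat kernel is even, `u - P_t u` is an average of second differences. -/
lemma sub_heat_eq {t : ℝ} (ht : 0 < t) (hu : Continuous u) (hK : ∀ z, |u z| ≤ K) (x : V) :
    u x - heat t u x = 1 / 2 * ∫ z, heatKernel t z * secondDiff u x z := by
  have i1 := integrable_heatKernel_smul (φ := fun z => u (x - z)) ht (by fun_prop) fun z => hK _
  have i2 := integrable_heatKernel_smul (φ := fun z => u (x + z)) ht (by fun_prop) fun z => hK _
  have i3 := (integrable_heatKernel (V := V) ht).mul_const (2 * u x)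
  simp only [smul_eq_mul] at i1 i2
  have e1 : heat t u x = ∫ z, heatKernel t z * u (x + z) := by
    unfold heat
    rw [← integral_neg_eq_self]
    simp [heatKernel_neg]
  have e2 : ∀ z, heatKernel t z * secondDiff u x z =
      heatKernel t z * (2 * u x) - heatKernel t z * u (x + z) - heatKernel t z * u (x - z) := by
    intro z; unfold secondDiff; ring
  simp_rw [e2]
  have i32 : Integrable fun z => heatKernel t z * (2 * u x) - heatKernel t z * u (x + z) :=
    i3.sub i2
  rw [integral_sub i32 i1, integral_sub i3 i2, integral_mul_const, integral_heatKernel ht,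
    ← e1]
  have e3 : heat t u x = ∫ z, heatKernel t z * u (x - z) := rfl
  rw [← e3]
  ring

lemma abs_sub_heat_le {t : ℝ} (ht : 0 < t) (hσ : 0 ≤ σ) (hσ2 : σ ≤ 2) (hu : Continuous u)
    (hK : ∀ z, |u z| ≤ K) (hA0 : 0 ≤ A) (hA : ∀ z, |secondDiff u x z| ≤ A * ‖z‖ ^ σ) :
    |u x - heat t u x| ≤ heatConst V * A * t ^ (σ / 2) := by
  rw [sub_heat_eq ht hu hK, abs_mul]
  have := norm_integral_heatKernel_smul_le ht hσ hσ2 hA0 (φ := secondDiff u x) hA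
  simp only [smul_eq_mul, Real.norm_eq_abs] at this
  have h2 : 0 ≤ heatConst V * t ^ (σ / 2) * A := (abs_nonneg _).trans this
  have : |(1:ℝ) / 2| = 1 / 2 := by norm_num
  rw [this]
  linarith

lemma abs_heat_le {t : ℝ} (ht : 0 < t) (hK : ∀ z, |u z| ≤ K) (x : V) : |heat t u x| ≤ K :=
  norm_heat_le (F := ℝ) ht hK x

lemma one_sub_exp_le {y : ℝ} : 1 - Real.exp (-y) ≤ y := by
  linarith [Real.add_one_le_exp (-y)]

lemma integrableOn_fracGen (hs : 0 < s) (hs1 : s < 1) (hδ : 0 ≤ δ) (hσ : 2 * s < σ) (hσ2 : σ ≤ 2)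
    (hu : Continuous u) (hK : ∀ z, |u z| ≤ K) (hA0 : 0 ≤ A)
    (hA : ∀ z, |secondDiff u x z| ≤ A * ‖z‖ ^ σ) :
    IntegrableOn (fun t => t ^ (-1 - s) * (u x - Real.exp (-(δ * t)) * heat t u x))
      (Set.Ioi 0) := by
  have hm : Measurable fun t => heat t u x := (stronglyMeasurable_heat_left hu x).measurable
  have hK0 : 0 ≤ K := (abs_nonneg _).trans (hK 0)
  refine integrableOn_levy (p := σ / 2) (A := heatConst V * A + δ * K) (B := 2 * K) hs
    (by linarith) (by fun_prop) (fun t ht ht1 => ?_) (fun t ht => ?_)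
  · have h1 := abs_sub_heat_le ht (by linarith) hσ2 hu hK hA0 hA
    have h2 := abs_heat_le ht hK x
    have h3 : 0 ≤ 1 - Real.exp (-(δ * t)) := by
      have : 0 ≤ δ * t := by positivity
      have := Real.exp_le_one_iff.2 (neg_nonpos.2 this)
      linarith
    have h4 : 1 - Real.exp (-(δ * t)) ≤ δ * t ^ (σ / 2) := by
      refine one_sub_exp_le.trans (mul_le_mul_of_nonneg_left ?_ hδ)
      simpa using Real.rpow_le_rpow_of_exponent_ge ht ht1 (by linarith : σ / 2 ≤ 1)
    have e : u x - Real.exp (-(δ * t)) * heat t u x =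
        (u x - heat t u x) + (1 - Real.exp (-(δ * t))) * heat t u x := by ring
    rw [e]
    refine (abs_add_le _ _).trans ?_
    rw [abs_mul, abs_of_nonneg h3]
    calc _ ≤ heatConst V * A * t ^ (σ / 2) + δ * t ^ (σ / 2) * K := by gcongr
      _ = _ := by ring
  · have ht0 : 0 < t := by linarith
    have h2 := abs_heat_le ht0 hK x
    have h3 : Real.exp (-(δ * t)) ≤ 1 :=
      Real.exp_le_one_iff.2 (neg_nonpos.2 (by positivity))
    calc _ ≤ |u x| + |Real.exp (-(δ * t)) * heat t u x| := abs_sub _ _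
      _ ≤ K + 1 * K := by
          rw [abs_mul, abs_of_pos (Real.exp_pos _)]
          gcongr
          exact hK x
      _ = _ := by ring

/-- The constant in `∫_0^∞ t^{-1-s} G_t (z) dt = C |z|^{-d-2s}`. -/
noncomputable def subordConst (V : Type*) [NormedAddCommGroup V] [InnerProductSpace ℝ V] (s : ℝ) :
    ℝ :=
  (4 * Real.pi) ^ (-((Module.finrank ℝ V : ℝ) / 2)) *
    4 ^ (s + (Module.finrank ℝ V : ℝ) / 2) * Real.Gamma (s + (Module.finrank ℝ V : ℝ) / 2)

lemma subordConst_pos (hs : 0 < s) : 0 < subordConst V s := by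
  have : 0 < Real.Gamma (s + (Module.finrank ℝ V : ℝ) / 2) := Real.Gamma_pos_of_pos (by positivity)
  unfold subordConst
  positivity

/-- Subordination: the kernel of `(-Δ)^s` is a superposition of heat kernels. -/
lemma integral_levy_heatKernel (hs : 0 < s) {z : V} (hz : z ≠ 0) :
    ∫ t in Set.Ioi 0, t ^ (-1 - s) * heatKernel t z =
      subordConst V s / ‖z‖ ^ ((Module.finrank ℝ V : ℝ) + 2 * s) := by
  set d : ℝ := (Module.finrank ℝ V : ℝ) with hd
  have hd0 : 0 ≤ d := by positivity
  have hz0 : 0 < ‖z‖ := norm_pos_iff.2 hz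
  rw [← integral_comp_rpow_Ioi (fun t => t ^ (-1 - s) * heatKernel t z) (p := -1) (by norm_num)]
  have e : ∀ t ∈ Set.Ioi (0:ℝ), (|(-1:ℝ)| * t ^ ((-1:ℝ) - 1)) •
      ((t ^ (-1:ℝ)) ^ (-1 - s) * heatKernel (t ^ (-1:ℝ)) z) = (4 * Real.pi) ^ (-(d / 2)) *
        (t ^ ((s + d / 2) - 1) * Real.exp (-(‖z‖ ^ 2 / 4 * t))) := by
    intro t ht
    have ht0 : 0 < t := ht
    unfold heatKernel
    rw [← hd, ← Real.rpow_mul ht0.le, Real.mul_rpow (by positivity) (by positivity),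
      ← Real.rpow_mul ht0.le]
    have e1 : t ^ ((s + d / 2) - 1) =
        t ^ ((-1:ℝ) - 1) * t ^ (-1 * (-1 - s)) * t ^ (-1 * -(d / 2)) := by
      rw [← Real.rpow_add ht0, ← Real.rpow_add ht0]; congr 1; ring
    rw [e1, Real.rpow_neg_one]
    have e2 : -(1 / (4 * t⁻¹)) * ‖z‖ ^ 2 = -(‖z‖ ^ 2 / 4 * t) := by field_simp
    rw [e2]
    simp only [abs_neg, abs_one, one_mul, smul_eq_mul]
    ring
  rw [setIntegral_congr_fun measurableSet_Ioi e, integral_const_mul,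
    Real.integral_rpow_mul_exp_neg_mul_Ioi (by positivity) (by positivity)]
  have e3 : (1 / (‖z‖ ^ 2 / 4)) ^ (s + d / 2) = 4 ^ (s + d / 2) / ‖z‖ ^ (d + 2 * s) := by
    rw [one_div_div, Real.div_rpow (by positivity) (by positivity), ← Real.rpow_natCast ‖z‖ 2,
      ← Real.rpow_mul hz0.le]
    congr 2; push_cast; ring
  rw [e3]
  unfold subordConst
  rw [← hd]
  ring

/-- The integral `∫ D(z) |z|^{-d-2s} dz` of the second difference is obtained from the heat
semigroup by writing `|z|^{-d-2s}` as a superposition of heat kernels. -/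
lemma integral_secondDiff_eq (hs : 0 < s) (hs1 : s < 1) (hσ : 2 * s < σ) (hσ2 : σ ≤ 2)
    (hu : Continuous u) (hK : ∀ z, |u z| ≤ K) (hA0 : 0 ≤ A)
    (hA : ∀ z, |secondDiff u x z| ≤ A * ‖z‖ ^ σ) :
    Integrable (fun z => secondDiff u x z / ‖z‖ ^ ((Module.finrank ℝ V : ℝ) + 2 * s)) ∧
    ∫ z, secondDiff u x z / ‖z‖ ^ ((Module.finrank ℝ V : ℝ) + 2 * s) =
      2 / subordConst V s * fracGen s 0 u x := by
  have hC := subordConst_pos (V := V) hs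
  have hDc := continuous_secondDiff hu x
  set f : ℝ → V → ℝ := fun t z => t ^ (-1 - s) * (heatKernel t z * secondDiff u x z) with hf
  have hfm : Measurable (Function.uncurry f) := by
    have h1 := measurable_heatKernel (V := V)
    have h2 : Measurable fun p : ℝ × V => secondDiff u x p.2 := hDc.measurable.comp measurable_snd
    exact (measurable_fst.pow_const _).mul (h1.mul h2)
  have hit : ∀ t ∈ Set.Ioi (0:ℝ), Integrable (f t) := fun t ht =>
    (integrable_heatKernel_smul ht hDc (fun z => abs_secondDiff_le hK x z)).const_mul _
  have hval : ∀ t ∈ Set.Ioi (0:ℝ), ∫ z, f t z = 2 * (t ^ (-1 - s) * (u x - heat t u x)) := by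
    intro t ht
    rw [sub_heat_eq ht hu hK, hf]
    simp only
    rw [integral_const_mul]; ring
  have hnorm : IntegrableOn (fun t => t ^ (-1 - s) * ∫ z, heatKernel t z * |secondDiff u x z|)
      (Set.Ioi 0) := by
    have hK0 : 0 ≤ K := (abs_nonneg _).trans (hK 0)
    refine integrableOn_levy (p := σ / 2) (A := heatConst V * A) (B := 4 * K) hs (by linarith) ?_
      (fun t ht ht1 => ?_) (fun t ht => ?_)
    · refine (StronglyMeasurable.integral_prod_right
        (f := fun (t : ℝ) (z : V) => heatKernel t z * |secondDiff u x z|) ?_).measurable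
      have h2 : Measurable fun p : ℝ × V => |secondDiff u x p.2| :=
        (hDc.abs).measurable.comp measurable_snd
      exact (measurable_heatKernel.mul h2).stronglyMeasurable
    · have := norm_integral_heatKernel_smul_le (V := V) ht (by linarith : 0 ≤ σ) hσ2 hA0
        (φ := fun z => |secondDiff u x z|) (fun z => by simpa using hA z)
      refine this.trans_eq (by ring)
    · exact norm_integral_heatKernel_smul_le_of_bound (V := V) (by linarith : 0 < t)
        (φ := fun z => |secondDiff u x z|) (fun z => by simpa using abs_secondDiff_le hK x z)
  have hprod : Integrable (Function.uncurry f) ((volume.restrict (Set.Ioi 0)).prod volume) := by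
    rw [integrable_prod_iff hfm.aestronglyMeasurable]
    refine ⟨(ae_restrict_iff' measurableSet_Ioi).2 (Eventually.of_forall hit), ?_⟩
    refine IntegrableOn.congr_fun hnorm (fun t ht => ?_) measurableSet_Ioi
    have ht0 : 0 < t := ht
    simp only [Function.uncurry, hf]
    rw [← integral_const_mul]
    congr 1; ext z
    rw [norm_mul, norm_mul, Real.norm_of_nonneg (by positivity : 0 ≤ t ^ (-1 - s)),
      Real.norm_of_nonneg (heatKernel_pos ht z).le, Real.norm_eq_abs]
  have hz : ∀ z, ∫ t in Set.Ioi 0, f t z =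
      subordConst V s * (secondDiff u x z / ‖z‖ ^ ((Module.finrank ℝ V : ℝ) + 2 * s)) := by
    intro z
    rcases eq_or_ne z 0 with rfl | hz
    · have : secondDiff u x 0 = 0 := by unfold secondDiff; simp; ring
      simp [hf, this]
    · simp only [hf]
      simp_rw [← mul_assoc]
      rw [integral_mul_const, integral_levy_heatKernel hs hz]
      ring
  have h1 := hprod.integral_prod_right
  simp only [Function.uncurry] at h1
  simp_rw [hz] at h1
  have h2 := integral_integral_swap hprod
  simp_rw [hz] at h2
  rw [integral_const_mul, setIntegral_congr_fun measurableSet_Ioi hval, integral_const_mul] at h2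
  have h3 : fracGen s 0 u x = ∫ t in Set.Ioi 0, t ^ (-1 - s) * (u x - heat t u x) := by
    unfold fracGen; simp
  rw [← h3] at h2
  refine ⟨?_, ?_⟩
  · refine (h1.const_mul (subordConst V s)⁻¹).congr (Eventually.of_forall fun z => ?_)
    simp only
    rw [inv_mul_cancel_left₀ hC.ne']
  · field_simp
    linarith

lemma integrableOn_div_norm_rpow (hs : 0 < s) {ε : ℝ} (hε : 0 < ε) {φ : V → ℝ}
    (hφ : Continuous φ) (hK : ∀ z, |φ z| ≤ K) :
    IntegrableOn (fun z => φ z / ‖z‖ ^ ((Module.finrank ℝ V : ℝ) + 2 * s)) {z | ε < ‖z‖} := by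
  set p : ℝ := (Module.finrank ℝ V : ℝ) + 2 * s with hp
  have hp0 : 0 < p := by positivity
  have hK0 : 0 ≤ K := (abs_nonneg _).trans (hK 0)
  have h1 : Integrable fun z : V => K * ((1 + 1 / ε) ^ p * (1 + ‖z‖) ^ (-p)) :=
    ((integrable_one_add_norm (by linarith)).const_mul _).const_mul _
  have hms : MeasurableSet {z : V | ε < ‖z‖} := measurableSet_lt measurable_const measurable_norm
  refine h1.integrableOn.mono' ?_ ((ae_restrict_iff' hms).2 (Eventually.of_forall fun z hz => ?_))
  · have := hφ.measurable
    exact (by fun_prop : Measurable fun z : V => φ z / ‖z‖ ^ p).aestronglyMeasurable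
  · have hz' : ε < ‖z‖ := hz
    have hz0 : 0 < ‖z‖ := hε.trans hz'
    rw [norm_div, Real.norm_eq_abs, Real.norm_of_nonneg (by positivity), div_eq_mul_inv]
    have h2 : (‖z‖ ^ p)⁻¹ ≤ (1 + 1 / ε) ^ p * (1 + ‖z‖) ^ (-p) := by
      rw [Real.rpow_neg (by positivity), ← div_eq_mul_inv, le_div_iff₀ (by positivity),
        ← div_eq_inv_mul, div_le_iff₀ (by positivity), ← Real.mul_rpow (by positivity) hz0.le]
      refine Real.rpow_le_rpow (by positivity) ?_ hp0.le
      have : 1 ≤ ‖z‖ / ε := (one_le_div hε).2 hz'.le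
      calc 1 + ‖z‖ ≤ ‖z‖ / ε + ‖z‖ := by linarith
        _ = _ := by ring
    gcongr
    exact hK z

/-- Symmetrization of the truncated singular integral. -/
lemma integral_truncated_eq_secondDiff (hs : 0 < s) {ε : ℝ} (hε : 0 < ε) (hu : Continuous u)
    (hK : ∀ z, |u z| ≤ K) (x : V) :
    ∫ z in {z | ε < ‖z‖}, (u x - u (x - z)) / ‖z‖ ^ ((Module.finrank ℝ V : ℝ) + 2 * s) =
      1 / 2 * ∫ z in {z | ε < ‖z‖}, secondDiff u x z /
        ‖z‖ ^ ((Module.finrank ℝ V : ℝ) + 2 * s) := by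
  set p : ℝ := (Module.finrank ℝ V : ℝ) + 2 * s with hp
  have hms : MeasurableSet {z : V | ε < ‖z‖} := measurableSet_lt measurable_const measurable_norm
  have hb : ∀ z w : V, |u z - u w| ≤ 2 * K := fun z w => by
    have h1 := abs_le.1 (hK z)
    have h2 := abs_le.1 (hK w)
    exact abs_le.2 ⟨by linarith, by linarith⟩
  have i1 := integrableOn_div_norm_rpow (V := V) hs hε (φ := fun z => u x - u (x - z))
    (by fun_prop) (fun z => hb _ _)
  have i2 := integrableOn_div_norm_rpow (V := V) hs hε (φ := fun z => u x - u (x + z))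
    (by fun_prop) (fun z => hb _ _)
  rw [← hp] at i1 i2
  have e1 : ∫ z in {z | ε < ‖z‖}, (u x - u (x - z)) / ‖z‖ ^ p =
      ∫ z in {z | ε < ‖z‖}, (u x - u (x + z)) / ‖z‖ ^ p := by
    rw [← integral_indicator hms, ← integral_neg_eq_self, ← integral_indicator hms]
    congr 1; ext z
    simp [Set.indicator]
  have e2 : ∀ z, secondDiff u x z / ‖z‖ ^ p =
      (u x - u (x - z)) / ‖z‖ ^ p + (u x - u (x + z)) / ‖z‖ ^ p := fun z => by
    unfold secondDiff; ring
  simp_rw [e2]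
  rw [integral_add i1 i2, ← e1]
  ring

end Generator

section Euclidean

variable {n : ℕ}

/-- The constant `κ` with `(-Δ)^s u = κ ∫_0^∞ t^{-1-s} (u - P_t u) dt`. -/
noncomputable def levyConst (n : ℕ) (s : ℝ) : ℝ :=
  fracLapConst n s / subordConst (EuclideanSpace ℝ (Fin n)) s

lemma levyConst_pos {s : ℝ} (hs : 0 < s) (hs1 : s < 1) : 0 < levyConst n s := by
  unfold levyConst fracLapConst
  have h1 : 0 < Real.Gamma ((n : ℝ) / 2 + s) := Real.Gamma_pos_of_pos (by positivity)
  have h2 : 0 < Real.Gamma (1 - s) := Real.Gamma_pos_of_pos (by linarith)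
  have h3 := subordConst_pos (V := EuclideanSpace ℝ (Fin n)) hs
  positivity

/-- For functions with a sufficiently small second difference at `x`, the principal value exists
and is given by the heat semigroup. -/
lemma hasFracLaplacianAt_fracGen {s σ K A : ℝ} (hs : 0 < s) (hs1 : s < 1) (hσ : 2 * s < σ)
    (hσ2 : σ ≤ 2) {u : EuclideanSpace ℝ (Fin n) → ℝ} {x : EuclideanSpace ℝ (Fin n)}
    (hu : Continuous u) (hK : ∀ z, |u z| ≤ K) (hA0 : 0 ≤ A)
    (hA : ∀ z, |secondDiff u x z| ≤ A * ‖z‖ ^ σ) :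
    HasFracLaplacianAt s u x (levyConst n s * fracGen s 0 u x) := by
  have hb : ∀ z w, |u z - u w| ≤ 2 * K := fun z w => by
    have h1 := abs_le.1 (hK z)
    have h2 := abs_le.1 (hK w)
    exact abs_le.2 ⟨by linarith, by linarith⟩
  set φ : EuclideanSpace ℝ (Fin n) → ℝ := fun z => (u x - u (x - z)) / ‖z‖ ^ ((n : ℝ) + 2 * s)
    with hφ
  have hφy : fracLapIntegrand s u x = fun y => φ (x - y) := by
    ext y; simp [fracLapIntegrand, hφ]
  have hms : ∀ ε : ℝ, MeasurableSet {z : EuclideanSpace ℝ (Fin n) | ε < ‖z‖} := fun ε =>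
    measurableSet_lt measurable_const measurable_norm
  have hms' : ∀ ε : ℝ, MeasurableSet {y : EuclideanSpace ℝ (Fin n) | ε < ‖x - y‖} := fun ε =>
    measurableSet_lt measurable_const (by fun_prop)
  have hind : ∀ ε : ℝ, {y | ε < ‖x - y‖}.indicator (fun y => φ (x - y)) =
      fun y => ({z | ε < ‖z‖}.indicator φ) (x - y) := fun ε => by
    ext y; simp [Set.indicator]
  refine ⟨fun ε hε => ?_, ?_⟩
  · rw [hφy, ← integrable_indicator_iff (hms' ε), hind]
    refine Integrable.comp_sub_left ?_ x
    rw [integrable_indicator_iff (hms ε)]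
    have := integrableOn_div_norm_rpow (V := EuclideanSpace ℝ (Fin n)) hs hε
      (φ := fun z => u x - u (x - z)) (by fun_prop) (fun z => hb _ _)
    simpa using this
  · obtain ⟨hi, he⟩ := integral_secondDiff_eq hs hs1 hσ hσ2 hu hK hA0 hA
    rw [finrank_euclideanSpace_fin] at hi he
    have ht := tendsto_setIntegral_lt hi (q := fun z => ‖z‖) measurable_norm
      (Eventually.of_forall fun z => by
        rcases eq_or_ne z 0 with rfl | hz
        · right
          have : secondDiff u x 0 = 0 := by unfold secondDiff; simp; ring
          simp [this]
        · exact Or.inl (norm_pos_iff.2 hz))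
    rw [he] at ht
    have ht2 := ht.const_mul (fracLapConst n s * (1 / 2))
    have e : fracLapConst n s * (1 / 2) * (2 / subordConst (EuclideanSpace ℝ (Fin n)) s *
        fracGen s 0 u x) = levyConst n s * fracGen s 0 u x := by unfold levyConst; ring
    rw [e] at ht2
    refine ht2.congr' ?_
    filter_upwards [self_mem_nhdsWithin] with ε hε
    rw [hφy, ← integral_indicator (hms' ε), hind, integral_sub_left_eq_self
      ({z | ε < ‖z‖}.indicator φ) volume x, integral_indicator (hms ε)]
    have := integral_truncated_eq_secondDiff hs hε hu hK x
    rw [finrank_euclideanSpace_fin] at this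
    rw [this]
    ring

end Euclidean

section Inverse

set_option linter.unusedSectionVars false

variable {V : Type*} [NormedAddCommGroup V] [InnerProductSpace ℝ V] [FiniteDimensional ℝ V]
  [MeasurableSpace V] [BorelSpace V]

variable {s δ σ K A H α : ℝ} {u g : V → ℝ} {x : V}

/-! ### The Bessel potential solves `(δ - Δ)^s u = g` -/

/-- On Bessel potentials the heat semigroup shifts the time variable. -/
lemma heat_besselPot (hs : 0 < s) (hδ : 0 < δ) (hg : Continuous g) (hK : ∀ z, |g z| ≤ K)
    {t : ℝ} (ht : 0 < t) (x : V) :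
    heat t (besselPot s δ g) x = ∫ r in Set.Ioi 0, besselWeight s δ r * heat (r + t) g x := by
  have hint : Integrable (Function.uncurry fun (z : V) (r : ℝ) =>
      heatKernel t z * (besselWeight s δ r * heat r g (x - z)))
      (volume.prod (volume.restrict (Set.Ioi 0))) := by
    have h1 : Integrable (fun p : V × ℝ => heatKernel t p.1 * (besselWeight s δ p.2 * K))
        (volume.prod (volume.restrict (Set.Ioi 0))) :=
      (integrable_heatKernel ht).mul_prod ((integrableOn_besselWeight hs hδ).mul_const K)
    refine h1.mono' ?_ ?_
    · have h2 : StronglyMeasurable fun p : V × ℝ => heat p.2 g (x - p.1) :=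
        (stronglyMeasurable_heat (f := fun p : ℝ × V => g p.2)
          (hg.comp continuous_snd).stronglyMeasurable).comp_measurable
          (g := fun p : V × ℝ => (p.2, x - p.1)) (by fun_prop)
      have h3 := (continuous_heatKernel (V := V) t).measurable
      have h4 := measurable_besselWeight s δ
      have h5 := h2.measurable
      exact Measurable.aestronglyMeasurable ((h3.comp measurable_fst).mul
        ((h4.comp measurable_snd).mul h5))
    · have : ∀ᵐ p : V × ℝ ∂(volume.prod (volume.restrict (Set.Ioi 0))), p.2 ∈ Set.Ioi (0:ℝ) :=
        Measure.quasiMeasurePreserving_snd.ae (ae_restrict_mem measurableSet_Ioi)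
      filter_upwards [this] with p hp
      simp only [Function.uncurry]
      rw [norm_mul, norm_mul, Real.norm_of_nonneg (heatKernel_pos ht _).le,
        Real.norm_of_nonneg (besselWeight_pos s δ hp).le]
      exact mul_le_mul_of_nonneg_left (mul_le_mul_of_nonneg_left (abs_heat_le hp hK _)
        (besselWeight_pos s δ hp).le) (heatKernel_pos ht _).le
  have e1 : heat t (besselPot s δ g) x = ∫ z, ∫ r in Set.Ioi 0,
      heatKernel t z * (besselWeight s δ r * heat r g (x - z)) := by
    simp_rw [integral_const_mul]
    rfl
  rw [e1, integral_integral_swap hint]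
  refine setIntegral_congr_fun measurableSet_Ioi fun r hr => ?_
  have hr0 : 0 < r := hr
  rw [add_comm r t, ← heat_heat ht hr0 hg hK x]
  simp only [heat, smul_eq_mul]
  rw [← integral_const_mul]
  congr 1; ext z
  ring

lemma tendsto_heat_zero (hα : 0 < α) (hα1 : α ≤ 1) (hH : 0 ≤ H) (hg : Continuous g)
    (hK : ∀ z, |g z| ≤ K) (hgH : ∀ x y, |g x - g y| ≤ H * ‖x - y‖ ^ α) (x : V) :
    Tendsto (fun r => heat r g x) (𝓝[>] 0) (𝓝 (g x)) := by
  rw [tendsto_iff_norm_sub_tendsto_zero]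
  have h1 : Tendsto (fun r : ℝ => heatConst V * r ^ (α / 2) * H) (𝓝[>] 0) (𝓝 0) := by
    have h2 : Tendsto (fun r : ℝ => r ^ (α / 2)) (𝓝 0) (𝓝 (0 ^ (α / 2))) :=
      (Real.continuous_rpow_const (by positivity)).tendsto 0
    rw [Real.zero_rpow (by positivity)] at h2
    have h3 : Tendsto (fun r : ℝ => r ^ (α / 2)) (𝓝[>] 0) (𝓝 0) :=
      h2.mono_left nhdsWithin_le_nhds
    simpa using (h3.const_mul (heatConst V)).mul_const H
  refine squeeze_zero' (Eventually.of_forall fun _ => norm_nonneg _) ?_ h1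
  filter_upwards [self_mem_nhdsWithin] with r hr
  rw [heat_sub_self hr hg hK]
  refine norm_integral_heatKernel_smul_le hr hα.le (by linarith) hH fun z => ?_
  simpa using hgH (x - z) x

/-- Along the orbit `h r = e^{-δ r} P_r g (x)`, the potential is the fractional integral of order
`s` of `h`, and `fracGen` is its Marchaud derivative. -/
lemma fracGen_besselPot (hs : 1 / 2 < s) (hs1 : s < 1) (hδ : 0 < δ) (hα : 0 < α) (hα1 : α ≤ 1)
    (hH : 0 ≤ H) (hg : Continuous g) (hK : ∀ z, |g z| ≤ K)
    (hgH : ∀ x y, |g x - g y| ≤ H * ‖x - y‖ ^ α)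
    (hσ : 2 * s < σ) (hσ2 : σ ≤ 2) (hA0 : 0 ≤ A)
    (hA : ∀ z, |secondDiff (besselPot s δ g) x z| ≤ A * ‖z‖ ^ σ) :
    fracGen s δ (besselPot s δ g) x = marchaudConst s * g x := by
  have hs0 : 0 < s := by linarith
  have hu : Continuous (besselPot s δ g) := continuous_iff_continuousAt.2 fun x =>
    (hasFDerivAt_besselPot hs hδ hg hK x).continuousAt
  have hiu := integrableOn_fracGen (x := x) hs0 hs1 hδ.le hσ hσ2 hu
    (norm_besselPot_le (F := ℝ) hs0 hδ hK) hA0 hA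
  set h : ℝ → ℝ := fun r => Real.exp (-(δ * r)) * heat r g x with hh
  have hm : Measurable h := by
    have : Measurable fun t => heat t g x := (stronglyMeasurable_heat_left hg x).measurable
    fun_prop
  have hb : ∀ r, 0 < r → |h r| ≤ K * Real.exp (-(δ * r)) := fun r hr => by
    rw [hh]
    simp only
    rw [abs_mul, abs_of_pos (Real.exp_pos _), mul_comm]
    exact mul_le_mul_of_nonneg_right (abs_heat_le hr hK x) (Real.exp_pos _).le
  have h0 : Tendsto h (𝓝[>] 0) (𝓝 (g x)) := by
    have h1 : Tendsto (fun r : ℝ => Real.exp (-(δ * r))) (𝓝[>] 0) (𝓝 1) := by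
      have : Tendsto (fun r : ℝ => Real.exp (-(δ * r))) (𝓝 0) (𝓝 (Real.exp (-(δ * 0)))) :=
        (by fun_prop : Continuous fun r : ℝ => Real.exp (-(δ * r))).tendsto 0
      simp only [mul_zero, neg_zero, Real.exp_zero] at this
      exact this.mono_left nhdsWithin_le_nhds
    simpa using h1.mul (tendsto_heat_zero hα hα1 hH hg hK hgH x)
  have e0 : ∫ r in Set.Ioi 0, r ^ (s - 1) * h r = besselPot s δ g x := by
    unfold besselPot besselWeight
    simp only [hh, smul_eq_mul, mul_assoc]
  have et : ∀ t ∈ Set.Ioi (0:ℝ), ∫ r in Set.Ioi 0, r ^ (s - 1) * h (r + t) =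
      Real.exp (-(δ * t)) * heat t (besselPot s δ g) x := by
    intro t ht
    rw [heat_besselPot hs0 hδ hg hK ht, ← integral_const_mul]
    refine setIntegral_congr_fun measurableSet_Ioi fun r hr => ?_
    simp only [hh, besselWeight]
    rw [show -(δ * (r + t)) = -(δ * t) + -(δ * r) by ring, Real.exp_add]
    ring
  have ec : ∀ t ∈ Set.Ioi (0:ℝ), t ^ (-1 - s) *
      (besselPot s δ g x - Real.exp (-(δ * t)) * heat t (besselPot s δ g) x) =
      t ^ (-1 - s) * ((∫ r in Set.Ioi 0, r ^ (s - 1) * h r) -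
        ∫ r in Set.Ioi 0, r ^ (s - 1) * h (r + t)) := fun t ht => by rw [e0, et t ht]
  have := integral_marchaud hs0 hs1 hδ hm hb h0 (hiu.congr_fun ec measurableSet_Ioi)
  rw [← this]
  exact setIntegral_congr_fun measurableSet_Ioi ec

/-! ### The bounded part of the generator -/

/-- The mass `∫_0^∞ t^{-1-s} (1 - e^{-δ t}) dt`. -/
noncomputable def levyMass (s δ : ℝ) : ℝ :=
  ∫ t in Set.Ioi 0, t ^ (-1 - s) * (1 - Real.exp (-(δ * t)))

/-- The difference of `(δ - Δ)^s` and `(-Δ)^s`, up to a constant: the bounded positive operator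
`∫_0^∞ t^{-1-s} (1 - e^{-δ t}) P_t u dt`. -/
noncomputable def levyPot (s δ : ℝ) (u : V → ℝ) (x : V) : ℝ :=
  ∫ t in Set.Ioi 0, (t ^ (-1 - s) * (1 - Real.exp (-(δ * t)))) * heat t u x

lemma one_sub_exp_nonneg {t : ℝ} (hδ : 0 ≤ δ) (ht : 0 < t) : 0 ≤ 1 - Real.exp (-(δ * t)) := by
  have : 0 ≤ δ * t := by positivity
  have := Real.exp_le_one_iff.2 (neg_nonpos.2 this)
  linarith

lemma levyWeight_nonneg {t : ℝ} (hδ : 0 ≤ δ) (ht : 0 < t) :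
    0 ≤ t ^ (-1 - s) * (1 - Real.exp (-(δ * t))) :=
  mul_nonneg (by positivity) (one_sub_exp_nonneg hδ ht)

lemma integrableOn_levyMass (hs : 0 < s) (hs1 : s < 1) (hδ : 0 ≤ δ) :
    IntegrableOn (fun t => t ^ (-1 - s) * (1 - Real.exp (-(δ * t)))) (Set.Ioi 0) := by
  refine integrableOn_levy (p := 1) (A := δ) (B := 1) hs hs1 (by fun_prop) (fun t ht _ => ?_)
    (fun t ht => ?_)
  · rw [abs_of_nonneg (one_sub_exp_nonneg hδ ht), Real.rpow_one]
    exact one_sub_exp_le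
  · rw [abs_of_nonneg (one_sub_exp_nonneg hδ (by linarith))]
    linarith [Real.exp_pos (-(δ * t))]

lemma levyMass_nonneg (hδ : 0 ≤ δ) : 0 ≤ levyMass s δ :=
  setIntegral_nonneg measurableSet_Ioi fun _ ht => levyWeight_nonneg hδ ht

lemma integrableOn_levyPot (hs : 0 < s) (hs1 : s < 1) (hδ : 0 ≤ δ) (hu : Continuous u)
    (hK : ∀ z, |u z| ≤ K) (x : V) :
    IntegrableOn (fun t => (t ^ (-1 - s) * (1 - Real.exp (-(δ * t)))) * heat t u x)
      (Set.Ioi 0) :=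
  (integrableOn_levyMass hs hs1 hδ).mul_bdd (c := K)
    (stronglyMeasurable_heat_left hu x).aestronglyMeasurable
    ((ae_restrict_iff' measurableSet_Ioi).2 (Eventually.of_forall fun _ ht => abs_heat_le ht hK x))

lemma abs_integral_levyWeight_mul_le (hs : 0 < s) (hs1 : s < 1) (hδ : 0 ≤ δ) {φ : ℝ → ℝ}
    (hφ : ∀ t, 0 < t → |φ t| ≤ K) :
    |∫ t in Set.Ioi 0, (t ^ (-1 - s) * (1 - Real.exp (-(δ * t)))) * φ t| ≤ levyMass s δ * K := by
  rw [← Real.norm_eq_abs]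
  refine (norm_integral_le_of_norm_le ((integrableOn_levyMass hs hs1 hδ).mul_const K)
    ((ae_restrict_iff' measurableSet_Ioi).2 (Eventually.of_forall fun t ht => ?_))).trans_eq ?_
  · rw [norm_mul, Real.norm_of_nonneg (levyWeight_nonneg hδ ht)]
    exact mul_le_mul_of_nonneg_left (hφ t ht) (levyWeight_nonneg hδ ht)
  · rw [integral_mul_const]; rfl

lemma abs_levyPot_le (hs : 0 < s) (hs1 : s < 1) (hδ : 0 ≤ δ) (hK : ∀ z, |u z| ≤ K) (x : V) :
    |levyPot s δ u x| ≤ levyMass s δ * K :=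
  abs_integral_levyWeight_mul_le hs hs1 hδ fun _ ht => abs_heat_le ht hK x

lemma levyPot_sub {v : V → ℝ} {K' : ℝ} (hs : 0 < s) (hs1 : s < 1) (hδ : 0 ≤ δ) (hu : Continuous u)
    (hK : ∀ z, |u z| ≤ K) (hv : Continuous v) (hK' : ∀ z, |v z| ≤ K') (x : V) :
    levyPot s δ (fun y => u y - v y) x = levyPot s δ u x - levyPot s δ v x := by
  unfold levyPot
  rw [← integral_sub (integrableOn_levyPot hs hs1 hδ hu hK x)
    (integrableOn_levyPot hs hs1 hδ hv hK' x)]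
  refine setIntegral_congr_fun measurableSet_Ioi fun t ht => ?_
  rw [heat_sub ht hu hK hv hK', mul_sub]

lemma abs_levyPot_sub_le (hs : 0 < s) (hs1 : s < 1) (hδ : 0 ≤ δ) (hu : Continuous u)
    (hK : ∀ z, |u z| ≤ K) {x y : V} (hH : ∀ z, |u (x - z) - u (y - z)| ≤ H) :
    |levyPot s δ u x - levyPot s δ u y| ≤ levyMass s δ * H := by
  unfold levyPot
  rw [← integral_sub (integrableOn_levyPot hs hs1 hδ hu hK x)
    (integrableOn_levyPot hs hs1 hδ hu hK y)]
  simp_rw [← mul_sub]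
  refine abs_integral_levyWeight_mul_le hs hs1 hδ fun t ht => ?_
  rw [heat_sub_heat ht hu hK]
  exact norm_integral_heatKernel_smul_le_of_bound (F := ℝ) ht hH

lemma continuous_levyPot (hs : 0 < s) (hs1 : s < 1) (hδ : 0 ≤ δ) (hu : Continuous u)
    (hK : ∀ z, |u z| ≤ K) : Continuous (levyPot s δ u) := by
  refine continuous_of_dominated
    (F := fun x t => (t ^ (-1 - s) * (1 - Real.exp (-(δ * t)))) * heat t u x)
    (bound := fun t : ℝ => (t ^ (-1 - s) * (1 - Real.exp (-(δ * t)))) * K)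
    (fun x => (integrableOn_levyPot hs hs1 hδ hu hK x).aestronglyMeasurable) (fun x => ?_)
    ((integrableOn_levyMass hs hs1 hδ).mul_const K) ?_
  · refine (ae_restrict_iff' measurableSet_Ioi).2 (Eventually.of_forall fun t ht => ?_)
    rw [norm_mul, Real.norm_of_nonneg (levyWeight_nonneg hδ ht)]
    exact mul_le_mul_of_nonneg_left (abs_heat_le ht hK x) (levyWeight_nonneg hδ ht)
  · refine (ae_restrict_iff' measurableSet_Ioi).2 (Eventually.of_forall fun t ht => ?_)
    exact continuous_const.mul (continuous_heat (F := ℝ) ht hu hK)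

lemma fracGen_eq_add_levyPot (hs : 0 < s) (hs1 : s < 1) (hδ : 0 ≤ δ) (hσ : 2 * s < σ) (hσ2 : σ ≤ 2)
    (hu : Continuous u) (hK : ∀ z, |u z| ≤ K) (hA0 : 0 ≤ A)
    (hA : ∀ z, |secondDiff u x z| ≤ A * ‖z‖ ^ σ) :
    fracGen s δ u x = fracGen s 0 u x + levyPot s δ u x := by
  unfold fracGen levyPot
  rw [← integral_add (integrableOn_fracGen hs hs1 le_rfl hσ hσ2 hu hK hA0 hA)
    (integrableOn_levyPot hs hs1 hδ hu hK x)]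
  congr 1; ext t
  simp only [zero_mul, neg_zero, Real.exp_zero]
  ring

/-! ### The maximum principle -/

/-- Only bounds from above are needed, as the Gaussian is added to `u` at a maximum of the sum. -/
lemma secondDiff_gaussian_le (w z : V) :
    secondDiff (fun y => Real.exp (-‖y‖ ^ 2)) w z ≤ 2 * ‖z‖ ^ 2 ∧
    secondDiff (fun y => Real.exp (-‖y‖ ^ 2)) w z ≤ 2 := by
  simp only [secondDiff]
  have hw : Real.exp (-‖w‖ ^ 2) ≤ 1 := Real.exp_le_one_iff.2 (by
    have := sq_nonneg ‖w‖; linarith)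
  have h1 := Real.exp_pos (-‖w + z‖ ^ 2)
  have h2 := Real.exp_pos (-‖w - z‖ ^ 2)
  refine ⟨?_, by linarith⟩
  -- convexity of the exponential and the parallelogram law
  have e1 : -‖w + z‖ ^ 2 = -‖w‖ ^ 2 + (-‖z‖ ^ 2 - 2 * inner ℝ w z) := by
    rw [norm_add_sq_real]; ring
  have e2 : -‖w - z‖ ^ 2 = -‖w‖ ^ 2 + (-‖z‖ ^ 2 + 2 * inner ℝ w z) := by
    rw [norm_sub_sq_real]; ring
  rw [e1, e2, Real.exp_add, Real.exp_add]
  have h3 := Real.add_one_le_exp (-‖z‖ ^ 2 - 2 * inner ℝ w z)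
  have h4 := Real.add_one_le_exp (-‖z‖ ^ 2 + 2 * inner ℝ w z)
  have h5 := Real.exp_pos (-‖w‖ ^ 2)
  nlinarith [mul_le_mul_of_nonneg_left h3 h5.le, mul_le_mul_of_nonneg_left h4 h5.le, sq_nonneg ‖z‖]

/-- The gradient at a maximum point of `u` plus a small Gaussian. -/
lemma abs_fderiv_le_of_gaussian_max {ε : ℝ} (hε : 0 < ε) {x₀ x₁ : V} {L : V →L[ℝ] ℝ}
    (hu' : HasFDerivAt u L x₁)
    (hmax : ∀ y, u y + 2 * ε * Real.exp (-‖y - x₀‖ ^ 2) ≤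
      u x₁ + 2 * ε * Real.exp (-‖x₁ - x₀‖ ^ 2)) (b : V) : |L b| ≤ 4 * ε * ‖b‖ := by
  set w := x₁ - x₀ with hw
  have h0 : HasFDerivAt (fun y : V => ‖y‖ ^ 2) (2 • innerSL ℝ w) (x₁ - x₀) :=
    (hasStrictFDerivAt_norm_sq (x₁ - x₀)).hasFDerivAt
  have h1 : HasFDerivAt (fun y : V => ‖y - x₀‖ ^ 2) (2 • innerSL ℝ w) x₁ :=
    (hasFDerivAt_comp_sub (f := fun y : V => ‖y‖ ^ 2) x₀).2 h0
  have h2 := hu'.add ((h1.neg.exp).const_mul (2 * ε))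
  have h3 : IsLocalMax (fun y => u y + 2 * ε * Real.exp (-‖y - x₀‖ ^ 2)) x₁ :=
    Eventually.of_forall hmax
  have h4 := h3.hasFDerivAt_eq_zero h2
  have h5 : L b = 4 * ε * (Real.exp (-‖w‖ ^ 2) * inner ℝ w b) := by
    have := congrArg (fun L : V →L[ℝ] ℝ => L b) h4
    simp [← hw] at this
    linarith
  rw [h5]
  have h6 : Real.exp (-‖w‖ ^ 2) * ‖w‖ ≤ 1 := by
    rw [Real.exp_neg, ← div_eq_inv_mul, div_le_one (Real.exp_pos _)]
    nlinarith [Real.add_one_le_exp (‖w‖ ^ 2), sq_nonneg (‖w‖ - 1)]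
  rw [abs_mul, abs_of_pos (by positivity : 0 < 4 * ε), abs_mul, abs_of_pos (Real.exp_pos _)]
  gcongr
  calc _ ≤ Real.exp (-‖w‖ ^ 2) * (‖w‖ * ‖b‖) := by
        gcongr; exact abs_real_inner_le_norm _ _
    _ = (Real.exp (-‖w‖ ^ 2) * ‖w‖) * ‖b‖ := by ring
    _ ≤ 1 * ‖b‖ := by gcongr
    _ = ‖b‖ := one_mul _

/-- At a maximum point of the perturbed function, second differences of `u` are bounded from below
by those of the Gaussian. -/
lemma sub_heat_ge_of_gaussian_max {ε t : ℝ} (hε : 0 < ε) (ht : 0 < t) {x₀ x₁ : V}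
    (hu : Continuous u) (hK : ∀ z, |u z| ≤ K)
    (hmax : ∀ y, u y + 2 * ε * Real.exp (-‖y - x₀‖ ^ 2) ≤
      u x₁ + 2 * ε * Real.exp (-‖x₁ - x₀‖ ^ 2)) :
    -(2 * ε * heatConst V * min t 1) ≤ u x₁ - heat t u x₁ := by
  have hC := one_le_heatConst (V := V)
  have hsd : ∀ z, -(2 * ε * secondDiff (fun y => Real.exp (-‖y‖ ^ 2)) (x₁ - x₀) z) ≤
      secondDiff u x₁ z := by
    intro z
    have h1 := hmax (x₁ + z)
    have h2 := hmax (x₁ - z)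
    have e1 : x₁ + z - x₀ = x₁ - x₀ + z := by abel
    have e2 : x₁ - z - x₀ = x₁ - x₀ - z := by abel
    rw [e1] at h1
    rw [e2] at h2
    simp only [secondDiff]
    linarith
  rw [sub_heat_eq ht hu hK]
  have hi := integrable_heatKernel_smul ht (continuous_secondDiff hu x₁)
    (fun z => abs_secondDiff_le hK x₁ z)
  simp only [smul_eq_mul] at hi
  have k1 : -(4 * ε) ≤ ∫ z, heatKernel t z * secondDiff u x₁ z := by
    have h1 : ∫ z : V, heatKernel t z * (-(4 * ε)) ≤ ∫ z, heatKernel t z * secondDiff u x₁ z := by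
      refine integral_mono ((integrable_heatKernel ht).mul_const _) hi fun z => ?_
      refine mul_le_mul_of_nonneg_left (le_trans ?_ (hsd z)) (heatKernel_pos ht z).le
      have := mul_le_mul_of_nonneg_left (secondDiff_gaussian_le (x₁ - x₀) z).2 hε.le
      linarith
    rwa [integral_mul_const, integral_heatKernel ht, one_mul] at h1
  have k2 : -(4 * ε * (heatConst V * t)) ≤ ∫ z, heatKernel t z * secondDiff u x₁ z := by
    have h1 : ∫ z : V, -(4 * ε) * (‖z‖ ^ (2:ℝ) * heatKernel t z) ≤
        ∫ z, heatKernel t z * secondDiff u x₁ z := by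
      refine integral_mono ((integrable_norm_rpow_mul_heatKernel ht (by norm_num)
        le_rfl).const_mul _) hi fun z => ?_
      have h2 : -(4 * ε) * (‖z‖ ^ (2:ℝ) * heatKernel t z) =
          heatKernel t z * (-(4 * ε) * ‖z‖ ^ 2) := by rw [Real.rpow_two]; ring
      simp only
      rw [h2]
      refine mul_le_mul_of_nonneg_left (le_trans ?_ (hsd z)) (heatKernel_pos ht z).le
      have := mul_le_mul_of_nonneg_left (secondDiff_gaussian_le (x₁ - x₀) z).1 hε.le
      linarith
    rw [integral_const_mul] at h1
    have h3 := integral_norm_rpow_mul_heatKernel_le (V := V) ht (by norm_num : (0:ℝ) ≤ 2) le_rfl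
    rw [show (2:ℝ) / 2 = 1 by norm_num, Real.rpow_one] at h3
    have := mul_le_mul_of_nonneg_left h3 hε.le
    linarith
  rcases le_total t 1 with h | h
  · rw [min_eq_left h]; linarith
  · rw [min_eq_right h]
    have := mul_le_mul_of_nonneg_left hC hε.le
    linarith

/-- The integral `∫_0^∞ t^{-1-s} min (t, 1) dt`. -/
noncomputable def levyMinMass (s : ℝ) : ℝ := ∫ t in Set.Ioi (0:ℝ), t ^ (-1 - s) * min t 1

lemma levyMinMass_nonneg : 0 ≤ levyMinMass s :=
  setIntegral_nonneg measurableSet_Ioi fun t ht => by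
    have ht0 : 0 < t := ht
    positivity

lemma integrableOn_levyMinMass (hs : 0 < s) (hs1 : s < 1) :
    IntegrableOn (fun t : ℝ => t ^ (-1 - s) * min t 1) (Set.Ioi 0) := by
  refine integrableOn_levy (p := 1) (A := 1) (B := 1) hs hs1 (by fun_prop) (fun t ht ht1 => ?_)
    (fun t ht => ?_)
  · rw [min_eq_left ht1, abs_of_pos ht]; simp
  · rw [min_eq_right ht.le]; simp

/-- The nonlocal term at a maximum point of `u` plus a small Gaussian. -/
lemma fracGen_ge_of_gaussian_max {ε W : ℝ} (hs : 0 < s) (hs1 : s < 1) (hδ : 0 ≤ δ)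
    (hσ : 2 * s < σ) (hσ2 : σ ≤ 2) (hε : 0 < ε) {x₀ x₁ : V}
    (hu : Continuous u) (hK : ∀ z, |u z| ≤ K) (hA0 : 0 ≤ A)
    (hA : ∀ z, |secondDiff u x₁ z| ≤ A * ‖z‖ ^ σ) (hW : W ≤ u x₁)
    (hmax : ∀ y, u y + 2 * ε * Real.exp (-‖y - x₀‖ ^ 2) ≤
      u x₁ + 2 * ε * Real.exp (-‖x₁ - x₀‖ ^ 2)) :
    levyMass s δ * W - 2 * ε * heatConst V * levyMinMass s ≤ fracGen s δ u x₁ := by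
  have hC := one_le_heatConst (V := V)
  have i1 := (integrableOn_levyMass hs hs1 hδ).mul_const W
  have i2 := (integrableOn_levyMinMass hs hs1).const_mul (2 * ε * heatConst V)
  have e : levyMass s δ * W - 2 * ε * heatConst V * levyMinMass s =
      ∫ t in Set.Ioi 0, (t ^ (-1 - s) * (1 - Real.exp (-(δ * t))) * W -
        2 * ε * heatConst V * (t ^ (-1 - s) * min t 1)) := by
    rw [integral_sub i1 i2, integral_mul_const, integral_const_mul]
    rfl
  rw [e]
  refine setIntegral_mono_on (i1.sub i2)
    (integrableOn_fracGen hs hs1 hδ hσ hσ2 hu hK hA0 hA) measurableSet_Ioi fun t ht => ?_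
  have ht0 : 0 < t := ht
  have h1 := sub_heat_ge_of_gaussian_max hε ht0 hu hK hmax
  have h2 := one_sub_exp_nonneg hδ ht0
  have h3 := Real.exp_pos (-(δ * t))
  have h4 : 0 ≤ 2 * ε * heatConst V * min t 1 := by positivity
  have h5 : (1 - Real.exp (-(δ * t))) * W - 2 * ε * heatConst V * min t 1 ≤
      u x₁ - Real.exp (-(δ * t)) * heat t u x₁ := by
    have k1 := mul_le_mul_of_nonneg_left h1 h3.le
    have k2 := mul_le_mul_of_nonneg_left hW h2
    have k3 := mul_nonneg h2 h4
    linarith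
  calc _ = t ^ (-1 - s) * ((1 - Real.exp (-(δ * t))) * W -
        2 * ε * heatConst V * min t 1) := by ring
    _ ≤ _ := by gcongr

/-- The one-sided maximum principle for `κ (δ - Δ)^s u + b · ∇u + c u ≤ Q`. As the supremum of `u`
need not be attained, `u` is perturbed by a small Gaussian centred at an almost maximal point. -/
lemma le_of_fracGen_le {κ Q c₀ Mb : ℝ} (hs : 0 < s) (hs1 : s < 1) (hδ : 0 ≤ δ) (hσ : 2 * s < σ)
    (hσ2 : σ ≤ 2) (hκ : 0 < κ) (hc₀ : 0 < c₀) (hQ : 0 ≤ Q) (hK : ∀ z, |u z| ≤ K)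
    {u' : V → V →L[ℝ] ℝ} (hu' : ∀ x, HasFDerivAt u (u' x) x) (hA0 : 0 ≤ A)
    (hA : ∀ x z, |secondDiff u x z| ≤ A * ‖z‖ ^ σ) {b : V → V} {c : V → ℝ}
    (hb : ∀ x, ‖b x‖ ≤ Mb) (hc : ∀ x, c₀ ≤ c x)
    (heq : ∀ x, κ * fracGen s δ u x + u' x (b x) + c x * u x ≤ Q) (x : V) :
    u x ≤ Q / (c₀ + κ * levyMass s δ) := by
  have hu : Continuous u := continuous_iff_continuousAt.2 fun x => (hu' x).continuousAt
  have hm0 := levyMass_nonneg (s := s) hδ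
  have hMb : 0 ≤ Mb := (norm_nonneg _).trans (hb 0)
  have hD : 0 < c₀ + κ * levyMass s δ := by positivity
  by_contra! hlt
  have hbdd : BddAbove (Set.range u) := ⟨K, by rintro _ ⟨z, rfl⟩; exact (abs_le.1 (hK z)).2⟩
  set U := ⨆ z, u z with hU
  have hxU : u x ≤ U := le_ciSup hbdd x
  have hUQ : Q < U * (c₀ + κ * levyMass s δ) := by
    rw [div_lt_iff₀ hD] at hlt
    exact hlt.trans_le (mul_le_mul_of_nonneg_right hxU hD.le)
  have hU0 : 0 < U := by
    by_contra! h
    nlinarith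
  have hm₁0 := levyMinMass_nonneg (s := s)
  have hC := one_le_heatConst (V := V)
  set C₂ := κ * (2 * heatConst V * levyMinMass s) + 4 * Mb with hC₂
  have hC₂0 : 0 ≤ C₂ := by positivity
  -- `ε` so small that the errors made by the Gaussian do not close the gap `U D - Q > 0`
  obtain ⟨ε, hε, hεU, hεQ⟩ : ∃ ε > 0, ε < U ∧
      Q + ε * C₂ < (U - ε) * (c₀ + κ * levyMass s δ) := by
    set gap := U * (c₀ + κ * levyMass s δ) - Q with hgap
    have hgap0 : 0 < gap := by linarith
    set T := C₂ + (c₀ + κ * levyMass s δ) with hT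
    have hT0 : 0 < T := by positivity
    have h1 : min U (gap / T) / 2 * T < gap := by
      have : min U (gap / T) ≤ gap / T := min_le_right _ _
      have h2 : min U (gap / T) * T ≤ gap := by rwa [← le_div_iff₀ hT0]
      linarith
    refine ⟨min U (gap / T) / 2, by positivity, ?_, ?_⟩
    · have := min_le_left U (gap / T)
      linarith
    · rw [hT] at h1 ⊢
      linarith
  obtain ⟨x₀, hx₀⟩ := exists_lt_of_lt_ciSup (show U - ε < ⨆ z, u z by linarith)
  have hη1 : ∀ y : V, Real.exp (-‖y‖ ^ 2) ≤ 1 := fun y => Real.exp_le_one_iff.2 (by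
    have := sq_nonneg ‖y‖; linarith)
  obtain ⟨x₁, hx₁, hmax⟩ := (isCompact_closedBall x₀ 1).exists_isMaxOn
    (Metric.nonempty_closedBall.2 zero_le_one)
    (by fun_prop : Continuous fun y => u y + 2 * ε * Real.exp (-‖y - x₀‖ ^ 2)).continuousOn
  have hvx₀ : U + ε < u x₀ + 2 * ε * Real.exp (-‖x₀ - x₀‖ ^ 2) := by simp; linarith
  have hx₀₁ : u x₀ + 2 * ε * Real.exp (-‖x₀ - x₀‖ ^ 2) ≤
      u x₁ + 2 * ε * Real.exp (-‖x₁ - x₀‖ ^ 2) := hmax (Metric.mem_closedBall_self zero_le_one)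
  -- outside the unit ball the Gaussian is below `1/2`, so the maximum over the ball is global
  have hglob : ∀ y, u y + 2 * ε * Real.exp (-‖y - x₀‖ ^ 2) ≤
      u x₁ + 2 * ε * Real.exp (-‖x₁ - x₀‖ ^ 2) := by
    intro y
    by_cases hy : y ∈ Metric.closedBall x₀ 1
    · exact hmax hy
    · have h2 : 1 < ‖y - x₀‖ := by simpa [dist_eq_norm] using hy
      have h3 : Real.exp (-‖y - x₀‖ ^ 2) ≤ 1 / 2 := by
        have h4 : Real.exp (-‖y - x₀‖ ^ 2) ≤ Real.exp (-1) := Real.exp_le_exp.2 (by nlinarith)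
        exact h4.trans (by linarith [Real.exp_neg_one_lt_d9])
      have h5 : u y ≤ U := le_ciSup hbdd y
      have h6 := mul_le_mul_of_nonneg_left h3 hε.le
      linarith
  have hux₁ : U - ε ≤ u x₁ := by
    have h2 := mul_le_mul_of_nonneg_left (hη1 (x₁ - x₀)) hε.le
    linarith
  have hdrift := (abs_le.1 (abs_fderiv_le_of_gaussian_max hε (hu' x₁) hglob (b x₁))).1
  have hdrift2 := mul_le_mul_of_nonneg_left (hb x₁) hε.le
  have hfrac := fracGen_ge_of_gaussian_max hs hs1 hδ hσ hσ2 hε hu hK hA0 (hA x₁) hux₁ hglob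
  have hfin := heq x₁
  have h1 : c₀ * (U - ε) ≤ c x₁ * u x₁ :=
    mul_le_mul (hc x₁) hux₁ (by linarith) (hc₀.le.trans (hc x₁))
  have h2 := mul_le_mul_of_nonneg_left hfrac hκ.le
  rw [hC₂] at hεQ
  linarith

end Inverse

section HolderSpace

variable {n : ℕ} {F : Type*} [NormedAddCommGroup F] [NormedSpace ℝ F]

/-! ### Hölder spaces -/

lemma norm_sub_le_of_eHolderNorm_le {X Y : Type*} [NormedAddCommGroup X] [NormedAddCommGroup Y]
    {γ N : ℝ≥0} {φ : X → Y} (h : eHolderNorm γ φ ≤ N) (x y : X) :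
    ‖φ x - φ y‖ ≤ N * ‖x - y‖ ^ (γ : ℝ) := by
  have hm : MemHolder γ φ := eHolderNorm_lt_top.1 (h.trans_lt ENNReal.coe_lt_top)
  have h1 : nnHolderNorm γ φ ≤ N := by
    rw [← hm.coe_nnHolderNorm_eq_eHolderNorm] at h
    exact_mod_cast h
  have h2 := hm.holderWith.dist_le x y
  rw [dist_eq_norm, dist_eq_norm] at h2
  refine h2.trans ?_
  gcongr

lemma eHolderNorm_le_of_norm_sub_le {X Y : Type*} [NormedAddCommGroup X] [NormedAddCommGroup Y]
    {γ N : ℝ≥0} {φ : X → Y} (h : ∀ x y, ‖φ x - φ y‖ ≤ N * ‖x - y‖ ^ (γ : ℝ)) :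
    eHolderNorm γ φ ≤ N := by
  refine HolderWith.eHolderNorm_le fun x y => ?_
  rw [edist_dist, edist_dist, dist_eq_norm, dist_eq_norm,
    ENNReal.ofReal_rpow_of_nonneg (norm_nonneg (x - y)) γ.coe_nonneg, ← ENNReal.ofReal_coe_nnreal,
    ← ENNReal.ofReal_mul N.coe_nonneg]
  exact ENNReal.ofReal_le_ofReal (h x y)

lemma enorm_partialDeriv_le_ckENorm {k j : ℕ} (hj : j ≤ k) (i : Fin j → Fin n)
    (u : EuclideanSpace ℝ (Fin n) → F) (x : EuclideanSpace ℝ (Fin n)) :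
    ‖partialDeriv i u x‖ₑ ≤ ckENorm k u :=
  le_iSup₂_of_le j hj (le_iSup₂_of_le i x le_rfl)

lemma eHolderNorm_partialDeriv_le {k j : ℕ} (hj : j ≤ k) (i : Fin j → Fin n) (γ : ℝ≥0)
    (u : EuclideanSpace ℝ (Fin n) → F) :
    eHolderNorm γ (partialDeriv i u) ≤ holderESeminorm k γ u :=
  le_iSup₂_of_le j hj (le_iSup_of_le i le_rfl)

lemma norm_partialDeriv_le {θ : ℝ} {N : ℝ≥0} {j : ℕ} {u : EuclideanSpace ℝ (Fin n) → F}
    (hN : holderENorm θ u ≤ N) (hj : j ≤ ⌊θ⌋₊) (i : Fin j → Fin n)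
    (x : EuclideanSpace ℝ (Fin n)) : ‖partialDeriv i u x‖ ≤ N := by
  have := (enorm_partialDeriv_le_ckENorm hj i u x).trans (le_self_add.trans hN)
  rw [← ofReal_norm, ← ENNReal.ofReal_coe_nnreal] at this
  exact (ENNReal.ofReal_le_ofReal_iff N.coe_nonneg).1 this

lemma norm_partialDeriv_sub_le {θ : ℝ} {N : ℝ≥0} {j : ℕ} {u : EuclideanSpace ℝ (Fin n) → F}
    (hN : holderENorm θ u ≤ N) (hj : j ≤ ⌊θ⌋₊) (i : Fin j → Fin n)
    (x y : EuclideanSpace ℝ (Fin n)) :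
    ‖partialDeriv i u x - partialDeriv i u y‖ ≤ N * ‖x - y‖ ^ (Int.fract θ) := by
  have := norm_sub_le_of_eHolderNorm_le
    ((eHolderNorm_partialDeriv_le hj i (Int.fract θ).toNNReal u).trans (le_add_self.trans hN)) x y
  rwa [Real.coe_toNNReal _ (Int.fract_nonneg θ)] at this

lemma partialDeriv_zero (i : Fin 0 → Fin n) (u : EuclideanSpace ℝ (Fin n) → F) :
    partialDeriv i u = u := by
  ext x; simp [partialDeriv]

lemma partialDeriv_one (i : Fin 1 → Fin n) (u : EuclideanSpace ℝ (Fin n) → F)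
    (x : EuclideanSpace ℝ (Fin n)) :
    partialDeriv i u x = fderiv ℝ u x (EuclideanSpace.single (i 0) 1) := by
  simp [partialDeriv]

lemma partialDeriv_two (i : Fin 2 → Fin n) (u : EuclideanSpace ℝ (Fin n) → F)
    (x : EuclideanSpace ℝ (Fin n)) :
    partialDeriv i u x = fderiv ℝ (fderiv ℝ u) x (EuclideanSpace.single (i 0) 1)
      (EuclideanSpace.single (i 1) 1) := by
  simp [partialDeriv, iteratedFDeriv_two_apply]

lemma holderENorm_bounds {α : ℝ} (hα : 0 < α) (hα1 : α < 1) {N : ℝ≥0}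
    {f : EuclideanSpace ℝ (Fin n) → F} (hN : holderENorm α f ≤ N) :
    (∀ x, ‖f x‖ ≤ N) ∧ ∀ x y, ‖f x - f y‖ ≤ N * ‖x - y‖ ^ α := by
  have hfr : Int.fract α = α := Int.fract_eq_self.2 ⟨hα.le, hα1⟩
  refine ⟨fun x => ?_, fun x y => ?_⟩
  · simpa [partialDeriv_zero] using norm_partialDeriv_le hN (Nat.zero_le _) Fin.elim0 x
  · have := norm_partialDeriv_sub_le hN (Nat.zero_le _) Fin.elim0 x y
    rwa [partialDeriv_zero, hfr] at this

lemma norm_le_sum_single (L : EuclideanSpace ℝ (Fin n) →L[ℝ] F) :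
    ‖L‖ ≤ ∑ i, ‖L (EuclideanSpace.single i 1)‖ := by
  refine L.opNorm_le_bound (Finset.sum_nonneg fun _ _ => norm_nonneg _) fun v => ?_
  have hv : v = ∑ i, v i • EuclideanSpace.single i (1:ℝ) := by
    have := (EuclideanSpace.basisFun (Fin n) ℝ).sum_repr v
    simpa using this.symm
  have h1 : L v = ∑ i, v i • L (EuclideanSpace.single i 1) := by
    conv_lhs => rw [hv]
    simp
  rw [h1, Finset.sum_mul]
  refine (norm_sum_le _ _).trans (Finset.sum_le_sum fun i _ => ?_)
  rw [norm_smul, mul_comm]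
  gcongr
  exact PiLp.norm_apply_le v i

lemma abs_secondDiff_le_of_hasFDerivAt {V : Type*} [NormedAddCommGroup V] [InnerProductSpace ℝ V]
    {u : V → ℝ} {u' : V → V →L[ℝ] ℝ} {L β : ℝ}
    (hu' : ∀ x, HasFDerivAt u (u' x) x) (hβ : 0 ≤ β)
    (hL : ∀ x y, ‖u' x - u' y‖ ≤ L * ‖x - y‖ ^ β) (x z : V) :
    |secondDiff u x z| ≤ L * ‖z‖ ^ (β + 1) := by
  have h1 : ∀ y, HasFDerivAt (fun y => u (y + z) - u y) (u' (y + z) - u' y) y := fun y =>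
    ((hasFDerivAt_comp_add_right z).2 (hu' (y + z))).sub (hu' y)
  have h2 := convex_univ.norm_image_sub_le_of_norm_hasFDerivWithin_le (C := L * ‖z‖ ^ β)
    (fun y _ => (h1 y).hasFDerivWithinAt) (fun y _ => by simpa using hL (y + z) y)
    (Set.mem_univ x) (Set.mem_univ (x - z))
  have e : secondDiff u x z = u (x - z + z) - u (x - z) - (u (x + z) - u x) := by
    unfold secondDiff; rw [sub_add_cancel]; ring
  rw [e]
  simp only [Real.norm_eq_abs] at h2
  refine h2.trans_eq ?_
  rw [sub_sub_cancel_left, norm_neg, Real.rpow_add_of_nonneg (norm_nonneg _) hβ zero_le_one,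
    Real.rpow_one]
  ring

/-- A function in `C^θ`, with `1 < θ < 3` not an integer, has second differences of order
`|z|^{min (θ, 2)}`. -/
lemma MemHolderSpace.exists_bounds {θ : ℝ} (h1 : 1 < θ) (h2 : θ ≠ 2) (h3 : θ < 3)
    {u : EuclideanSpace ℝ (Fin n) → ℝ} (hu : MemHolderSpace θ u) :
    ∃ K A : ℝ, (∀ x, |u x| ≤ K) ∧ (∀ x, HasFDerivAt u (fderiv ℝ u x) x) ∧ 0 ≤ A ∧
      ∀ x z, |secondDiff u x z| ≤ A * ‖z‖ ^ min θ 2 := by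
  obtain ⟨hcd, hlt⟩ := hu
  obtain ⟨N, hN⟩ : ∃ N : ℝ≥0, holderENorm θ u ≤ N := ⟨_, (ENNReal.coe_toNNReal hlt.ne).ge⟩
  have hb : ∀ x, |u x| ≤ N := fun x => by
    simpa [partialDeriv_zero] using norm_partialDeriv_le hN (Nat.zero_le _) Fin.elim0 x
  have hfl1 : 1 ≤ ⌊θ⌋₊ := Nat.le_floor (by exact_mod_cast h1.le)
  have hdiff : Differentiable ℝ u := hcd.differentiable (by
    have : ⌊θ⌋₊ ≠ 0 := by omega
    exact_mod_cast this)
  have hder : ∀ x, HasFDerivAt u (fderiv ℝ u x) x := fun x => (hdiff x).hasFDerivAt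
  rcases lt_or_gt_of_ne h2 with h2 | h2
  · have hfl : ⌊θ⌋₊ = 1 := (Nat.floor_eq_iff (by linarith)).2 ⟨by simpa using h1.le, by
      norm_num; exact h2⟩
    have hfr : Int.fract θ = θ - 1 := by
      rw [Int.fract_eq_iff]; exact ⟨by linarith, by linarith, 1, by simp⟩
    refine ⟨N, n * N, hb, hder, by positivity, fun x z => ?_⟩
    have := abs_secondDiff_le_of_hasFDerivAt (L := n * N) (β := θ - 1) hder (by linarith)
      (fun x y => ?_) x z
    · rwa [sub_add_cancel, ← min_eq_left h2.le] at this
    · refine (norm_le_sum_single _).trans ?_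
      calc _ ≤ ∑ i : Fin n, (N : ℝ) * ‖x - y‖ ^ (θ - 1) := by
            refine Finset.sum_le_sum fun i _ => ?_
            have := norm_partialDeriv_sub_le hN hfl1 (fun _ => i) x y
            rw [partialDeriv_one, partialDeriv_one, hfr] at this
            simpa using this
        _ = _ := by simp; ring
  · have hfl2 : 2 ≤ ⌊θ⌋₊ := Nat.le_floor (by exact_mod_cast h2.le)
    have hcd2 : ContDiff ℝ 2 u := hcd.of_le (by exact_mod_cast hfl2)
    have hdiff2 : Differentiable ℝ (fderiv ℝ u) :=
      (hcd2.fderiv_right (m := 1) (by norm_num)).differentiable (by norm_num)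
    refine ⟨N, n * (n * N), hb, hder, by positivity, fun x z => ?_⟩
    have := abs_secondDiff_le_of_hasFDerivAt (L := n * (n * N)) (β := 1) hder (by linarith)
      (fun x y => ?_) x z
    · rw [min_eq_right h2.le]
      rwa [one_add_one_eq_two] at this
    · rw [Real.rpow_one]
      refine convex_univ.norm_image_sub_le_of_norm_hasFDerivWithin_le
        (fun x _ => (hdiff2 x).hasFDerivAt.hasFDerivWithinAt) (fun w _ => ?_)
        (Set.mem_univ y) (Set.mem_univ x)
      refine (norm_le_sum_single _).trans ?_
      calc _ ≤ ∑ i : Fin n, ((n : ℝ) * N) := by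
            refine Finset.sum_le_sum fun i _ => (norm_le_sum_single _).trans ?_
            calc _ ≤ ∑ j : Fin n, (N : ℝ) := by
                  refine Finset.sum_le_sum fun j _ => ?_
                  have := norm_partialDeriv_le hN hfl2 ![i, j] w
                  rw [partialDeriv_two] at this
                  simpa using this
              _ = _ := by simp
        _ = _ := by simp

/-- A bounded Lipschitz function is Hölder continuous of every exponent in `[0, 1]`. -/
lemma norm_sub_le_two_mul_rpow {X Y : Type*} [NormedAddCommGroup X] [NormedAddCommGroup Y]
    {φ : X → Y} {K γ : ℝ} (hγ : 0 ≤ γ) (hγ1 : γ ≤ 1) (hK : ∀ x, ‖φ x‖ ≤ K)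
    (hL : ∀ x y, ‖φ x - φ y‖ ≤ K * ‖x - y‖) (x y : X) :
    ‖φ x - φ y‖ ≤ 2 * K * ‖x - y‖ ^ γ := by
  have hK0 : 0 ≤ K := (norm_nonneg _).trans (hK 0)
  rcases le_total ‖x - y‖ 1 with h | h
  · rcases (norm_nonneg (x - y)).eq_or_lt with h0 | h0
    · have := hL x y
      rw [← h0, mul_zero] at this
      exact this.trans (by positivity)
    · have h1 : ‖x - y‖ ≤ ‖x - y‖ ^ γ := by
        simpa using Real.rpow_le_rpow_of_exponent_ge h0 h hγ1
      have := hL x y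
      nlinarith [mul_le_mul_of_nonneg_left h1 hK0, mul_nonneg hK0 h0.le]
  · have h1 : 1 ≤ ‖x - y‖ ^ γ := Real.one_le_rpow h hγ
    have h2 := (norm_sub_le (φ x) (φ y)).trans (add_le_add (hK x) (hK y))
    nlinarith

lemma norm_single_one (i : Fin n) : ‖(EuclideanSpace.single i (1:ℝ))‖ = 1 := by simp

lemma memHolderSpace_of_one_lt {θ : ℝ} (h1 : 1 < θ) (h2 : θ < 2) {K : ℝ≥0}
    {u : EuclideanSpace ℝ (Fin n) → ℝ}
    {u' : EuclideanSpace ℝ (Fin n) → EuclideanSpace ℝ (Fin n) →L[ℝ] ℝ}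
    (hu' : ∀ x, HasFDerivAt u (u' x) x) (hc : Continuous u') (hK : ∀ x, ‖u x‖ ≤ K)
    (hK' : ∀ x, ‖u' x‖ ≤ K) (hH : ∀ x y, ‖u' x - u' y‖ ≤ K * ‖x - y‖ ^ (θ - 1)) :
    MemHolderSpace θ u ∧ holderENorm θ u ≤ 3 * K := by
  have hfd : fderiv ℝ u = u' := funext fun x => (hu' x).fderiv
  have hfl : ⌊θ⌋₊ = 1 := (Nat.floor_eq_iff (by linarith)).2 ⟨by simpa using h1.le, by
      norm_num; exact h2⟩
  have hfr : Int.fract θ = θ - 1 := by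
    rw [Int.fract_eq_iff]; exact ⟨by linarith, by linarith, 1, by simp⟩
  have hcd : ContDiff ℝ 1 u :=
    contDiff_one_iff_fderiv.2 ⟨fun x => (hu' x).differentiableAt, by rwa [hfd]⟩
  have hγ : ((Int.fract θ).toNNReal : ℝ) = θ - 1 := by
    rw [Real.coe_toNNReal _ (Int.fract_nonneg θ), hfr]
  have hn : holderENorm θ u ≤ 3 * K := by
    unfold holderENorm
    rw [hfl]
    have e1 : ckENorm 1 u ≤ K := by
      refine iSup₂_le fun j hj => iSup₂_le fun i x => ?_
      rw [← ofReal_norm, ← ENNReal.ofReal_coe_nnreal]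
      refine ENNReal.ofReal_le_ofReal ?_
      interval_cases j
      · rw [partialDeriv_zero]; exact hK x
      · rw [partialDeriv_one, hfd]
        refine ((u' x).le_opNorm _).trans ?_
        rw [norm_single_one, mul_one]; exact hK' x
    have e2 : holderESeminorm 1 (Int.fract θ).toNNReal u ≤ 2 * K := by
      refine iSup₂_le fun j hj => iSup_le fun i => ?_
      have e3 : (2 * K : ℝ≥0∞) = ((2 * K : ℝ≥0) : ℝ≥0∞) := by push_cast; rfl
      rw [e3]
      refine eHolderNorm_le_of_norm_sub_le fun x y => ?_
      rw [hγ]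
      push_cast
      interval_cases j
      · rw [partialDeriv_zero]
        refine norm_sub_le_two_mul_rpow (by linarith) (by linarith) hK (fun x y => ?_) x y
        exact convex_univ.norm_image_sub_le_of_norm_hasFDerivWithin_le
          (fun x _ => (hu' x).hasFDerivWithinAt) (fun w _ => hK' w) (Set.mem_univ y)
          (Set.mem_univ x)
      · rw [partialDeriv_one, partialDeriv_one, hfd, ← sub_apply]
        refine ((u' x - u' y).le_opNorm _).trans ?_
        rw [norm_single_one, mul_one]
        refine (hH x y).trans ?_
        gcongr
        linarith [K.2]
    calc _ ≤ (K : ℝ≥0∞) + 2 * K := add_le_add e1 e2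
      _ = 3 * K := by ring
  refine ⟨⟨by rw [hfl]; exact_mod_cast hcd, hn.trans_lt ?_⟩, hn⟩
  exact ENNReal.mul_lt_top (by norm_num) ENNReal.coe_lt_top

set_option maxSynthPendingDepth 3 in
lemma memHolderSpace_of_two_lt {θ : ℝ} (h1 : 2 < θ) (h2 : θ < 3) {K : ℝ≥0}
    {u : EuclideanSpace ℝ (Fin n) → ℝ}
    {u' : EuclideanSpace ℝ (Fin n) → EuclideanSpace ℝ (Fin n) →L[ℝ] ℝ}
    {u'' : EuclideanSpace ℝ (Fin n) → EuclideanSpace ℝ (Fin n) →L[ℝ]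
      EuclideanSpace ℝ (Fin n) →L[ℝ] ℝ}
    (hu' : ∀ x, HasFDerivAt u (u' x) x) (hu'' : ∀ x, HasFDerivAt u' (u'' x) x)
    (hc : Continuous u'') (hK : ∀ x, ‖u x‖ ≤ K)
    (hK' : ∀ x, ‖u' x‖ ≤ K) (hK'' : ∀ x, ‖u'' x‖ ≤ K)
    (hH : ∀ x y, ‖u'' x - u'' y‖ ≤ K * ‖x - y‖ ^ (θ - 2)) :
    MemHolderSpace θ u ∧ holderENorm θ u ≤ 3 * K := by
  have hfd : fderiv ℝ u = u' := funext fun x => (hu' x).fderiv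
  have hfd2 : fderiv ℝ u' = u'' := funext fun x => (hu'' x).fderiv
  have hfl : ⌊θ⌋₊ = 2 := (Nat.floor_eq_iff (by linarith)).2 ⟨by simpa using h1.le, by
      norm_num; exact h2⟩
  have hfr : Int.fract θ = θ - 2 := by
    rw [Int.fract_eq_iff]; exact ⟨by linarith, by linarith, 2, by simp⟩
  have hcd : ContDiff ℝ 2 u := by
    have e : (2 : WithTop ℕ∞) = 1 + 1 := one_add_one_eq_two.symm
    refine e ▸ contDiff_succ_iff_fderiv.2 ⟨fun x => (hu' x).differentiableAt, by simp, ?_⟩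
    rw [hfd, contDiff_one_iff_fderiv]
    exact ⟨fun x => (hu'' x).differentiableAt, by rwa [hfd2]⟩
  have hγ : ((Int.fract θ).toNNReal : ℝ) = θ - 2 := by
    rw [Real.coe_toNNReal _ (Int.fract_nonneg θ), hfr]
  have hap : ∀ (L : EuclideanSpace ℝ (Fin n) →L[ℝ] EuclideanSpace ℝ (Fin n) →L[ℝ] ℝ) (i j : Fin n),
      ‖L (EuclideanSpace.single i 1) (EuclideanSpace.single j 1)‖ ≤ ‖L‖ := fun L i j => by
    have := L.le_opNorm₂ (EuclideanSpace.single i 1) (EuclideanSpace.single j 1)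
    rwa [norm_single_one, norm_single_one, mul_one, mul_one] at this
  have hn : holderENorm θ u ≤ 3 * K := by
    unfold holderENorm
    rw [hfl]
    have e1 : ckENorm 2 u ≤ K := by
      refine iSup₂_le fun j hj => iSup₂_le fun i x => ?_
      rw [← ofReal_norm, ← ENNReal.ofReal_coe_nnreal]
      refine ENNReal.ofReal_le_ofReal ?_
      interval_cases j
      · rw [partialDeriv_zero]; exact hK x
      · rw [partialDeriv_one, hfd]
        refine ((u' x).le_opNorm _).trans ?_
        rw [norm_single_one, mul_one]; exact hK' x
      · rw [partialDeriv_two, hfd, hfd2]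
        exact (hap _ _ _).trans (hK'' x)
    have e2 : holderESeminorm 2 (Int.fract θ).toNNReal u ≤ 2 * K := by
      refine iSup₂_le fun j hj => iSup_le fun i => ?_
      have e3 : (2 * K : ℝ≥0∞) = ((2 * K : ℝ≥0) : ℝ≥0∞) := by push_cast; rfl
      rw [e3]
      refine eHolderNorm_le_of_norm_sub_le fun x y => ?_
      rw [hγ]
      push_cast
      interval_cases j
      · rw [partialDeriv_zero]
        refine norm_sub_le_two_mul_rpow (by linarith) (by linarith) hK (fun x y => ?_) x y
        exact convex_univ.norm_image_sub_le_of_norm_hasFDerivWithin_le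
          (fun x _ => (hu' x).hasFDerivWithinAt) (fun w _ => hK' w) (Set.mem_univ y)
          (Set.mem_univ x)
      · rw [partialDeriv_one, partialDeriv_one, hfd, ← sub_apply]
        refine ((u' x - u' y).le_opNorm _).trans ?_
        rw [norm_single_one, mul_one]
        refine norm_sub_le_two_mul_rpow (by linarith) (by linarith) hK' (fun x y => ?_) x y
        exact convex_univ.norm_image_sub_le_of_norm_hasFDerivWithin_le
          (fun x _ => (hu'' x).hasFDerivWithinAt) (fun w _ => hK'' w) (Set.mem_univ y)
          (Set.mem_univ x)
      · rw [partialDeriv_two, partialDeriv_two, hfd, hfd2, ← sub_apply,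
          ← sub_apply]
        refine (hap _ _ _).trans ((hH x y).trans ?_)
        gcongr
        linarith [K.2]
    calc _ ≤ (K : ℝ≥0∞) + 2 * K := add_le_add e1 e2
      _ = 3 * K := by ring
  refine ⟨⟨by rw [hfl]; exact_mod_cast hcd, hn.trans_lt ?_⟩, hn⟩
  exact ENNReal.mul_lt_top (by norm_num) ENNReal.coe_lt_top

end HolderSpace

section Perturbation

set_option linter.unusedSectionVars false

variable {V : Type*} [NormedAddCommGroup V] [InnerProductSpace ℝ V] [FiniteDimensional ℝ V]
  [MeasurableSpace V] [BorelSpace V]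

/-! ### The drift as a perturbation for large damping -/

/-- The lower-order terms `b · ∇u + c u` of the equation for the potential `u` of `g`. -/
noncomputable def driftOp (s δ : ℝ) (b : V → V) (c g : V → ℝ) (x : V) : ℝ :=
  gradBessel s δ g x (b x) + c x * besselPot s δ g x

/-- A bound for the norm of `driftOp` on bounded functions, for coefficients bounded by `Mb` and
`Mc`. It tends to zero as `δ → ∞`. -/
noncomputable def driftBound (V : Type*) [NormedAddCommGroup V] [InnerProductSpace ℝ V]
    (s δ Mb Mc : ℝ) : ℝ :=
  besselMass (s - 1 / 2) δ * heatConst V * Mb + Mc * besselMass s δ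

lemma tendsto_driftBound {s : ℝ} (hs : 1 / 2 < s) (Mb Mc : ℝ) :
    Tendsto (fun δ => driftBound V s δ Mb Mc) atTop (𝓝 0) := by
  have h1 := ((tendsto_besselMass (a := s - 1 / 2) (by linarith)).mul_const
    (heatConst V)).mul_const Mb
  have h2 := (tendsto_besselMass (a := s) (by linarith)).const_mul Mc
  have h3 := h1.add h2
  simp only [zero_mul, mul_zero, add_zero] at h3
  exact h3

variable {s δ μ Mb Mc K N : ℝ} {b : V → V} {c g : V → ℝ}

lemma driftBound_nonneg (hMb : 0 ≤ Mb) (hMc : 0 ≤ Mc) : 0 ≤ driftBound V s δ Mb Mc := by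
  have h1 := besselMass_nonneg (a := s) (δ := δ)
  have h2 := besselMass_nonneg (a := s - 1 / 2) (δ := δ)
  have h3 := heatConst_pos (V := V)
  unfold driftBound
  positivity

lemma abs_driftOp_le (hs : 1 / 2 < s) (hδ : 0 < δ) (hK : ∀ x, |g x| ≤ K) {x : V}
    (hb : ‖b x‖ ≤ Mb) (hc : |c x| ≤ Mc) : |driftOp s δ b c g x| ≤ driftBound V s δ Mb Mc * K := by
  have h1 := norm_gradBessel_le (F := ℝ) hs hδ hK x
  have h2 := norm_besselPot_le (F := ℝ) (by linarith : 0 < s) hδ hK x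
  rw [Real.norm_eq_abs] at h2
  have h4 : |gradBessel s δ g x (b x)| ≤ besselMass (s - 1 / 2) δ * (heatConst V * K) * Mb :=
    ((gradBessel s δ g x).le_opNorm (b x)).trans
      (mul_le_mul h1 hb (norm_nonneg _) ((norm_nonneg _).trans h1))
  have h5 : |c x * besselPot s δ g x| ≤ Mc * (besselMass s δ * K) := by
    rw [abs_mul]
    exact mul_le_mul hc h2 (abs_nonneg _) ((abs_nonneg _).trans hc)
  refine ((abs_add_le _ _).trans (add_le_add h4 h5)).trans_eq ?_
  unfold driftBound; ring

lemma continuous_besselPot (hs : 1 / 2 < s) (hδ : 0 < δ) (hg : Continuous g)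
    (hK : ∀ x, |g x| ≤ K) : Continuous (besselPot s δ g) :=
  continuous_iff_continuousAt.2 fun x => (hasFDerivAt_besselPot hs hδ hg hK x).continuousAt

lemma continuous_driftOp (hs : 1 / 2 < s) (hδ : 0 < δ) (hb : Continuous b) (hc : Continuous c)
    (hg : Continuous g) (hK : ∀ x, |g x| ≤ K) : Continuous (driftOp s δ b c g) := by
  have h1 := continuous_gradBessel (F := ℝ) hs hδ hg hK
  have h2 := continuous_besselPot hs hδ hg hK
  unfold driftOp
  fun_prop

lemma driftOp_sub {g' : V → ℝ} {K' : ℝ} (hs : 1 / 2 < s) (hδ : 0 < δ) (hg : Continuous g)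
    (hK : ∀ x, |g x| ≤ K) (hg' : Continuous g') (hK' : ∀ x, |g' x| ≤ K') (x : V) :
    driftOp s δ b c (fun y => g y - g' y) x = driftOp s δ b c g x - driftOp s δ b c g' x := by
  unfold driftOp
  rw [gradBessel_sub (F := ℝ) hs hδ hg hK hg' hK', besselPot_sub (F := ℝ) (by linarith) hδ hg hK
    hg' hK', sub_apply]
  ring

/-- A priori bound: the equation `μ g + (b · ∇ + c) J g = f` is a small perturbation of
`μ g = f`. -/
lemma abs_le_of_abs_add_driftOp_le (hs : 1 / 2 < s) (hδ : 0 < δ) (hμ : 0 < μ)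
    (hsmall : driftBound V s δ Mb Mc ≤ μ / 2) (hb : ∀ x, ‖b x‖ ≤ Mb) (hc : ∀ x, |c x| ≤ Mc)
    (hK : ∀ x, |g x| ≤ K) (h : ∀ x, |μ * g x + driftOp s δ b c g x| ≤ N) (x : V) :
    |g x| ≤ 2 / μ * N := by
  have hbdd : BddAbove (Set.range fun x => |g x|) := ⟨K, by rintro _ ⟨z, rfl⟩; exact hK z⟩
  set S := ⨆ x, |g x| with hS
  have hgS : ∀ x, |g x| ≤ S := fun x => le_ciSup hbdd x
  have hS0 : 0 ≤ S := (abs_nonneg _).trans (hgS 0)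
  have h1 : ∀ x, |g x| ≤ (N + μ / 2 * S) / μ := fun x => by
    have h2 := (abs_driftOp_le hs hδ hgS (hb x) (hc x)).trans
      (mul_le_mul_of_nonneg_right hsmall hS0)
    rw [le_div_iff₀ hμ, mul_comm, ← abs_of_pos hμ, ← abs_mul, abs_of_pos hμ]
    calc |μ * g x| = |(μ * g x + driftOp s δ b c g x) - driftOp s δ b c g x| := by
          rw [add_sub_cancel_right]
      _ ≤ _ := (abs_sub _ _).trans (add_le_add (h x) h2)
  have h2 : S ≤ (N + μ / 2 * S) / μ := ciSup_le h1
  rw [le_div_iff₀ hμ] at h2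
  refine (hgS x).trans ?_
  rw [div_mul_eq_mul_div, le_div_iff₀ hμ]
  linarith

/-- Hölder regularity for `μ g + (b · ∇ + c) J g = f`: differences `g (· + h) - g` solve an
equation of the same form. -/
lemma abs_sub_le_of_add_driftOp_eq {α : ℝ} {f : V → ℝ} (hs : 1 / 2 < s) (hδ : 0 < δ) (hμ : 0 < μ)
    (hsmall : driftBound V s δ Mb Mc ≤ μ / 2)
    (hb : ∀ x, ‖b x‖ ≤ Mb) (hc : ∀ x, |c x| ≤ Mc)
    (hbα : ∀ x y, ‖b x - b y‖ ≤ Mb * ‖x - y‖ ^ α) (hcα : ∀ x y, |c x - c y| ≤ Mc * ‖x - y‖ ^ α)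
    (hg : Continuous g) (hK : ∀ x, |g x| ≤ K) (heq : ∀ x, μ * g x + driftOp s δ b c g x = f x)
    (hf : ∀ x, |f x| ≤ N) (hfα : ∀ x y, |f x - f y| ≤ N * ‖x - y‖ ^ α) (x y : V) :
    |g x - g y| ≤ 4 / μ * N * ‖x - y‖ ^ α := by
  have hN : 0 ≤ N := (abs_nonneg _).trans (hf 0)
  have hgN : ∀ x, |g x| ≤ 2 / μ * N := abs_le_of_abs_add_driftOp_le hs hδ hμ hsmall hb hc hK
    fun x => by rw [heq]; exact hf x
  set h := x - y with hh
  have hcomp : ∀ z, driftOp s δ (fun z => b z) c (fun w => g (w + h)) z =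
      gradBessel s δ g (z + h) (b z) + c z * besselPot s δ g (z + h) := by
    intro z
    have e1 : ∀ r, heat r (fun w => g (w + h)) z = heat r g (z + h) := fun r => by
      unfold heat; simp_rw [sub_add_eq_add_sub]
    have e2 : ∀ r, gradHeat r (fun w => g (w + h)) z = gradHeat r g (z + h) := fun r => by
      unfold gradHeat; simp_rw [sub_add_eq_add_sub]
    unfold driftOp gradBessel besselPot
    simp_rw [e1, e2]
  have hgc : Continuous fun w => g (w + h) := by fun_prop
  -- the translate of `g` solves the equation with translated coefficients, so the difference
  -- solves the original one up to the commutator with `b - b (· - h)` and `c - c (· - h)`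
  have key : ∀ z, |μ * (g (z + h) - g z) +
      driftOp s δ b c (fun w => g (w + h) - g w) z| ≤ 2 * N * ‖h‖ ^ α := by
    intro z
    rw [driftOp_sub hs hδ hgc (fun w => hK _) hg hK, hcomp]
    have e : μ * (g (z + h) - g z) + (gradBessel s δ g (z + h) (b z) +
        c z * besselPot s δ g (z + h) - driftOp s δ b c g z) =
        (f (z + h) - f z) - driftOp s δ (fun w => b w - b (w - h)) (fun w => c w - c (w - h)) g
          (z + h) := by
      rw [← heq, ← heq]
      unfold driftOp
      simp only [add_sub_cancel_right, map_sub]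
      ring
    rw [e]
    have h1 := hfα (z + h) z
    have h2 := abs_driftOp_le (b := fun w => b w - b (w - h)) (c := fun w => c w - c (w - h))
      (x := z + h) (Mb := Mb * ‖h‖ ^ α) (Mc := Mc * ‖h‖ ^ α) hs hδ hgN
      (by simpa using hbα (z + h) (z + h - h)) (by simpa using hcα (z + h) (z + h - h))
    have h3 : driftBound V s δ (Mb * ‖h‖ ^ α) (Mc * ‖h‖ ^ α) * (2 / μ * N) ≤ N * ‖h‖ ^ α := by
      have e : driftBound V s δ (Mb * ‖h‖ ^ α) (Mc * ‖h‖ ^ α) * (2 / μ * N) =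
          driftBound V s δ Mb Mc * (2 / μ * N * ‖h‖ ^ α) := by unfold driftBound; ring
      rw [e]
      calc _ ≤ μ / 2 * (2 / μ * N * ‖h‖ ^ α) := by gcongr
        _ = _ := by field_simp
    rw [add_sub_cancel_left] at h1
    refine (abs_sub _ _).trans ?_
    linarith
  have := abs_le_of_abs_add_driftOp_le (K := K + K) hs hδ hμ hsmall hb hc
    (fun w => (abs_sub _ _).trans (add_le_add (hK _) (hK _))) key y
  rw [hh, add_sub_cancel] at this
  refine this.trans_eq ?_
  ring

open BoundedContinuousFunction in
/-- Solvability of `μ g + (b · ∇ + c) J g = f` in bounded continuous functions. -/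
lemma exists_add_driftOp_eq (hs : 1 / 2 < s) (hδ : 0 < δ) (hμ : 0 < μ)
    (hsmall : driftBound V s δ Mb Mc ≤ μ / 2) (hbc : Continuous b) (hcc : Continuous c)
    (hb : ∀ x, ‖b x‖ ≤ Mb) (hc : ∀ x, |c x| ≤ Mc) (f : V →ᵇ ℝ) :
    ∃ g : V →ᵇ ℝ, ∀ x, μ * g x + driftOp s δ b c g x = f x := by
  have hn : ∀ (g : V →ᵇ ℝ) x, |g x| ≤ ‖g‖ := fun g x => g.norm_coe_le_norm x
  have hb' : ∀ (g : V →ᵇ ℝ) x, ‖μ⁻¹ * (f x - driftOp s δ b c g x)‖ ≤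
      μ⁻¹ * (‖f‖ + driftBound V s δ Mb Mc * ‖g‖) := fun g x => by
    rw [norm_mul, Real.norm_of_nonneg (by positivity)]
    refine mul_le_mul_of_nonneg_left ?_ (by positivity)
    exact (norm_sub_le _ _).trans (add_le_add (hn f x)
      (abs_driftOp_le hs hδ (hn g) (hb x) (hc x)))
  let T : (V →ᵇ ℝ) → (V →ᵇ ℝ) := fun g => BoundedContinuousFunction.ofNormedAddCommGroup
    (fun x => μ⁻¹ * (f x - driftOp s δ b c g x))
    (continuous_const.mul (f.continuous.sub
      (continuous_driftOp hs hδ hbc hcc g.continuous (hn g)))) _ (hb' g)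
  have hT : ContractingWith (1 / 2) T := by
    refine ⟨by rw [← NNReal.coe_lt_coe]; norm_num, LipschitzWith.of_dist_le_mul fun g g' => ?_⟩
    rw [BoundedContinuousFunction.dist_le (by positivity)]
    intro x
    have e : T g x - T g' x = -(μ⁻¹ * driftOp s δ b c (fun y => g y - g' y) x) := by
      rw [driftOp_sub hs hδ g.continuous (hn g) g'.continuous (hn g')]
      simp only [T, BoundedContinuousFunction.coe_ofNormedAddCommGroup]
      ring
    rw [Real.dist_eq, e, abs_neg, abs_mul, abs_of_pos (inv_pos.2 hμ)]
    have h1 := abs_driftOp_le (g := fun y => g y - g' y) (K := dist g g') hs hδ (fun y => by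
      rw [← Real.dist_eq]; exact BoundedContinuousFunction.dist_coe_le_dist y) (hb x) (hc x)
    calc _ ≤ μ⁻¹ * (μ / 2 * dist g g') := by
          refine mul_le_mul_of_nonneg_left (h1.trans ?_) (by positivity)
          gcongr
      _ = _ := by
          rw [← mul_assoc]
          congr 1
          rw [NNReal.coe_div, NNReal.coe_one, NNReal.coe_ofNat]
          field_simp
  refine ⟨hT.fixedPoint T, fun x => ?_⟩
  have h1 := congrArg (fun g : V →ᵇ ℝ => g x) hT.fixedPoint_isFixedPt
  set g := ContractingWith.fixedPoint T hT
  have h2 : μ⁻¹ * (f x - driftOp s δ b c g x) = g x := h1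
  rw [← h2]
  field_simp
  ring

end Perturbation

section Regular

set_option linter.unusedSectionVars false

variable {V : Type*} [NormedAddCommGroup V] [InnerProductSpace ℝ V] [FiniteDimensional ℝ V]
  [MeasurableSpace V] [BorelSpace V]

/-! ### The equation for functions with controlled second differences -/

/-- `u` is bounded and differentiable, and its second differences are of order `|z|^σ`,
uniformly. For `2s < σ ≤ 2` this suffices to evaluate `(-Δ)^s u`. -/
def HasSecondDiffBound (σ : ℝ) (u : V → ℝ) : Prop :=
  Differentiable ℝ u ∧ ∃ K A : ℝ, (∀ x, |u x| ≤ K) ∧ 0 ≤ A ∧ ∀ x z, |secondDiff u x z| ≤ A * ‖z‖ ^ σ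

variable {s δ σ κ Q c₀ Mb : ℝ} {u v : V → ℝ}

lemma HasSecondDiffBound.sub (hu : HasSecondDiffBound σ u) (hv : HasSecondDiffBound σ v) :
    HasSecondDiffBound σ (fun x => u x - v x) := by
  obtain ⟨hu', K, A, hK, hA0, hA⟩ := hu
  obtain ⟨hv', L, B, hL, hB0, hB⟩ := hv
  refine ⟨hu'.sub hv', K + L, A + B, fun x => (abs_sub _ _).trans (add_le_add (hK x) (hL x)),
    by positivity, fun x z => ?_⟩
  have e : secondDiff (fun x => u x - v x) x z = secondDiff u x z - secondDiff v x z := by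
    simp only [secondDiff]; ring
  rw [e, add_mul]
  exact (abs_sub _ _).trans (add_le_add (hA x z) (hB x z))

lemma HasSecondDiffBound.zero : HasSecondDiffBound σ (fun _ : V => (0 : ℝ)) :=
  ⟨by fun_prop, 0, 0, by simp, le_rfl, by simp [secondDiff]⟩

lemma fracGen_sub (hs : 0 < s) (hs1 : s < 1) (hδ : 0 ≤ δ) (hσ : 2 * s < σ) (hσ2 : σ ≤ 2)
    (hu : HasSecondDiffBound σ u) (hv : HasSecondDiffBound σ v) (x : V) :
    fracGen s δ (fun x => u x - v x) x = fracGen s δ u x - fracGen s δ v x := by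
  obtain ⟨hu', K, A, hK, hA0, hA⟩ := hu
  obtain ⟨hv', L, B, hL, hB0, hB⟩ := hv
  unfold fracGen
  rw [← integral_sub (integrableOn_fracGen hs hs1 hδ hσ hσ2 hu'.continuous hK hA0 (hA x))
    (integrableOn_fracGen hs hs1 hδ hσ hσ2 hv'.continuous hL hB0 (hB x))]
  refine setIntegral_congr_fun measurableSet_Ioi fun t ht => ?_
  simp only
  rw [heat_sub ht hu'.continuous hK hv'.continuous hL]
  ring

/-- The maximum principle for `κ (δ - Δ)^s u + b · ∇u + c u`. -/
lemma abs_le_of_abs_fracGen_le (hs : 0 < s) (hs1 : s < 1) (hδ : 0 ≤ δ) (hσ : 2 * s < σ)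
    (hσ2 : σ ≤ 2) (hκ : 0 < κ) (hc₀ : 0 < c₀) (hu : HasSecondDiffBound σ u) {b : V → V} {c : V → ℝ}
    (hb : ∀ x, ‖b x‖ ≤ Mb) (hc : ∀ x, c₀ ≤ c x)
    (heq : ∀ x, |κ * fracGen s δ u x + fderiv ℝ u x (b x) + c x * u x| ≤ Q) (x : V) :
    |u x| ≤ Q / (c₀ + κ * levyMass s δ) := by
  have hQ : 0 ≤ Q := (abs_nonneg _).trans (heq 0)
  have hz : HasSecondDiffBound σ (fun x => 0 - u x) := HasSecondDiffBound.zero.sub hu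
  have h0 : ∀ x, fracGen s δ (fun _ : V => (0 : ℝ)) x = 0 := fun x => by simp [fracGen, heat]
  refine abs_le.2 ⟨?_, ?_⟩
  · have hgen := fracGen_sub hs hs1 hδ hσ hσ2 HasSecondDiffBound.zero hu
    obtain ⟨hz', K, A, hK, hA0, hA⟩ := hz
    have := le_of_fracGen_le hs hs1 hδ hσ hσ2 hκ hc₀ hQ hK (fun x => (hz' x).hasFDerivAt) hA0 hA
      hb hc (fun x => ?_) x
    · linarith
    · rw [hgen, h0, fderiv_fun_sub (by fun_prop) (hu.1 x), fderiv_fun_const]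
      have := (abs_le.1 (heq x)).1
      simp only [Pi.zero_apply, zero_sub, neg_apply]
      linarith
  · obtain ⟨hu', K, A, hK, hA0, hA⟩ := hu
    exact le_of_fracGen_le hs hs1 hδ hσ hσ2 hκ hc₀ hQ hK (fun x => (hu' x).hasFDerivAt) hA0 hA
      hb hc (fun x => (abs_le.1 (heq x)).2) x

end Regular

section Solve

variable {n : ℕ}

/-! ### The Schauder estimate in Hölder spaces -/

lemma MemHolderSpace.hasSecondDiffBound {θ : ℝ} (h1 : 1 < θ) (h2 : θ ≠ 2) (h3 : θ < 3)
    {u : EuclideanSpace ℝ (Fin n) → ℝ} (hu : MemHolderSpace θ u) :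
    HasSecondDiffBound (min θ 2) u := by
  obtain ⟨K, A, hK, hd, hA0, hA⟩ := hu.exists_bounds h1 h2 h3
  exact ⟨fun x => (hd x).differentiableAt, K, A, hK, hA0, hA⟩

/-- In the class of functions with controlled second differences the equation can be written with
`fracGen`. -/
lemma isSolution_iff {s σ : ℝ} (hs : 0 < s) (hs1 : s < 1) (hσ : 2 * s < σ) (hσ2 : σ ≤ 2)
    {b : EuclideanSpace ℝ (Fin n) → EuclideanSpace ℝ (Fin n)}
    {c f u : EuclideanSpace ℝ (Fin n) → ℝ}
    (hu : HasSecondDiffBound σ u) :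
    IsSolution s b c f u ↔
      ∀ x, levyConst n s * fracGen s 0 u x + fderiv ℝ u x (b x) + c x * u x = f x := by
  obtain ⟨hu', K, A, hK, hA0, hA⟩ := hu
  have hL : ∀ x, HasFracLaplacianAt s u x (levyConst n s * fracGen s 0 u x) := fun x =>
    hasFracLaplacianAt_fracGen hs hs1 hσ hσ2 hu'.continuous hK hA0 (hA x)
  have hin : ∀ x, inner ℝ (b x) (∇ u x) = fderiv ℝ u x (b x) := fun x => by
    rw [real_inner_comm, inner_gradient_left]
  refine forall_congr' fun x => ⟨?_, fun h => ⟨hu' x, _, hL x, by rw [hin, h]⟩⟩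
  rintro ⟨-, ℓ, hℓ, h⟩
  rw [tendsto_nhds_unique (hL x).2 hℓ.2, ← hin, h]

lemma continuous_of_norm_sub_le_rpow {X Y : Type*} [NormedAddCommGroup X] [NormedAddCommGroup Y]
    {φ : X → Y} {N γ : ℝ} (hγ : 0 < γ) (h : ∀ x y, ‖φ x - φ y‖ ≤ N * ‖x - y‖ ^ γ) :
    Continuous φ := by
  refine continuous_iff_continuousAt.2 fun y => ?_
  rw [ContinuousAt, tendsto_iff_norm_sub_tendsto_zero]
  refine squeeze_zero (fun _ => norm_nonneg _) (fun x => h x y) ?_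
  have : Tendsto (fun x => N * ‖x - y‖ ^ γ) (𝓝 y) (𝓝 (N * ‖y - y‖ ^ γ)) := by
    have h1 : Continuous fun x : X => ‖x - y‖ := by fun_prop
    exact ((h1.rpow_const fun _ => Or.inr hγ.le).const_mul N).tendsto y
  simpa [Real.zero_rpow hγ.ne'] using this

set_option maxSynthPendingDepth 3 in
/-- The Schauder estimate for the Bessel potential. -/
lemma exists_schauder_besselPot {s δ α : ℝ} (hs : 1 / 2 < s) (hs1 : s < 1) (hδ : 0 < δ)
    (hα : 0 < α) (hα1 : α < 1) (h2 : 2 * s + α ≠ 2) :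
    ∃ C : ℝ≥0, ∀ (g : EuclideanSpace ℝ (Fin n) → ℝ) (N : ℝ≥0), (∀ x, |g x| ≤ N) →
      (∀ x y, |g x - g y| ≤ N * ‖x - y‖ ^ α) →
      MemHolderSpace (2 * s + α) (besselPot s δ g) ∧
        holderENorm (2 * s + α) (besselPot s δ g) ≤ ((C * N : ℝ≥0) : ℝ≥0∞) := by
  set C₀ := besselMass s δ with hC₀
  set C₁ := besselMass (s - 1 / 2) δ * heatConst (EuclideanSpace ℝ (Fin n)) with hC₁
  have e3 : ∀ K : ℝ≥0, (3 * K : ℝ≥0∞) = ((3 * K : ℝ≥0) : ℝ≥0∞) := fun K => by push_cast; rfl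
  have hb₀ : ∀ (g : EuclideanSpace ℝ (Fin n) → ℝ) (N : ℝ≥0), (∀ x, |g x| ≤ N) →
      ∀ x, ‖besselPot s δ g x‖ ≤ C₀ * N :=
    fun g N hK x => norm_besselPot_le (F := ℝ) (by linarith) hδ hK x
  have hb₁ : ∀ (g : EuclideanSpace ℝ (Fin n) → ℝ) (N : ℝ≥0), (∀ x, |g x| ≤ N) →
      ∀ x, ‖gradBessel s δ g x‖ ≤ C₁ * N :=
    fun g N hK x => (norm_gradBessel_le (F := ℝ) hs hδ hK x).trans_eq (by rw [hC₁]; ring)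
  rcases lt_or_gt_of_ne h2 with h2 | h2
  · set C₂ := 2 * heatConst (EuclideanSpace ℝ (Fin n)) ^ 2 *
      (1 / (s + (α - 1) / 2) + 1 / (1 / 2 - (s + (α - 1) / 2)))
    set C := (max C₀ (max C₁ C₂)).toNNReal with hC
    have hC0 : C₀ ≤ C := (le_max_left _ _).trans (Real.le_coe_toNNReal _)
    have hC1 : C₁ ≤ C := ((le_max_left _ _).trans (le_max_right _ _)).trans
      (Real.le_coe_toNNReal _)
    have hC2 : C₂ ≤ C := ((le_max_right _ _).trans (le_max_right _ _)).trans
      (Real.le_coe_toNNReal _)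
    refine ⟨3 * C, fun g N hK hH => ?_⟩
    have hg : Continuous g := continuous_of_norm_sub_le_rpow hα hH
    rw [mul_assoc, ← e3]
    refine memHolderSpace_of_one_lt (by linarith) h2 (hasFDerivAt_besselPot (F := ℝ) hs hδ hg hK)
      (continuous_gradBessel (F := ℝ) hs hδ hg hK) (fun x => ?_) (fun x => ?_) (fun x y => ?_)
    · exact (hb₀ g N hK x).trans (by push_cast; gcongr)
    · exact (hb₁ g N hK x).trans (by push_cast; gcongr)
    · refine (norm_gradBessel_sub_le_of_holder (F := ℝ) hδ hα.le hα1.le hs h2 N.coe_nonneg hg hK hH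
        x y).trans ?_
      push_cast
      refine mul_le_mul_of_nonneg_right ?_ (by positivity)
      calc _ = C₂ * N := by ring
        _ ≤ _ := by gcongr
  · set C₂ := besselMass (s + (α - 2) / 2) δ * (2 * heatConst (EuclideanSpace ℝ (Fin n)) ^ 2)
    set C₃ := 8 * heatConst (EuclideanSpace ℝ (Fin n)) ^ 3 *
      (1 / (s + (α - 2) / 2) + 1 / (1 / 2 - (s + (α - 2) / 2)))
    set C := (max (max C₀ C₁) (max C₂ C₃)).toNNReal with hC
    have hC0 : C₀ ≤ C := ((le_max_left _ _).trans (le_max_left _ _)).trans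
      (Real.le_coe_toNNReal _)
    have hC1 : C₁ ≤ C := ((le_max_right _ _).trans (le_max_left _ _)).trans
      (Real.le_coe_toNNReal _)
    have hC2 : C₂ ≤ C := ((le_max_left _ _).trans (le_max_right _ _)).trans
      (Real.le_coe_toNNReal _)
    have hC3 : C₃ ≤ C := ((le_max_right _ _).trans (le_max_right _ _)).trans
      (Real.le_coe_toNNReal _)
    refine ⟨3 * C, fun g N hK hH => ?_⟩
    have hg : Continuous g := continuous_of_norm_sub_le_rpow hα hH
    have hH' := norm_hessBessel_sub_le_of_holder (F := ℝ) hδ hα.le hα1.le h2 (by linarith)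
      N.coe_nonneg hg hK hH
    have hcont : Continuous (hessBessel s δ g) :=
      continuous_of_norm_sub_le_rpow (sub_pos.2 h2) hH'
    rw [mul_assoc, ← e3]
    refine memHolderSpace_of_two_lt h2 (by linarith) (hasFDerivAt_besselPot (F := ℝ) hs hδ hg hK)
      (hasFDerivAt_gradBessel (F := ℝ) hδ hα.le hα1.le h2 N.coe_nonneg hg hK hH)
      hcont
      (fun x => ?_) (fun x => ?_) (fun x => ?_) (fun x y => ?_)
    · exact (hb₀ g N hK x).trans (by push_cast; gcongr)
    · exact (hb₁ g N hK x).trans (by push_cast; gcongr)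
    · refine (norm_hessBessel_le (F := ℝ) hδ hα.le hα1.le h2 N.coe_nonneg hg hK hH x).trans ?_
      push_cast
      calc _ = C₂ * N := by ring
        _ ≤ _ := by gcongr
    · refine (hH' x y).trans ?_
      push_cast
      refine mul_le_mul_of_nonneg_right ?_ (by positivity)
      calc _ = C₃ * N := by ring
        _ ≤ _ := by gcongr

end Solve

/-! ### Existence and the a priori estimate -/

/-- A continuous map that preserves `P` and contracts distances between points satisfying `P` has
a fixed point. -/
lemma exists_fixedPoint_of_contracting_on {X : Type*} [MetricSpace X] [CompleteSpace X] {Ψ : X → X}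
    (hΨ : Continuous Ψ) {P : X → Prop} (hP : ∀ x, P x → P (Ψ x)) {q : ℝ} (hq0 : 0 ≤ q) (hq1 : q < 1)
    (hq : ∀ x y, P x → P y → dist (Ψ x) (Ψ y) ≤ q * dist x y) {x₀ : X} (hx₀ : P x₀) :
    ∃ x, Ψ x = x := by
  have hPk : ∀ k, P (Ψ^[k] x₀) := fun k => by
    induction k with
    | zero => exact hx₀
    | succ k ih => rw [Function.iterate_succ_apply']; exact hP _ ih
  have hd : ∀ k, dist (Ψ^[k] x₀) (Ψ^[k + 1] x₀) ≤ dist x₀ (Ψ x₀) * q ^ k := fun k => by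
    induction k with
    | zero => simp
    | succ k ih =>
      have h1 := hq _ _ (hPk k) (hPk (k + 1))
      rw [← Function.iterate_succ_apply' Ψ, ← Function.iterate_succ_apply' Ψ] at h1
      calc _ ≤ q * dist (Ψ^[k] x₀) (Ψ^[k + 1] x₀) := h1
        _ ≤ q * (dist x₀ (Ψ x₀) * q ^ k) := by gcongr
        _ = _ := by ring
  obtain ⟨x, hx⟩ := cauchySeq_tendsto_of_complete (cauchySeq_of_le_geometric q _ hq1 hd)
  exact ⟨x, isFixedPt_of_tendsto_iterate hx hΨ.continuousAt⟩

section Solve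

variable {n : ℕ}

/-- The hypotheses on the drift `b` and the zeroth-order coefficient `c`: both are bounded and
`α`-Hölder, with constants `Mb` and `Mc`, and `c ≥ c₀`. -/
structure AdmissibleCoeffs (α Mb Mc c₀ : ℝ)
    (b : EuclideanSpace ℝ (Fin n) → EuclideanSpace ℝ (Fin n)) (c : EuclideanSpace ℝ (Fin n) → ℝ) :
    Prop where
  norm_b_le : ∀ x, ‖b x‖ ≤ Mb
  norm_b_sub_le : ∀ x y, ‖b x - b y‖ ≤ Mb * ‖x - y‖ ^ α
  abs_c_le : ∀ x, |c x| ≤ Mc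
  abs_c_sub_le : ∀ x y, |c x - c y| ≤ Mc * ‖x - y‖ ^ α
  le_c : ∀ x, c₀ ≤ c x

variable {s δ α Mb Mc c₀ K H : ℝ}
  {b : EuclideanSpace ℝ (Fin n) → EuclideanSpace ℝ (Fin n)} {c g : EuclideanSpace ℝ (Fin n) → ℝ}

lemma memHolderSpace_besselPot (hs : 1 / 2 < s) (hs1 : s < 1) (hδ : 0 < δ) (hα : 0 < α)
    (hα1 : α < 1) (h2 : 2 * s + α ≠ 2) (hK : ∀ x, |g x| ≤ K)
    (hH : ∀ x y, |g x - g y| ≤ H * ‖x - y‖ ^ α) :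
    MemHolderSpace (2 * s + α) (besselPot s δ g) := by
  obtain ⟨C, hC⟩ := exists_schauder_besselPot (n := n) hs hs1 hδ hα hα1 h2
  refine (hC g (max K H).toNNReal (fun x => ?_) fun x y => ?_).1
  · exact (hK x).trans ((le_max_left _ _).trans (Real.le_coe_toNNReal _))
  · refine (hH x y).trans ?_
    gcongr
    exact (le_max_right _ _).trans (Real.le_coe_toNNReal _)

/-- On potentials `u` of Hölder functions `g`, the operator `(δ - Δ)^s + b · ∇ + c` is a
perturbation of a multiple of the identity acting on `g`. -/
lemma fracGen_besselPot_add_eq (hs : 1 / 2 < s) (hs1 : s < 1) (hδ : 0 < δ) (hα : 0 < α)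
    (hα1 : α < 1) (h2 : 2 * s + α ≠ 2) (hK : ∀ x, |g x| ≤ K)
    (hH : ∀ x y, |g x - g y| ≤ H * ‖x - y‖ ^ α) (κ : ℝ) (x : EuclideanSpace ℝ (Fin n)) :
    κ * fracGen s δ (besselPot s δ g) x + fderiv ℝ (besselPot s δ g) x (b x) +
      c x * besselPot s δ g x = κ * marchaudConst s * g x + driftOp s δ b c g x := by
  have hg : Continuous g := continuous_of_norm_sub_le_rpow hα hH
  obtain ⟨-, L, A, -, hA0, hA⟩ := (memHolderSpace_besselPot hs hs1 hδ hα hα1 h2 hK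
    hH).hasSecondDiffBound (by linarith) h2 (by linarith)
  have hH0 : ∀ x y, |g x - g y| ≤ max H 0 * ‖x - y‖ ^ α := fun x y => (hH x y).trans (by
    gcongr; exact le_max_left _ _)
  rw [fracGen_besselPot hs hs1 hδ hα hα1.le (le_max_right _ _) hg hK hH0
    (lt_min (by linarith) (by linarith)) (min_le_right _ _) hA0 (hA x),
    (hasFDerivAt_besselPot (F := ℝ) hs hδ hg hK x).fderiv]
  unfold driftOp
  ring

/-- Potentials of bounded functions are Hölder continuous. -/
lemma abs_besselPot_sub_le (hs : 1 / 2 < s) (hδ : 0 < δ) (hα : 0 ≤ α) (hα1 : α ≤ 1)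
    (hg : Continuous g) (hK : ∀ x, |g x| ≤ K) (x y : EuclideanSpace ℝ (Fin n)) :
    |besselPot s δ g x - besselPot s δ g y| ≤
      2 * (driftBound (EuclideanSpace ℝ (Fin n)) s δ 1 1 * K) * ‖x - y‖ ^ α := by
  have hK0 : 0 ≤ K := (abs_nonneg _).trans (hK 0)
  have h1 := besselMass_nonneg (a := s) (δ := δ)
  have h2 := besselMass_nonneg (a := s - 1 / 2) (δ := δ)
  have h3 := heatConst_pos (V := EuclideanSpace ℝ (Fin n))
  refine norm_sub_le_two_mul_rpow (φ := besselPot s δ g) hα hα1 (fun x => ?_) (fun x y => ?_) x y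
  · refine (norm_besselPot_le (F := ℝ) (by linarith) hδ hK x).trans ?_
    unfold driftBound
    gcongr
    have : 0 ≤ besselMass (s - 1 / 2) δ * heatConst (EuclideanSpace ℝ (Fin n)) := by positivity
    linarith
  · refine norm_sub_le_of_hasFDerivAt (hasFDerivAt_besselPot (F := ℝ) hs hδ hg hK) (fun x => ?_) x y
    refine (norm_gradBessel_le (F := ℝ) hs hδ hK x).trans ?_
    rw [← mul_assoc]
    unfold driftBound
    gcongr
    linarith

open BoundedContinuousFunction in
/-- Solvability: the equation for `u = J g` is rewritten as a fixed point problem, with the bounded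
operator `(δ - Δ)^s - (-Δ)^s` on the right hand side. The maximum principle makes it contracting. -/
lemma exists_besselPot_solution (hs : 1 / 2 < s) (hs1 : s < 1) (hδ : 0 < δ) (hα : 0 < α)
    (hα1 : α < 1) (h2 : 2 * s + α ≠ 2) (hc₀ : 0 < c₀) (hbc : AdmissibleCoeffs α Mb Mc c₀ b c)
    {κ : ℝ} (hκ : 0 < κ)
    (hsmall : driftBound (EuclideanSpace ℝ (Fin n)) s δ Mb Mc ≤ κ * marchaudConst s / 2)
    {f : EuclideanSpace ℝ (Fin n) → ℝ}
    (hf : ∀ x, |f x| ≤ K) (hfα : ∀ x y, |f x - f y| ≤ K * ‖x - y‖ ^ α) :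
    ∃ (g : EuclideanSpace ℝ (Fin n) →ᵇ ℝ) (H : ℝ), (∀ x y, |g x - g y| ≤ H * ‖x - y‖ ^ α) ∧
      ∀ x, κ * marchaudConst s * g x + driftOp s δ b c g x =
        f x + κ * levyPot s δ (besselPot s δ g) x := by
  have hs0 : 0 < s := by linarith
  have hμ : 0 < κ * marchaudConst s := mul_pos hκ (marchaudConst_pos hs0 hs1)
  set μ := κ * marchaudConst s with hμdef
  have hℓ := levyMass_nonneg (s := s) hδ.le
  have hm := besselMass_nonneg (a := s) (δ := δ)
  have hbcont : Continuous b := continuous_of_norm_sub_le_rpow hα hbc.norm_b_sub_le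
  have hccont : Continuous c := continuous_of_norm_sub_le_rpow hα hbc.abs_c_sub_le
  have hn : ∀ (g : EuclideanSpace ℝ (Fin n) →ᵇ ℝ) x, |g x| ≤ ‖g‖ := fun g x => g.norm_coe_le_norm x
  have hdist : ∀ (u v : EuclideanSpace ℝ (Fin n) →ᵇ ℝ) x, |u x - v x| ≤ dist u v := fun u v x => by
    rw [← Real.dist_eq]; exact BoundedContinuousFunction.dist_coe_le_dist x
  choose R hR using exists_add_driftOp_eq (δ := δ) hs hδ hμ hsmall hbcont hccont hbc.norm_b_le
    hbc.abs_c_le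
  have hRsub : ∀ (F G : EuclideanSpace ℝ (Fin n) →ᵇ ℝ) x, μ * (R F x - R G x) +
      driftOp s δ b c (fun y => R F y - R G y) x = F x - G x := fun F G x => by
    rw [driftOp_sub hs hδ (R F).continuous (hn _) (R G).continuous (hn _), ← hR F, ← hR G]
    ring
  -- the right hand side as a function of `u`
  let T : (EuclideanSpace ℝ (Fin n) →ᵇ ℝ) → (EuclideanSpace ℝ (Fin n) →ᵇ ℝ) := fun u =>
    BoundedContinuousFunction.ofNormedAddCommGroup
    (fun x => f x + κ * levyPot s δ u x)
    ((continuous_of_norm_sub_le_rpow (φ := f) hα hfα).add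
      ((continuous_levyPot hs0 hs1 hδ.le u.continuous (hn u)).const_mul κ))
    (K + κ * (levyMass s δ * ‖u‖)) fun x => by
      refine (norm_add_le _ _).trans (add_le_add (hf x) ?_)
      rw [norm_mul, Real.norm_of_nonneg hκ.le]
      exact mul_le_mul_of_nonneg_left (abs_levyPot_le hs0 hs1 hδ.le (hn u) x) hκ.le
  have hTsub : ∀ u v x, |T u x - T v x| ≤ κ * (levyMass s δ * dist u v) := fun u v x => by
    have e : T u x - T v x = κ * levyPot s δ (fun y => u y - v y) x := by
      rw [levyPot_sub hs0 hs1 hδ.le u.continuous (hn u) v.continuous (hn v)]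
      simp only [T, BoundedContinuousFunction.coe_ofNormedAddCommGroup]
      ring
    rw [e, abs_mul, abs_of_pos hκ]
    exact mul_le_mul_of_nonneg_left (abs_levyPot_le hs0 hs1 hδ.le (hdist u v) x) hκ.le
  let J : (EuclideanSpace ℝ (Fin n) →ᵇ ℝ) → (EuclideanSpace ℝ (Fin n) →ᵇ ℝ) := fun g =>
    BoundedContinuousFunction.ofNormedAddCommGroup
    (besselPot s δ g) (continuous_besselPot hs hδ g.continuous (hn g)) (besselMass s δ * ‖g‖)
    (norm_besselPot_le (F := ℝ) hs0 hδ (hn g))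
  have hJsub : ∀ g h x, J g x - J h x = besselPot s δ (fun y => g y - h y) x := fun g h x =>
    (besselPot_sub (F := ℝ) hs0 hδ g.continuous (hn g) h.continuous (hn h) x).symm
  let P : (EuclideanSpace ℝ (Fin n) →ᵇ ℝ) → Prop := fun u =>
    ∃ H : ℝ, ∀ x y, |u x - u y| ≤ H * ‖x - y‖ ^ α
  have hPJ : ∀ g, P (J g) := fun g =>
    ⟨_, abs_besselPot_sub_le hs hδ hα.le hα1.le g.continuous (hn g)⟩
  have hPT : ∀ u, P u → P (T u) := by
    rintro u ⟨H, hH⟩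
    refine ⟨K + κ * (levyMass s δ * H), fun x y => ?_⟩
    have e : T u x - T u y = (f x - f y) + κ * (levyPot s δ u x - levyPot s δ u y) := by
      simp only [T, BoundedContinuousFunction.coe_ofNormedAddCommGroup]; ring
    have h1 := abs_levyPot_sub_le (x := x) (y := y) hs0 hs1 hδ.le u.continuous (hn u)
      (fun z => by simpa using hH (x - z) (y - z))
    rw [e]
    refine (abs_add_le _ _).trans ?_
    rw [abs_mul, abs_of_pos hκ]
    have := mul_le_mul_of_nonneg_left h1 hκ.le
    have := hfα x y
    linarith
  have hPR : ∀ F, P F → P (R F) := by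
    rintro F ⟨H, hH⟩
    refine ⟨_, abs_sub_le_of_add_driftOp_eq (N := max ‖F‖ H) hs hδ hμ hsmall hbc.norm_b_le
      hbc.abs_c_le hbc.norm_b_sub_le hbc.abs_c_sub_le (R F).continuous (hn _) (hR F)
      (fun x => (hn F x).trans (le_max_left _ _)) fun x y => (hH x y).trans ?_⟩
    gcongr
    exact le_max_right _ _
  have hcont : Continuous fun u => J (R (T u)) := by
    refine (LipschitzWith.of_dist_le_mul (K := (besselMass s δ * (2 / μ * (κ *
      levyMass s δ))).toNNReal) fun u v => ?_).continuous
    rw [Real.coe_toNNReal _ (by positivity), BoundedContinuousFunction.dist_le (by positivity)]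
    intro x
    rw [Real.dist_eq, hJsub]
    refine (norm_besselPot_le (F := ℝ) hs0 hδ (K := 2 / μ * (κ * (levyMass s δ * dist u v)))
      (fun y => ?_) x).trans_eq (by ring)
    refine abs_le_of_abs_add_driftOp_le (g := fun y => R (T u) y - R (T v) y) hs hδ hμ hsmall
      hbc.norm_b_le hbc.abs_c_le (fun y => hdist _ _ y) (fun y => ?_) y
    rw [hRsub]
    exact hTsub u v y
  -- contraction for the original sup norm, without smallness of `κ * levyMass s δ`
  have hq : ∀ u v, P u → P v → dist (J (R (T u))) (J (R (T v))) ≤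
      κ * levyMass s δ / (c₀ + κ * levyMass s δ) * dist u v := by
    intro u v hu hv
    obtain ⟨H₁, hH₁⟩ := hPR _ (hPT u hu)
    obtain ⟨H₂, hH₂⟩ := hPR _ (hPT v hv)
    rw [BoundedContinuousFunction.dist_le (by positivity)]
    intro x
    rw [Real.dist_eq, hJsub]
    have hK' := hdist (R (T u)) (R (T v))
    -- for Hölder data the difference of the potentials is admissible in the maximum principle
    have hH' : ∀ x y, |(R (T u) x - R (T v) x) - (R (T u) y - R (T v) y)| ≤
        (H₁ + H₂) * ‖x - y‖ ^ α := fun x y => by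
      rw [sub_sub_sub_comm, add_mul]
      exact (abs_sub _ _).trans (add_le_add (hH₁ x y) (hH₂ x y))
    have hmem := memHolderSpace_besselPot (g := fun y => R (T u) y - R (T v) y) hs hs1 hδ hα hα1 h2
      hK' hH'
    refine (abs_le_of_abs_fracGen_le (b := b) (c := c) (Q := κ * (levyMass s δ * dist u v)) hs0 hs1
      hδ.le (lt_min (by linarith) (by linarith)) (min_le_right _ _) hκ hc₀
      (hmem.hasSecondDiffBound (by linarith) h2 (by linarith)) hbc.norm_b_le hbc.le_c
      (fun y => ?_) x).trans_eq (by ring)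
    rw [fracGen_besselPot_add_eq hs hs1 hδ hα hα1 h2 hK' hH', hRsub]
    exact hTsub u v y
  have hq1 : κ * levyMass s δ / (c₀ + κ * levyMass s δ) < 1 := by
    rw [div_lt_one (by positivity)]; linarith
  obtain ⟨u, hu⟩ := exists_fixedPoint_of_contracting_on hcont (fun u _ => hPJ (R (T u)))
    (by positivity) hq1 hq (x₀ := 0) ⟨0, by simp⟩
  have hPu : P u := hu ▸ hPJ _
  obtain ⟨H, hH⟩ := hPR _ (hPT u hPu)
  refine ⟨R (T u), H, hH, fun x => ?_⟩
  have e : besselPot s δ (R (T u)) = u :=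
    congrArg (fun v : EuclideanSpace ℝ (Fin n) →ᵇ ℝ => (v : EuclideanSpace ℝ (Fin n) → ℝ)) hu
  rw [e]
  exact hR (T u) x

lemma levyMass_zero : levyMass s 0 = 0 := by simp [levyMass]

/-- Existence of a solution, with the Schauder estimate. The maximum principle bounds `u` by
`N / c₀`, which bounds `(δ - Δ)^s u - (-Δ)^s u`; then `u = J g` with `g` bounded, so `u` is Hölder
continuous, hence so is `g`, and the Schauder estimate for potentials applies. -/
theorem exists_solution (hs : 1 / 2 < s) (hs1 : s < 1) (hα : 0 < α) (hα1 : α < 1)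
    (h2 : 2 * s + α ≠ 2) (hc₀ : 0 < c₀) (Mb Mc : ℝ) {κ : ℝ} (hκ : 0 < κ) :
    ∃ C : ℝ≥0, ∀ (b : EuclideanSpace ℝ (Fin n) → EuclideanSpace ℝ (Fin n))
      (c : EuclideanSpace ℝ (Fin n) → ℝ), AdmissibleCoeffs α Mb Mc c₀ b c →
      ∀ (f : EuclideanSpace ℝ (Fin n) → ℝ) (N : ℝ≥0), (∀ x, |f x| ≤ N) →
      (∀ x y, |f x - f y| ≤ N * ‖x - y‖ ^ α) →
      ∃ u : EuclideanSpace ℝ (Fin n) → ℝ, MemHolderSpace (2 * s + α) u ∧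
        (∀ x, κ * fracGen s 0 u x + fderiv ℝ u x (b x) + c x * u x = f x) ∧
        holderENorm (2 * s + α) u ≤ ((C * N : ℝ≥0) : ℝ≥0∞) := by
  have hs0 : 0 < s := by linarith
  have hμ : 0 < κ * marchaudConst s := mul_pos hκ (marchaudConst_pos hs0 hs1)
  set μ := κ * marchaudConst s with hμdef
  obtain ⟨δ, hsmall, hδ⟩ :=
    (((tendsto_driftBound (V := EuclideanSpace ℝ (Fin n)) hs Mb Mc).eventually_le_const
    (show 0 < μ / 2 by positivity)).and (eventually_gt_atTop 0)).exists
  obtain ⟨C, hC⟩ := exists_schauder_besselPot (n := n) hs hs1 hδ hα hα1 h2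
  have hℓ := levyMass_nonneg (s := s) hδ.le
  have hD := driftBound_nonneg (V := EuclideanSpace ℝ (Fin n)) (s := s) (δ := δ)
    zero_le_one zero_le_one
  set ℓ := levyMass s δ
  set D := driftBound (EuclideanSpace ℝ (Fin n)) s δ 1 1
  set a₁ := 1 + κ * ℓ / c₀ with ha₁
  set a₂ := a₁ + κ * ℓ * (4 * D * a₁ / μ) with ha₂
  have ha₁0 : 0 ≤ a₁ := by positivity
  have ha₂0 : 0 ≤ a₂ := by positivity
  refine ⟨C * (4 / μ * a₂).toNNReal, fun b c hbc f N hf hfα => ?_⟩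
  have hN := N.coe_nonneg
  obtain ⟨g, H, hH, hg⟩ := exists_besselPot_solution hs hs1 hδ hα hα1 h2 hc₀ hbc hκ hsmall hf hfα
  have hgK : ∀ x, |g x| ≤ ‖g‖ := fun x => g.norm_coe_le_norm x
  have hmem := memHolderSpace_besselPot hs hs1 hδ hα hα1 h2 hgK hH
  have hsd := hmem.hasSecondDiffBound (by linarith) h2 (by linarith)
  have hσ : 2 * s < min (2 * s + α) 2 := lt_min (by linarith) (by linarith)
  set u := besselPot s δ g with hu
  have heq : ∀ x, κ * fracGen s 0 u x + fderiv ℝ u x (b x) + c x * u x = f x := by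
    obtain ⟨hd, K, A, hK, hA0, hA⟩ := hsd
    intro x
    have h1 := fracGen_besselPot_add_eq (b := b) (c := c) hs hs1 hδ hα hα1 h2 hgK hH κ x
    rw [hg, ← hu, fracGen_eq_add_levyPot hs0 hs1 hδ.le hσ (min_le_right _ _) hd.continuous hK hA0
      (hA x)] at h1
    linarith
  refine ⟨u, hmem, heq, ?_⟩
  have huN : ∀ x, |u x| ≤ N / c₀ := fun x => by
    have := abs_le_of_abs_fracGen_le hs0 hs1 le_rfl hσ (min_le_right _ _) hκ hc₀ hsd hbc.norm_b_le
      hbc.le_c (fun x => by rw [heq]; exact hf x) x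
    rwa [levyMass_zero, mul_zero, add_zero] at this
  have huc : Continuous u := hsd.1.continuous
  have hF : ∀ x, |f x + κ * levyPot s δ u x| ≤ a₁ * N := fun x => by
    refine (abs_add_le _ _).trans ((add_le_add (hf x) ?_).trans_eq
      (by rw [ha₁]; ring : (N : ℝ) + κ * (ℓ * (N / c₀)) = a₁ * N))
    rw [abs_mul, abs_of_pos hκ]
    exact mul_le_mul_of_nonneg_left (abs_levyPot_le hs0 hs1 hδ.le huN x) hκ.le
  have hgN : ∀ x, |g x| ≤ 2 / μ * (a₁ * N) := abs_le_of_abs_add_driftOp_le hs hδ hμ hsmall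
    hbc.norm_b_le hbc.abs_c_le hgK fun x => by rw [hg]; exact hF x
  have huα := abs_besselPot_sub_le hs hδ hα.le hα1.le g.continuous hgN
  have ha₁₂ : a₁ ≤ a₂ := by
    have : 0 ≤ κ * ℓ * (4 * D * a₁ / μ) := by positivity
    linarith
  have hFα : ∀ x y, |(f x + κ * levyPot s δ u x) - (f y + κ * levyPot s δ u y)| ≤
      a₂ * N * ‖x - y‖ ^ α := fun x y => by
    have h1 := abs_levyPot_sub_le (x := x) (y := y) hs0 hs1 hδ.le huc huN
      (fun z => by simpa using huα (x - z) (y - z))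
    rw [add_sub_add_comm, ← mul_sub]
    refine (abs_add_le _ _).trans ?_
    rw [abs_mul, abs_of_pos hκ]
    have h3 := mul_le_mul_of_nonneg_left h1 hκ.le
    have h4 : (1 + κ * ℓ * (4 * D * a₁ / μ)) * (N * ‖x - y‖ ^ α) ≤ a₂ * (N * ‖x - y‖ ^ α) := by
      refine mul_le_mul_of_nonneg_right ?_ (by positivity)
      have : 0 ≤ κ * ℓ / c₀ := by positivity
      linarith
    calc _ ≤ N * ‖x - y‖ ^ α + κ * (ℓ * (2 * (D * (2 / μ * (a₁ * N))) * ‖x - y‖ ^ α)) :=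
          add_le_add (hfα x y) h3
      _ = (1 + κ * ℓ * (4 * D * a₁ / μ)) * (N * ‖x - y‖ ^ α) := by ring
      _ ≤ _ := h4.trans_eq (by ring)
  have hgα := abs_sub_le_of_add_driftOp_eq hs hδ hμ hsmall hbc.norm_b_le hbc.abs_c_le
    hbc.norm_b_sub_le hbc.abs_c_sub_le g.continuous hgK hg
    (fun x => (hF x).trans (mul_le_mul_of_nonneg_right ha₁₂ hN)) hFα
  have hcst : (((4 / μ * a₂).toNNReal * N : ℝ≥0) : ℝ) = 4 / μ * (a₂ * N) := by
    rw [NNReal.coe_mul, Real.coe_toNNReal _ (by positivity)]; ring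
  have := (hC g ((4 / μ * a₂).toNNReal * N) (fun x => ?_) (fun x y => ?_)).2
  · rwa [← mul_assoc] at this
  · rw [hcst]
    refine (hgN x).trans ?_
    gcongr
    norm_num
  · rw [hcst]; exact hgα x y

/-- Uniqueness, by the maximum principle. -/
theorem solution_unique {κ : ℝ} (hs : 1 / 2 < s) (hs1 : s < 1) (hα : 0 < α) (hα1 : α < 1)
    (h2 : 2 * s + α ≠ 2) (hc₀ : 0 < c₀) (hbc : AdmissibleCoeffs α Mb Mc c₀ b c) (hκ : 0 < κ)
    {f u v : EuclideanSpace ℝ (Fin n) → ℝ} (hu : MemHolderSpace (2 * s + α) u)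
    (hv : MemHolderSpace (2 * s + α) v)
    (hequ : ∀ x, κ * fracGen s 0 u x + fderiv ℝ u x (b x) + c x * u x = f x)
    (heqv : ∀ x, κ * fracGen s 0 v x + fderiv ℝ v x (b x) + c x * v x = f x) : u = v := by
  have hs0 : 0 < s := by linarith
  have hσ : 2 * s < min (2 * s + α) 2 := lt_min (by linarith) (by linarith)
  have hu' := hu.hasSecondDiffBound (by linarith) h2 (by linarith)
  have hv' := hv.hasSecondDiffBound (by linarith) h2 (by linarith)
  funext x
  have := abs_le_of_abs_fracGen_le (Q := 0) hs0 hs1 le_rfl hσ (min_le_right _ _) hκ hc₀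
    (hu'.sub hv') hbc.norm_b_le hbc.le_c (fun x => ?_) x
  · rw [zero_div] at this
    exact sub_eq_zero.1 (abs_nonpos_iff.1 this)
  · rw [fracGen_sub hs0 hs1 le_rfl hσ (min_le_right _ _) hu' hv',
      fderiv_fun_sub (hu'.1 x) (hv'.1 x), sub_apply, abs_nonpos_iff]
    linarith [hequ x, heqv x]

end Solve
end FracDrift

theorem mainTheorem9 (n : ℕ) (hn : 1 ≤ n) (s : ℝ) (hs : 1 / 2 < s) (hs' : s < 1)
    (α : ℝ) (hα : 0 < α) (hα' : α < 1) (hsα : ∀ m : ℤ, 2 * s + α ≠ m)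
    (c₀ : ℝ) (hc₀ : 0 < c₀) (Mb Mc : ℝ≥0) :
    ∃ C : ℝ≥0, 0 < C ∧
      ∀ (b : EuclideanSpace ℝ (Fin n) → EuclideanSpace ℝ (Fin n))
        (c : EuclideanSpace ℝ (Fin n) → ℝ),
        FracDrift.MemHolderSpace α b → FracDrift.holderENorm α b ≤ Mb →
        FracDrift.MemHolderSpace α c → FracDrift.holderENorm α c ≤ Mc →
        (∀ x, c₀ ≤ c x) →
        ∀ f : EuclideanSpace ℝ (Fin n) → ℝ, FracDrift.MemHolderSpace α f →
          (∃! u : EuclideanSpace ℝ (Fin n) → ℝ,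
            FracDrift.MemHolderSpace (2 * s + α) u ∧ FracDrift.IsSolution s b c f u) ∧
          ∀ u : EuclideanSpace ℝ (Fin n) → ℝ,
            FracDrift.MemHolderSpace (2 * s + α) u → FracDrift.IsSolution s b c f u →
            FracDrift.holderENorm (2 * s + α) u ≤ C * FracDrift.holderENorm α f := by
  have hs0 : 0 < s := by linarith
  have h2 : 2 * s + α ≠ 2 := by exact_mod_cast hsα 2
  have hκ := FracDrift.levyConst_pos (n := n) hs0 hs'
  have hσ : 2 * s < min (2 * s + α) 2 := lt_min (by linarith) (by linarith)
  have hiff : ∀ {b c f u}, FracDrift.MemHolderSpace (2 * s + α) u →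
      (FracDrift.IsSolution (n := n) s b c f u ↔ _) := fun hu =>
    FracDrift.isSolution_iff hs0 hs' hσ (min_le_right _ _)
      (hu.hasSecondDiffBound (by linarith) h2 (by linarith))
  obtain ⟨C, hC⟩ := FracDrift.exists_solution (n := n) hs hs' hα hα' h2 hc₀ Mb Mc hκ
  refine ⟨C + 1, by positivity, fun b c _ hbM _ hcM hc f hf => ?_⟩
  have hb' := FracDrift.holderENorm_bounds hα hα' hbM
  have hc' := FracDrift.holderENorm_bounds hα hα' hcM
  have hbc : FracDrift.AdmissibleCoeffs α Mb Mc c₀ b c := ⟨hb'.1, hb'.2, hc'.1, hc'.2, hc⟩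
  have hN := ENNReal.coe_toNNReal hf.2.ne
  set N := (FracDrift.holderENorm α f).toNNReal
  have hf' := FracDrift.holderENorm_bounds hα hα' hN.ge
  obtain ⟨u, hu, heq, hle⟩ := hC b c hbc f N hf'.1 hf'.2
  have huniq : ∀ v, FracDrift.MemHolderSpace (2 * s + α) v → FracDrift.IsSolution s b c f v →
      v = u := fun v hv hsol =>
    FracDrift.solution_unique hs hs' hα hα' h2 hc₀ hbc hκ hv hu ((hiff hv).1 hsol) heq
  refine ⟨⟨u, ⟨hu, (hiff hu).2 heq⟩, fun v hv => huniq v hv.1 hv.2⟩, fun v hv hsol => ?_⟩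
  rw [huniq v hv hsol, ← hN]
  refine hle.trans ?_
  rw [← ENNReal.coe_mul, ENNReal.coe_le_coe]
  gcongr
  exact le_self_add
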